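/- Let $n\ge 1$, $a\in(-1,1)$, $s=\frac{1-a}{2}$. Write $X=(x,y)\in\mathbb R^n\times\mathbb R$, $B_r=\{|X|<r\}\subset\mathbb R^{n+1}$, $B_r^*=\{|x|<r\}\subset\mathbb R^n$, and $L_a v=\operatorname{div}(|y|^a\nabla v)$. For an open set $\Omega\subset\mathbb R^{n+1}$ symmetric in $y$ and a function $g$ of $x$, we say that $u$ solves the thin obstacle problem in $\Omega$ with right-hand side $g$ if $u$ is continuous in $\Omega$, $u\in W^{1,2}_{loc}(\Omega,|y|^a)$, and, with $\Lambda(u)=\{(x,0)\in\Omega: u(x,0)=0\}$, $$u(x,0)\ge 0,\qquad u(x,y)=u(x,-y),\qquad L_a u=|y|^a g(x)\ \text{ in } \Omega\setminus\Lambda(u),\qquad L_a u\le |y|^a g(x)\ \text{ in } \Omega,$$ the last two in the sense of distributions. A global profile is a solution $u_0$ in $\Omega=\mathbb R^{n+1}$ with $g=0$ that is homogeneous of degree $1+s$, convex in $x$ for every fixed $y$, and normalized by $\int_{S_1}u_0^2|y|^a\,d\sigma=1$, where $S_1$ is the unit sphere of $\mathbb R^{n+1}$. There are constants $\varepsilon_0>0$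 and $c>0$, depending only on $n$ and $a$, such that the following holds. Let $u$ be a solution in $B_1$ with right-hand side $g$, where $|g|\le\varepsilon_0$ and $|\nabla_x g|\le\varepsilon_0$ in $B_1^*$ (that is, $g$ is Lipschitz with constant $\varepsilon_0$). Let $u_0$ be a global profile and let $e_n\in\mathbb R^n$ be the unit normal to its free boundary pointing out of its contact set, i.e. $\Lambda(u_0)=\{(x,0): x\cdot e_n\le 0\}$. Suppose that $u$ is differentiable in $x$ at every point of $B_1$ and $|\nabla_x u-\nabla_x u_0|\le\varepsilon_0$ in $B_1$. Then $\Lambda=\Lambda(u)\subset B_1$ is not empty, and for every unit vector $\tau\in\mathbb R^n\times\{0\}$ with $|\tau-e_n|<1/2$ the tangential derivative $u_\tau$ satisfies $$u_\tau(X)\ \ge\ c\,\operatorname{dist}(X,\Lambda)^{2s}\qquad\text{for every } X\in B_{1/8}.$$ -/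

import Mathlib

open MeasureTheory Metric Set
open scoped ContDiff

noncomputable section

namespace ThinObstacle

/-- `ℝⁿ` with its Euclidean norm. Points of `ℝⁿ⁺¹` are `X = (x, y)` with `y` the last coordinate. -/
abbrev E (n : ℕ) : Type := EuclideanSpace ℝ (Fin n)

/-- The point `(x, y)` of `ℝⁿ⁺¹`. -/
def pt {n : ℕ} (x : E n) (y : ℝ) : E (n + 1) :=
  WithLp.toLp 2 (Fin.snoc (α := fun _ => ℝ) (fun i => x i) y)

/-- The component `x` of `X = (x, y)`. -/
def xPart {n : ℕ} (X : E (n + 1)) : E n := WithLp.toLp 2 (fun i => X i.castSucc)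

/-- The component `y` of `X = (x, y)`. -/
def yPart {n : ℕ} (X : E (n + 1)) : ℝ := X (Fin.last n)

/-- The weight `|y|^a`. -/
def weight {n : ℕ} (a : ℝ) (X : E (n + 1)) : ℝ := |yPart X| ^ a

/-- The exponent `s = (1 - a) / 2`. -/
def sExp (a : ℝ) : ℝ := (1 - a) / 2

/-- Smooth functions with compact support in `Ω`. -/
def IsTest {n : ℕ} (Ω : Set (E n)) (φ : E n → ℝ) : Prop :=
  ContDiff ℝ ∞ φ ∧ HasCompactSupport φ ∧ tsupport φ ⊆ Ω

/-- `G` is the weak gradient of `u` in `Ω`, and it is locally square integrable in `Ω` with respect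
to `|y|^a dX`; for `u` continuous in `Ω` this says `u ∈ W^{1,2}_loc(Ω, |y|^a)`, `∇u = G`. -/
def HasWeakGradient {n : ℕ} (a : ℝ) (Ω : Set (E (n + 1))) (u : E (n + 1) → ℝ)
    (G : E (n + 1) → E (n + 1)) : Prop :=
  AEStronglyMeasurable G (volume.restrict Ω) ∧
  LocallyIntegrableOn (fun X => weight a X * ‖G X‖ ^ 2) Ω volume ∧
  ∀ φ, IsTest Ω φ → ∀ v : E (n + 1),
    ∫ X, u X * fderiv ℝ φ X v = - ∫ X, inner ℝ (G X) v * φ X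

/-- The contact set `Λ = {(x, 0) ∈ Ω : u(x, 0) = 0}`. -/
def contactSet {n : ℕ} (Ω : Set (E (n + 1))) (u : E (n + 1) → ℝ) : Set (E (n + 1)) :=
  {X | X ∈ Ω ∧ yPart X = 0 ∧ u X = 0}

/-- `u` solves in `Ω` the thin obstacle problem with zero obstacle for the operator
`L_a u = div(|y|^a ∇u)` and right-hand side `|y|^a g(x)`. Both the equation and the inequality are
meant in the sense of distributions: for a test function `φ`, the value of `L_a u` at `φ` is
`-∫ |y|^a ∇u · ∇φ`, where `∇u · ∇φ` is written `fderiv ℝ φ X (G X)`. -/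
structure IsSolution {n : ℕ} (a : ℝ) (Ω : Set (E (n + 1))) (g : E n → ℝ)
    (u : E (n + 1) → ℝ) : Prop where
  continuousOn : ContinuousOn u Ω
  nonneg : ∀ x : E n, pt x 0 ∈ Ω → 0 ≤ u (pt x 0)
  even : ∀ (x : E n) (y : ℝ), pt x y ∈ Ω → u (pt x y) = u (pt x (-y))
  equation : ∃ G, HasWeakGradient a Ω u G ∧
    (∀ φ, IsTest (Ω \ contactSet Ω u) φ →
      - ∫ X, weight a X * fderiv ℝ φ X (G X) = ∫ X, weight a X * g (xPart X) * φ X) ∧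
    (∀ φ, IsTest Ω φ → (∀ X, 0 ≤ φ X) →
      - ∫ X, weight a X * fderiv ℝ φ X (G X) ≤ ∫ X, weight a X * g (xPart X) * φ X)

/-- A global profile of degree `1 + s`: a solution of the homogeneous problem in the whole space,
homogeneous of degree `1 + s` and convex in `x`, normalized in `L²(S_1, |y|^a dσ)`. -/
structure IsGlobalProfile {n : ℕ} (a : ℝ) (u₀ : E (n + 1) → ℝ) : Prop where
  solution : IsSolution a univ (fun _ => 0) u₀
  homogeneous : ∀ t : ℝ, 0 < t → ∀ X, u₀ (t • X) = t ^ (1 + sExp a) * u₀ X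
  convex : ∀ y : ℝ, ConvexOn ℝ univ (fun x : E n => u₀ (pt x y))
  normalized : ∫ θ : sphere (0 : E (n + 1)) 1, weight a (θ : E (n + 1)) * u₀ θ ^ 2
    ∂(volume : Measure (E (n + 1))).toSphere = 1

/-- `u` is differentiable at `X = (x, y)` with respect to `x`. -/
def DifferentiableXAt {n : ℕ} (u : E (n + 1) → ℝ) (X : E (n + 1)) : Prop :=
  DifferentiableAt ℝ (fun x : E n => u (pt x (yPart X))) (xPart X)

/-- The gradient `∇_x u` at `X`. -/
def gradX {n : ℕ} (u : E (n + 1) → ℝ) (X : E (n + 1)) : E n :=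
  gradient (fun x : E n => u (pt x (yPart X))) (xPart X)

end ThinObstacle

end

noncomputable section

namespace ThinObstacle

open Filter Topology

variable {n : ℕ} {a : ℝ}

/-! Consider the difference quotient w(x, y) = (u(x + hτ, y) - u(x, y)) / h. The translate of u is a
supersolution, u itself solves the equation off Λ, and g is ε-Lipschitz, so L_a w ≤ ε|y|^a off Λ. On
Λ the subtracted value is zero and the other one is nonnegative, so w ≥ 0 there. Closeness to u₀
together with ∂_τ u₀ ≥ c₀|y|^{2s} gives w ≥ c₀|y|^{2s} - ε. These facts, uniform in h, are what
`IsIncrement` records; throughout, 2s = 1 - a.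

Three comparisons with barriers C + By² + D|y|^{1-a} - A|x - x₀|² then improve the bound. First, w ≥
0 in a slab |y| ≤ l: the possible loss -ε on the lateral boundary is absorbed by the paraboloid, and
w ≥ 3ε at |y| = l. Second, w ≥ D|y|^{1-a} in a smaller slab, because |y|^{1-a} is L_a-harmonic off y
= 0. Third, in a cylinder |x - x₀| ≤ r, |y| ≤ lr that misses Λ, the second bound at |y| = lr
propagates inwards to w ≥ D(lr)^{1-a}/2. Letting h → 0 (`gradX_lower_bound`) and taking r = dist(X,
Λ)/16 gives the theorem. If Λ were empty, r = 1/8 would give u_e ≥ 2ε at -e/2, where ∇_x u₀ = 0 and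
hence |u_e| ≤ ε.

The constant c₀ must not depend on u₀. By `IsGlobalProfile.eq_profE` a profile is k·q^s(t - sρ) with
t = x·e, ρ = |(t, y)|, q = (ρ + t)/2, and the normalization bounds k below. For that rigidity,
convexity and homogeneity determine the trace. The difference Z between u₀ and the explicit solution
vanishes on y = 0 and is L_a-harmonic for y > 0. Its horizontal increments grow at most like R^s,
whereas boundary decay (`decay_of_bounded`) gains (y/R)^{2s}; so Z does not depend on x. Homogeneity
leaves a multiple of y^{1+s}, which is not L_a-harmonic, so Z = 0.

The `comparison` principle works with continuous functions and with tests η(x)χ(y), where χ is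
constant near 0 so that |y|^a χ' is smooth. At a negative minimum of w minus the barrier,
mollification in x alone keeps an interior minimum and makes the x-Laplacian classical. What remains
is a weak one-dimensional inequality in y, refuted by an explicit test function
(`exists_flatTest_integral_pos`). -/

/-! ### Coordinates (x, y), Fubini, and local integrability of the weight -/

@[simp] lemma xPart_pt (x : E n) (y : ℝ) : xPart (pt x y) = x := by
  ext i; simp [xPart, pt]

@[simp] lemma yPart_pt (x : E n) (y : ℝ) : yPart (pt x y) = y := by
  simp [yPart, pt]

@[simp] lemma pt_xPart_yPart (X : E (n + 1)) : pt (xPart X) (yPart X) = X := by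
  ext i
  refine Fin.lastCases ?_ (fun j => ?_) i <;> simp [xPart, yPart, pt]

lemma pt_add (x x' : E n) (y y' : ℝ) : pt x y + pt x' y' = pt (x + x') (y + y') := by
  ext i
  refine Fin.lastCases ?_ (fun j => ?_) i <;> simp [pt]

lemma smul_pt (t : ℝ) (x : E n) (y : ℝ) : t • pt x y = pt (t • x) (t * y) := by
  ext i
  refine Fin.lastCases ?_ (fun j => ?_) i <;> simp [pt]

lemma inner_pt (x x' : E n) (y y' : ℝ) :
    inner ℝ (pt x y) (pt x' y') = inner ℝ x x' + y * y' := by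
  simp [PiLp.inner_apply, Fin.sum_univ_castSucc, pt, mul_comm]

lemma norm_pt_sq (x : E n) (y : ℝ) : ‖pt x y‖ ^ 2 = ‖x‖ ^ 2 + y ^ 2 := by
  rw [← real_inner_self_eq_norm_sq, inner_pt, real_inner_self_eq_norm_sq]; ring

/-- The isometry `(x, y) ↦ pt x y` from the Euclidean product `ℝⁿ × ℝ` onto `ℝⁿ⁺¹`. -/
def ptIsometry (n : ℕ) : WithLp 2 (E n × ℝ) ≃ₗᵢ[ℝ] E (n + 1) where
  toFun p := pt p.fst p.snd
  invFun X := WithLp.toLp 2 (xPart X, yPart X)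
  left_inv p := by simp only [xPart_pt, yPart_pt]; rfl
  right_inv X := by simp
  map_add' p q := by simp [pt_add]
  map_smul' t p := by simp [smul_pt]
  norm_map' p := by
    rw [← sq_eq_sq₀ (norm_nonneg _) (norm_nonneg _)]
    rw [WithLp.prod_norm_sq_eq_of_L2, Real.norm_eq_abs, sq_abs]
    exact norm_pt_sq _ _

lemma measurePreserving_pt : MeasurePreserving (fun p : E n × ℝ => pt p.1 p.2) :=
  (ptIsometry n).measurePreserving.comp (WithLp.volume_preserving_toLp (E n) ℝ)

/-- The continuous linear equivalence `(x, y) ↦ pt x y`. -/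
def ptEquiv (n : ℕ) : (E n × ℝ) ≃L[ℝ] E (n + 1) :=
  (WithLp.prodContinuousLinearEquiv 2 ℝ (E n) ℝ).symm.trans
    (ptIsometry n).toContinuousLinearEquiv

/-- `xPart` as a continuous linear map. -/
def xPartL (n : ℕ) : E (n + 1) →L[ℝ] E n :=
  (ContinuousLinearMap.fst ℝ (E n) ℝ).comp ((ptEquiv n).symm : E (n + 1) →L[ℝ] E n × ℝ)

/-- `yPart` as a continuous linear map. -/
def yPartL (n : ℕ) : E (n + 1) →L[ℝ] ℝ :=
  (ContinuousLinearMap.snd ℝ (E n) ℝ).comp ((ptEquiv n).symm : E (n + 1) →L[ℝ] E n × ℝ)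

@[simp] lemma xPartL_apply (X : E (n + 1)) : xPartL n X = xPart X := rfl

@[simp] lemma yPartL_apply (X : E (n + 1)) : yPartL n X = yPart X := rfl

lemma continuous_pt : Continuous fun p : E n × ℝ => pt p.1 p.2 := (ptEquiv n).continuous

lemma continuous_xPart : Continuous (xPart : E (n + 1) → E n) := (xPartL n).continuous
lemma continuous_yPart : Continuous (yPart : E (n + 1) → ℝ) := (yPartL n).continuous

lemma integral_eq_integral_pt (F : E (n + 1) → ℝ) :
    ∫ X, F X = ∫ p : E n × ℝ, F (pt p.1 p.2) :=
  (measurePreserving_pt.integral_comp (ptEquiv n).toHomeomorph.measurableEmbedding F).symm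

lemma locallyIntegrable_abs_rpow (ha : -1 < a) : LocallyIntegrable fun y : ℝ => |y| ^ a := by
  refine locallyIntegrable_of_norm_le_rpow (C := 1) (α := -a) (by simp) (by simp; linarith) ?_ ?_
  · filter_upwards with y
    simp [Real.abs_rpow_of_nonneg]
  · exact (measurable_id.abs.pow_const a).aestronglyMeasurable

lemma locallyIntegrable_weight (ha : -1 < a) :
    LocallyIntegrable fun p : E n × ℝ => |p.2| ^ a := by
  rw [locallyIntegrable_iff]
  intro K hK
  have hK1 := hK.image continuous_fst
  have hK2 := hK.image continuous_snd
  have h2 : IntegrableOn (fun y : ℝ => |y| ^ a) (Prod.snd '' K) :=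
    (locallyIntegrable_abs_rpow ha).integrableOn_isCompact hK2
  have h1 : IntegrableOn (fun _ : E n => (1 : ℝ)) (Prod.fst '' K) :=
    integrableOn_const hK1.measure_ne_top
  have := Integrable.mul_prod h1 h2
  rw [Measure.prod_restrict] at this
  refine (IntegrableOn.mono_set (t := (Prod.fst '' K) ×ˢ (Prod.snd '' K)) ?_ ?_)
  · simpa [IntegrableOn, Measure.volume_eq_prod] using this
  · exact fun p hp => ⟨mem_image_of_mem _ hp, mem_image_of_mem _ hp⟩

/-! ### Product test functions and the weak form -/

/-- The Laplacian as a sum of second directional derivatives. -/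
def lap (η : E n → ℝ) (x : E n) : ℝ :=
  ∑ i, fderiv ℝ (fun z => fderiv ℝ η z (EuclideanSpace.single i 1)) x (EuclideanSpace.single i 1)

/-- The operator `(|y|^a χ')'`. -/
def wd (a : ℝ) (χ : ℝ → ℝ) : ℝ → ℝ := deriv fun y => |y| ^ a * deriv χ y

/-- Smooth compactly supported functions. -/
structure Smc {F : Type*} [NormedAddCommGroup F] [NormedSpace ℝ F] (η : F → ℝ) : Prop where
  smooth : ContDiff ℝ ∞ η
  cs : HasCompactSupport η

/-- Smooth compactly supported functions of `y` that are constant near `y = 0`. -/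
structure FlatTest (χ : ℝ → ℝ) : Prop extends Smc χ where
  flat : ∀ᶠ y in 𝓝 0, deriv χ y = 0

lemma Smc.fderiv_apply {F : Type*} [NormedAddCommGroup F] [NormedSpace ℝ F] {η : F → ℝ}
    (h : Smc η) (v : F) : Smc fun z => fderiv ℝ η z v where
  smooth := (h.smooth.fderiv_right (m := ∞) (by simp)).clm_apply contDiff_const
  cs := by
    exact (h.cs.fderiv_apply (𝕜 := ℝ) v)

lemma Smc.deriv {χ : ℝ → ℝ} (h : Smc χ) : Smc (deriv χ) where
  smooth := ((contDiff_infty_iff_deriv.1 h.smooth).2)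
  cs := h.cs.deriv

lemma tsupport_fderiv_apply_subset' {F : Type*} [NormedAddCommGroup F] [NormedSpace ℝ F]
    {η : F → ℝ} (v : F) : tsupport (fun z => fderiv ℝ η z v) ⊆ tsupport η :=
  tsupport_fderiv_apply_subset ℝ v

lemma tsupport_lap_subset (η : E n → ℝ) : tsupport (lap η) ⊆ tsupport η := by
  refine closure_minimal ?_ (isClosed_tsupport η)
  intro x hx
  by_contra hx'
  refine hx (Finset.sum_eq_zero fun i _ => ?_)
  refine image_eq_zero_of_notMem_tsupport (f := fun x => fderiv ℝ (fun z => fderiv ℝ η z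
    (EuclideanSpace.single i 1)) x (EuclideanSpace.single i 1)) fun h => hx' ?_
  exact tsupport_fderiv_apply_subset' _ (tsupport_fderiv_apply_subset' _ h)

lemma Smc.lap {η : E n → ℝ} (h : Smc η) : Smc (lap η) where
  smooth := by
    unfold ThinObstacle.lap
    exact ContDiff.sum fun i _ => ((h.fderiv_apply _).fderiv_apply _).smooth
  cs := h.cs.mono' (subset_closure.trans (tsupport_lap_subset η))

lemma contDiff_abs_rpow_mul {f : ℝ → ℝ} (b : ℝ) (hf : ContDiff ℝ ∞ f) (h0 : ∀ᶠ y in 𝓝 0, f y = 0) :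
    ContDiff ℝ ∞ fun y => |y| ^ b * f y := by
  rw [contDiff_iff_contDiffAt]
  intro y
  rcases eq_or_ne y 0 with rfl | hy
  · refine (contDiffAt_const (c := (0 : ℝ))).congr_of_eventuallyEq ?_
    filter_upwards [h0] with y hy using by simp [hy]
  · exact ((contDiffAt_abs hy).rpow_const_of_ne (abs_ne_zero.2 hy)).mul hf.contDiffAt

/-- This is what flatness buys: |y|^b is singular or degenerate only at 0, where χ' vanishes
identically. Hence the flux can itself be a factor of a smooth test function. -/
lemma FlatTest.smc_flux {χ : ℝ → ℝ} (h : FlatTest χ) (b : ℝ) :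
    Smc fun y => |y| ^ b * deriv χ y where
  smooth := contDiff_abs_rpow_mul b h.deriv.smooth h.flat
  cs := h.deriv.cs.mul_left

lemma FlatTest.smc_wd {χ : ℝ → ℝ} (h : FlatTest χ) : Smc (wd a χ) := (h.smc_flux a).deriv

lemma tsupport_wd_subset (a : ℝ) (χ : ℝ → ℝ) : tsupport (wd a χ) ⊆ tsupport χ := by
  refine (tsupport_deriv_subset (𝕜 := ℝ)).trans ?_
  refine (closure_mono ?_).trans (tsupport_deriv_subset (𝕜 := ℝ) (f := χ))
  intro y hy h0
  exact hy (by simp [h0])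

/-- The weak form of `L_a w` tested against `η(x) χ(y)`, with all derivatives on the test
function. -/
def form (a : ℝ) (w : E n × ℝ → ℝ) (η : E n → ℝ) (χ : ℝ → ℝ) : ℝ :=
  ∫ y, (|y| ^ a * χ y * (∫ x, w (x, y) * lap η x) + wd a χ y * ∫ x, w (x, y) * η x)

/-- The function `η(x) χ(y)` on `ℝⁿ⁺¹`. -/
def tensor (η : E n → ℝ) (χ : ℝ → ℝ) (X : E (n + 1)) : ℝ := η (xPart X) * χ (yPart X)

lemma tsupport_tensor_subset (η : E n → ℝ) (χ : ℝ → ℝ) :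
    tsupport (tensor η χ) ⊆ {X | xPart X ∈ tsupport η ∧ yPart X ∈ tsupport χ} := by
  refine closure_minimal (fun X hX => ?_) ?_
  · exact ⟨subset_closure (left_ne_zero_of_mul hX), subset_closure (right_ne_zero_of_mul hX)⟩
  · exact ((isClosed_tsupport η).preimage continuous_xPart).inter
      ((isClosed_tsupport χ).preimage continuous_yPart)

lemma Smc.tensor {η : E n → ℝ} {χ : ℝ → ℝ} (hη : Smc η) (hχ : Smc χ) : Smc (tensor η χ) where
  smooth := (hη.smooth.comp (xPartL n).contDiff).mul (hχ.smooth.comp (yPartL n).contDiff)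
  cs := by
    refine HasCompactSupport.of_support_subset_isCompact
      ((hη.cs.isCompact.prod hχ.cs.isCompact).image continuous_pt)
      ((subset_tsupport _).trans ((tsupport_tensor_subset η χ).trans ?_))
    exact fun X hX => ⟨(xPart X, yPart X), hX, by simp⟩

lemma Smc.isTest_tensor {η : E n → ℝ} {χ : ℝ → ℝ} (hη : Smc η) (hχ : Smc χ)
    {Ω : Set (E (n + 1))} (h : ∀ x ∈ tsupport η, ∀ y ∈ tsupport χ, pt x y ∈ Ω) :
    IsTest Ω (ThinObstacle.tensor η χ) := by
  refine ⟨(hη.tensor hχ).smooth, (hη.tensor hχ).cs, fun X hX => ?_⟩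
  have := tsupport_tensor_subset η χ hX
  simpa using h _ this.1 _ this.2

lemma fderiv_tensor {η : E n → ℝ} {χ : ℝ → ℝ} (hη : Smc η) (hχ : Smc χ) (X v : E (n + 1)) :
    fderiv ℝ (tensor η χ) X v =
      fderiv ℝ η (xPart X) (xPart v) * χ (yPart X) + η (xPart X) * deriv χ (yPart X) * yPart v := by
  have h1 : HasFDerivAt (fun X : E (n + 1) => η (xPart X))
      ((fderiv ℝ η (xPart X)).comp (xPartL n)) X :=
    ((hη.smooth.differentiable (by simp)) (xPart X)).hasFDerivAt.comp X (xPartL n).hasFDerivAt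
  have h2 : HasFDerivAt (fun X : E (n + 1) => χ (yPart X))
      (deriv χ (yPart X) • (yPartL n)) X :=
    ((hχ.smooth.differentiable (by simp)) (yPart X)).hasDerivAt.comp_hasFDerivAt X
      (yPartL n).hasFDerivAt
  have : HasFDerivAt (tensor η χ) _ X := h1.mul h2
  rw [this.fderiv]
  simp
  ring

/-! ### From the weak gradient to the weak form -/

lemma weight_pt (x : E n) (y : ℝ) : weight a (pt x y) = |y| ^ a := by simp [weight]

lemma locallyIntegrable_weight' (ha : -1 < a) :
    LocallyIntegrable (weight a : E (n + 1) → ℝ) := by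
  rw [locallyIntegrable_iff]
  intro K hK
  rw [← measurePreserving_pt.integrableOn_comp_preimage
    (ptEquiv n).toHomeomorph.measurableEmbedding]
  have : IsCompact ((fun p : E n × ℝ => pt p.1 p.2) ⁻¹' K) :=
    (ptEquiv n).toHomeomorph.isCompact_preimage.2 hK
  simpa [Function.comp_def, weight_pt] using
    (locallyIntegrable_weight (n := n) ha).integrableOn_isCompact this

lemma measurable_weight : Measurable (weight a : E (n + 1) → ℝ) :=
  (continuous_yPart.measurable.abs).pow_const a

lemma weight_nonneg (X : E (n + 1)) : 0 ≤ weight a X := by unfold weight; positivity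

/-- On the compact support of θ both |y|^a and |y|^a|G|² are integrable, and |G| ≤ 1 + |G|². -/
lemma integrable_weight_mul_inner (ha : -1 < a) {Ω : Set (E (n + 1))} {u : E (n + 1) → ℝ}
    {G : E (n + 1) → E (n + 1)} (hG : HasWeakGradient a Ω u G) {θ : E (n + 1) → ℝ}
    (hθ : Continuous θ) (hθc : HasCompactSupport θ) (hθΩ : tsupport θ ⊆ Ω) (v : E (n + 1)) :
    Integrable fun X => weight a X * θ X * inner ℝ (G X) v := by
  have hK : IsCompact (tsupport θ) := hθc
  obtain ⟨C, hC⟩ := hθ.bounded_above_of_compact_support hθc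
  have hC0 : 0 ≤ C := (norm_nonneg _).trans (hC 0)
  have i1 : IntegrableOn (fun X => weight a X * ‖G X‖ ^ 2) (tsupport θ) :=
    hG.2.1.integrableOn_compact_subset hθΩ hK
  have i2 : IntegrableOn (weight a) (tsupport θ) :=
    (locallyIntegrable_weight' ha).integrableOn_isCompact hK
  have i3 : IntegrableOn (fun X => C * ‖v‖ * (weight a X + weight a X * ‖G X‖ ^ 2)) (tsupport θ) :=
    (i2.add i1).const_mul _
  have hGm : AEStronglyMeasurable G (volume.restrict (tsupport θ)) :=
    hG.1.mono_measure (Measure.restrict_mono hθΩ le_rfl)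
  refine IntegrableOn.integrable_of_forall_notMem_eq_zero (s := tsupport θ) ?_ ?_
  · refine Integrable.mono' i3 ?_ ?_
    · exact ((measurable_weight.aestronglyMeasurable).mul hθ.aestronglyMeasurable).mul
        (hGm.inner aestronglyMeasurable_const)
    · filter_upwards with X
      have h1 : |inner ℝ (G X) v| ≤ ‖G X‖ * ‖v‖ := abs_real_inner_le_norm _ _
      have h2 : ‖G X‖ ≤ 1 + ‖G X‖ ^ 2 := by nlinarith [sq_nonneg (‖G X‖ - 1)]
      have hw := weight_nonneg (a := a) X
      calc ‖weight a X * θ X * inner ℝ (G X) v‖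
          = weight a X * ‖θ X‖ * |inner ℝ (G X) v| := by
            rw [norm_mul, norm_mul, Real.norm_of_nonneg hw, Real.norm_eq_abs (inner ℝ (G X) v)]
        _ ≤ weight a X * C * ((1 + ‖G X‖ ^ 2) * ‖v‖) := by
            gcongr
            · exact hC X
            · exact h1.trans (by gcongr)
        _ = _ := by ring
  · intro X hX
    simp [image_eq_zero_of_notMem_tsupport hX]

/-- A smooth cutoff away from `y = 0`. -/
lemma exists_cutoff : ∃ ζ : ℝ → ℝ, ContDiff ℝ ∞ ζ ∧ (∀ y, 0 ≤ ζ y ∧ ζ y ≤ 1) ∧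
    (∀ᶠ y in 𝓝 0, ζ y = 0) ∧ ∀ y, 1 ≤ |y| → ζ y = 1 := by
  let f : ContDiffBump (0 : ℝ) := ⟨1 / 2, 1, by norm_num, by norm_num⟩
  refine ⟨fun y => 1 - f y, contDiff_const.sub f.contDiff, fun y => ?_, ?_, fun y hy => ?_⟩
  · exact ⟨by linarith [f.le_one (x := y)], by linarith [f.nonneg (x := y)]⟩
  · filter_upwards [f.eventuallyEq_one] with y hy using by simp [hy]
  · have := f.zero_of_le_dist (x := y) (by simpa using hy)
    simp [this]

lemma ae_yPart_ne_zero : ∀ᵐ X : E (n + 1), yPart X ≠ 0 := by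
  have : ∀ᵐ p : E n × ℝ, yPart (pt p.1 p.2) ≠ 0 := by
    simp only [yPart_pt]
    have h : ∀ᵐ y : ℝ, y ≠ 0 := by simp [ae_iff]
    exact (Measure.quasiMeasurePreserving_snd (μ := (volume : Measure (E n)))
      (ν := (volume : Measure ℝ))).ae h
  have h2 := (ptEquiv n).toHomeomorph.measurableEmbedding.ae_map_iff (μ := volume)
    (p := fun X => yPart X ≠ 0)
  have h3 : Measure.map (⇑(ptEquiv n).toHomeomorph) (volume : Measure (E n × ℝ)) = volume :=
    measurePreserving_pt.map_eq
  rw [h3] at h2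
  exact h2.2 this

/-- The weak gradient is defined without weight, and |y|^a ψχ need not be a smooth test function. It
becomes one after multiplication by a cutoff ζ((k + 1)y) that vanishes near y = 0. A horizontal
derivative does not see this cutoff, so dominated convergence removes it as k → ∞. -/
lemma weakGradient_horizontal (ha : -1 < a) {Ω : Set (E (n + 1))} {u : E (n + 1) → ℝ}
    {G : E (n + 1) → E (n + 1)} (hu : ContinuousOn u Ω) (hΩ : IsOpen Ω)
    (hG : HasWeakGradient a Ω u G)
    {ψ : E n → ℝ} {χ : ℝ → ℝ} (hψ : Smc ψ) (hχ : Smc χ)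
    (h : ∀ x ∈ tsupport ψ, ∀ y ∈ tsupport χ, pt x y ∈ Ω) (v : E n) :
    ∫ X, weight a X * tensor ψ χ X * inner ℝ (G X) (pt v 0) =
      - ∫ X, weight a X * (u X * tensor (fun x => fderiv ℝ ψ x v) χ X) := by
  obtain ⟨ζ, hζ, hζ1, hζ0, hζ2⟩ := exists_cutoff
  have hψ' := hψ.fderiv_apply v
  have hh' : ∀ x ∈ tsupport (fun x => fderiv ℝ ψ x v), ∀ y ∈ tsupport χ, pt x y ∈ Ω :=
    fun x hx => h x (tsupport_fderiv_apply_subset' v hx)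
  let z : ℕ → ℝ → ℝ := fun k y => ζ ((k + 1 : ℝ) * y)
  have hz0 : ∀ k, ∀ᶠ y in 𝓝 (0 : ℝ), z k y = 0 := fun k => by
    have : Tendsto (fun y : ℝ => (k + 1 : ℝ) * y) (𝓝 0) (𝓝 0) := by
      have : Continuous fun y : ℝ => (k + 1 : ℝ) * y := by fun_prop
      simpa using this.tendsto 0
    exact this.eventually hζ0
  have hzs : ∀ k, ContDiff ℝ ∞ (z k) := fun k => hζ.comp (contDiff_const.mul contDiff_id)
  have hχk : ∀ k, Smc fun y => |y| ^ a * (z k y * χ y) := fun k =>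
    ⟨contDiff_abs_rpow_mul a ((hzs k).mul hχ.smooth) ((hz0 k).mono fun y hy => by simp [hy]),
      (hχ.cs.mul_left).mul_left⟩
  have hsub : ∀ k, tsupport (fun y => |y| ^ a * (z k y * χ y)) ⊆ tsupport χ := fun k =>
    closure_mono fun y hy => right_ne_zero_of_mul (right_ne_zero_of_mul hy)
  have key : ∀ k, ∫ X, z k (yPart X) * (weight a X * tensor ψ χ X * inner ℝ (G X) (pt v 0)) =
      - ∫ X, z k (yPart X) *
        (weight a X * (u X * tensor (fun x => fderiv ℝ ψ x v) χ X)) := by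
    intro k
    have := hG.2.2 _ (hψ.isTest_tensor (hχk k) fun x hx y hy => h x hx y (hsub k hy)) (pt v 0)
    have e1 : ∀ X, u X * fderiv ℝ (tensor ψ fun y => |y| ^ a * (z k y * χ y)) X (pt v 0) =
        z k (yPart X) * (weight a X * (u X * tensor (fun x => fderiv ℝ ψ x v) χ X)) := fun X => by
      rw [fderiv_tensor hψ (hχk k)]
      simp only [tensor, weight, xPart_pt, yPart_pt]
      ring
    have e2 : ∀ X, inner ℝ (G X) (pt v 0) * tensor ψ (fun y => |y| ^ a * (z k y * χ y)) X =
        z k (yPart X) * (weight a X * tensor ψ χ X * inner ℝ (G X) (pt v 0)) := fun X => by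
      simp only [tensor, weight]
      ring
    simp_rw [e1, e2] at this
    linarith
  have hlim : ∀ F : E (n + 1) → ℝ, Integrable F →
      Tendsto (fun k => ∫ X, z k (yPart X) * F X) atTop (𝓝 (∫ X, F X)) := by
    intro F hF
    refine tendsto_integral_of_dominated_convergence (fun X => ‖F X‖) ?_ hF.norm ?_ ?_
    · intro k
      exact (((hzs k).continuous.comp continuous_yPart).aestronglyMeasurable).mul hF.1
    · intro k
      filter_upwards with X
      rw [norm_mul]
      refine mul_le_of_le_one_left (norm_nonneg _) ?_
      rw [Real.norm_of_nonneg (hζ1 _).1]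
      exact (hζ1 _).2
    · filter_upwards [ae_yPart_ne_zero] with X hX
      refine tendsto_const_nhds.congr' ?_
      have ht : Tendsto (fun k : ℕ => ((k : ℝ) + 1) * |yPart X|) atTop atTop :=
        (tendsto_natCast_atTop_atTop.atTop_add tendsto_const_nhds).atTop_mul_const (abs_pos.2 hX)
      filter_upwards [ht.eventually_ge_atTop 1] with k hk
      have : z k (yPart X) = 1 := hζ2 _ (by
        rw [abs_mul, abs_of_nonneg (by positivity : (0 : ℝ) ≤ (k : ℝ) + 1)]; exact hk)
      simp [this]
  have hi1 := integrable_weight_mul_inner ha hG (hψ.tensor hχ).smooth.continuous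
    (hψ.tensor hχ).cs (hψ.isTest_tensor hχ h).2.2 (pt v 0)
  have hi2 : Integrable fun X => weight a X * (u X * tensor (fun x => fderiv ℝ ψ x v) χ X) := by
    have hT := hψ'.isTest_tensor hχ hh'
    refine (locallyIntegrable_weight' ha).integrable_smul_right_of_hasCompactSupport ?_
      hT.2.1.mul_left
    refine continuous_of_tsupport fun X hX => ?_
    have hX' : X ∈ Ω := hT.2.2 (tsupport_mul_subset_right hX)
    exact (hu.continuousAt (hΩ.mem_nhds hX')).mul hT.1.continuous.continuousAt
  have l1 := hlim _ hi1
  have l2 := (hlim _ hi2).neg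
  simp_rw [key] at l1
  exact tendsto_nhds_unique l1 l2

/-- Horizontal derivatives are integrated by parts with `weakGradient_horizontal`. For the vertical
one, η(x)|y|^a χ'(y) is an admissible test function because χ is flat at 0. Afterwards only u
appears, so the equation makes sense for continuous functions. -/
lemma integral_weight_fderiv_tensor (ha : -1 < a) {Ω : Set (E (n + 1))} {u : E (n + 1) → ℝ}
    {G : E (n + 1) → E (n + 1)} (hu : ContinuousOn u Ω) (hΩ : IsOpen Ω)
    (hG : HasWeakGradient a Ω u G)
    {η : E n → ℝ} {χ : ℝ → ℝ} (hη : Smc η) (hχ : FlatTest χ)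
    (h : ∀ x ∈ tsupport η, ∀ y ∈ tsupport χ, pt x y ∈ Ω) :
    - ∫ X, weight a X * fderiv ℝ (tensor η χ) X (G X) =
      form a (fun p => u (pt p.1 p.2)) η χ := by
  have hη' := fun i => hη.fderiv_apply (EuclideanSpace.single i 1)
  have hη'' := fun i => (hη' i).fderiv_apply (EuclideanSpace.single i 1)
  have hs' : ∀ i, ∀ x ∈ tsupport (fun x => fderiv ℝ η x (EuclideanSpace.single i 1)),
      ∀ y ∈ tsupport χ, pt x y ∈ Ω := fun i x hx => h x (tsupport_fderiv_apply_subset' _ hx)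
  have hflux := hχ.smc_flux a
  have hsflux : ∀ x ∈ tsupport η, ∀ y ∈ tsupport (fun y => |y| ^ a * deriv χ y), pt x y ∈ Ω :=
    fun x hx y hy => h x hx y (tsupport_deriv_subset (𝕜 := ℝ) (tsupport_mul_subset_right hy))
  have hsd : ∀ x ∈ tsupport η, ∀ y ∈ tsupport (deriv χ), pt x y ∈ Ω :=
    fun x hx y hy => h x hx y (tsupport_deriv_subset (𝕜 := ℝ) hy)
  -- split the derivative into coordinates
  have e1 : ∀ X, weight a X * fderiv ℝ (tensor η χ) X (G X) =
      ∑ i, weight a X * tensor (fun x => fderiv ℝ η x (EuclideanSpace.single i 1)) χ X *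
        inner ℝ (G X) (pt (EuclideanSpace.single i 1) 0) +
      weight a X * tensor η (deriv χ) X * inner ℝ (G X) (pt 0 1) := by
    intro X
    rw [fderiv_tensor hη hχ.toSmc]
    have hx : xPart (G X) = ∑ i, inner ℝ (G X) (pt (EuclideanSpace.single i 1) 0) •
        EuclideanSpace.single i (1 : ℝ) := by
      have : ∀ i, inner ℝ (G X) (pt (EuclideanSpace.single i 1) 0) = xPart (G X) i := by
        intro i
        conv_lhs => rw [← pt_xPart_yPart (G X)]
        rw [inner_pt]
        simp [EuclideanSpace.inner_single_right]
      simp_rw [this]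
      ext j
      simp [Finset.sum_apply, Pi.single_apply]
    have hy : yPart (G X) = inner ℝ (G X) (pt 0 1) := by
      conv_rhs => rw [← pt_xPart_yPart (G X)]
      rw [inner_pt]
      simp
    rw [hx, hy, map_sum, mul_add, Finset.sum_mul, Finset.mul_sum]
    congr 1
    · refine Finset.sum_congr rfl fun i _ => ?_
      simp only [map_smul, smul_eq_mul, tensor]
      ring
    · simp only [tensor]
      ring
  have i1 := fun i => integrable_weight_mul_inner ha hG
    ((hη' i).tensor hχ.toSmc).smooth.continuous
    ((hη' i).tensor hχ.toSmc).cs ((hη' i).isTest_tensor hχ.toSmc (hs' i)).2.2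
    (pt (EuclideanSpace.single i 1) 0)
  have i2 := integrable_weight_mul_inner ha hG
    (hη.tensor hχ.deriv).smooth.continuous
    (hη.tensor hχ.deriv).cs (hη.isTest_tensor hχ.deriv hsd).2.2 (pt 0 1)
  have hcont : ∀ (ψ : E n → ℝ) (κ : ℝ → ℝ), Smc ψ → Smc κ →
      (∀ x ∈ tsupport ψ, ∀ y ∈ tsupport κ, pt x y ∈ Ω) →
      Continuous (fun X => u X * tensor ψ κ X) ∧
        HasCompactSupport (fun X => u X * tensor ψ κ X) := by
    intro ψ κ hψ hκ hs
    have hT := hψ.isTest_tensor hκ hs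
    refine ⟨continuous_of_tsupport fun X hX => ?_, hT.2.1.mul_left⟩
    have hX' : X ∈ Ω := hT.2.2 (tsupport_mul_subset_right hX)
    exact (hu.continuousAt (hΩ.mem_nhds hX')).mul hT.1.continuous.continuousAt
  have hlapS : ∀ x ∈ tsupport (lap η), ∀ y ∈ tsupport χ, pt x y ∈ Ω :=
    fun x hx => h x (tsupport_lap_subset η hx)
  have hwdS : ∀ x ∈ tsupport η, ∀ y ∈ tsupport (wd a χ), pt x y ∈ Ω :=
    fun x hx y hy => h x hx y (tsupport_wd_subset a χ hy)
  have j0 : ∀ i, Integrable fun X => weight a X * (u X * tensor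
      (fun x => fderiv ℝ (fun z => fderiv ℝ η z (EuclideanSpace.single i 1)) x
        (EuclideanSpace.single i 1)) χ X) := fun i => by
    have := hcont _ _ (hη'' i) hχ.toSmc fun x hx => hs' i x (tsupport_fderiv_apply_subset' _ hx)
    exact (locallyIntegrable_weight' ha).integrable_smul_right_of_hasCompactSupport this.1 this.2
  have j1 : Integrable fun X => weight a X * (u X * tensor (lap η) χ X) := by
    have := hcont _ _ hη.lap hχ.toSmc hlapS
    exact (locallyIntegrable_weight' ha).integrable_smul_right_of_hasCompactSupport this.1 this.2
  have j2 : Integrable fun X => u X * tensor η (wd a χ) X := by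
    have := hcont _ _ hη hχ.smc_wd hwdS
    exact this.1.integrable_of_hasCompactSupport this.2
  have v1 : ∫ X, weight a X * tensor η (deriv χ) X * inner ℝ (G X) (pt 0 1) =
      - ∫ X, u X * tensor η (wd a χ) X := by
    have := hG.2.2 _ (hη.isTest_tensor hflux hsflux) (pt 0 1)
    have e3 : ∀ X, fderiv ℝ (tensor η fun y => |y| ^ a * deriv χ y) X (pt 0 1) =
        tensor η (wd a χ) X := fun X => by
      rw [fderiv_tensor hη hflux]
      simp [tensor, wd]
    have e4 : ∀ X, inner ℝ (G X) (pt 0 1) * tensor η (fun y => |y| ^ a * deriv χ y) X =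
        weight a X * tensor η (deriv χ) X * inner ℝ (G X) (pt 0 1) := fun X => by
      simp only [tensor, weight]
      ring
    simp_rw [e3, e4] at this
    linarith
  simp_rw [e1]
  rw [integral_add (integrable_finsetSum _ fun i _ => i1 i) i2,
    integral_finsetSum _ fun i _ => i1 i, v1]
  simp_rw [fun i => weakGradient_horizontal ha hu hΩ hG (hη' i) hχ.toSmc (hs' i)
    (EuclideanSpace.single i 1)]
  rw [Finset.sum_neg_distrib, ← integral_finsetSum _ fun i _ => j0 i]
  have e5 : ∀ X, ∑ i, weight a X * (u X * tensor
      (fun x => fderiv ℝ (fun z => fderiv ℝ η z (EuclideanSpace.single i 1)) x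
        (EuclideanSpace.single i 1)) χ X) = weight a X * (u X * tensor (lap η) χ X) := fun X => by
    simp only [tensor, lap, Finset.sum_mul, Finset.mul_sum]
  simp_rw [e5]
  rw [neg_add, neg_neg, neg_neg, ← integral_add j1 j2, integral_eq_integral_pt]
  have jj := (measurePreserving_pt.integrable_comp_emb
    (ptEquiv n).toHomeomorph.measurableEmbedding).2 (j1.add j2)
  have jj1 := (measurePreserving_pt.integrable_comp_emb
    (ptEquiv n).toHomeomorph.measurableEmbedding).2 j1
  have jj2 := (measurePreserving_pt.integrable_comp_emb
    (ptEquiv n).toHomeomorph.measurableEmbedding).2 j2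
  rw [Measure.volume_eq_prod] at jj jj1 jj2 ⊢
  have := integral_prod_symm _ jj
  simp only [Function.comp_def, Pi.add_apply] at this
  rw [this]
  unfold form
  refine integral_congr_ae ?_
  filter_upwards [jj1.prod_left_ae, jj2.prod_left_ae] with y h1 h2
  simp only [Function.comp_def] at h1 h2
  rw [integral_add h1 h2]
  simp only [weight_pt, tensor, xPart_pt, yPart_pt]
  rw [← integral_const_mul, ← integral_const_mul]
  congr 1 <;> exact integral_congr_ae (.of_forall fun x => by simp only []; ring)

lemma integral_weight_tensor (g : E n → ℝ) (η : E n → ℝ) (χ : ℝ → ℝ) :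
    ∫ X, weight a X * g (xPart X) * tensor η χ X = (∫ y, |y| ^ a * χ y) * ∫ x, g x * η x := by
  rw [integral_eq_integral_pt, mul_comm, Measure.volume_eq_prod, ← integral_prod_mul]
  exact integral_congr_ae (.of_forall fun p => by simp [weight, tensor]; ring)

/-- A solution satisfies the equation tested against `η(x) χ(y)` away from its contact set. -/
lemma IsSolution.form_eq (ha : -1 < a) {Ω : Set (E (n + 1))} (hΩ : IsOpen Ω) {g : E n → ℝ}
    {u : E (n + 1) → ℝ} (hu : IsSolution a Ω g u)
    {η : E n → ℝ} {χ : ℝ → ℝ} (hη : Smc η) (hχ : FlatTest χ)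
    (h : ∀ x ∈ tsupport η, ∀ y ∈ tsupport χ, pt x y ∈ Ω \ contactSet Ω u) :
    form a (fun p => u (pt p.1 p.2)) η χ = (∫ y, |y| ^ a * χ y) * ∫ x, g x * η x := by
  obtain ⟨G, hG, h1, -⟩ := hu.equation
  rw [← integral_weight_fderiv_tensor ha hu.continuousOn hΩ hG hη hχ fun x hx y hy =>
    (h x hx y hy).1, h1 _ (hη.isTest_tensor hχ.toSmc h), integral_weight_tensor]

/-- A solution is a supersolution when tested against `η(x) χ(y) ≥ 0`. -/
lemma IsSolution.form_le (ha : -1 < a) {Ω : Set (E (n + 1))} (hΩ : IsOpen Ω) {g : E n → ℝ}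
    {u : E (n + 1) → ℝ} (hu : IsSolution a Ω g u)
    {η : E n → ℝ} {χ : ℝ → ℝ} (hη : Smc η) (hχ : FlatTest χ)
    (hη0 : ∀ x, 0 ≤ η x) (hχ0 : ∀ y, 0 ≤ χ y)
    (h : ∀ x ∈ tsupport η, ∀ y ∈ tsupport χ, pt x y ∈ Ω) :
    form a (fun p => u (pt p.1 p.2)) η χ ≤ (∫ y, |y| ^ a * χ y) * ∫ x, g x * η x := by
  obtain ⟨G, hG, -, h1⟩ := hu.equation
  rw [← integral_weight_fderiv_tensor ha hu.continuousOn hΩ hG hη hχ h, ← integral_weight_tensor]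
  exact h1 _ (hη.isTest_tensor hχ.toSmc h) fun X => mul_nonneg (hη0 _) (hχ0 _)

/-! ### One-dimensional integration by parts for (|y|^a χ')' -/

/-- The fundamental theorem of calculus tolerates a countable exceptional set. Powers of |y| are
therefore handled by continuity across 0 and differentiability elsewhere. -/
lemma integral_eq_zero_of_hasDerivAt_of_hasCompactSupport {H H' : ℝ → ℝ} (hc : Continuous H)
    (hs : HasCompactSupport H) (hd : ∀ y ≠ 0, HasDerivAt H (H' y) y) (hi : Integrable H') :
    ∫ y, H' y = 0 := by
  obtain ⟨R, hR, hR'⟩ := hs.isCompact.isBounded.subset_ball_lt 0 0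
  have hz : ∀ y, R ≤ |y| → H y = 0 := fun y hy => image_eq_zero_of_notMem_tsupport fun h => by
    have := hR' h
    simp at this
    linarith
  have hz' : ∀ y, R < |y| → H' y = 0 := fun y hy => by
    have hy0 : y ≠ 0 := abs_pos.1 (hR.trans hy)
    refine (hd y hy0).unique ((hasDerivAt_const y (0 : ℝ)).congr_of_eventuallyEq ?_)
    filter_upwards [continuous_abs.continuousAt.eventually (lt_mem_nhds hy)] with z hz1
    exact hz z hz1.le
  have h1 : ∫ y in (-(R + 1))..(R + 1), H' y = H (R + 1) - H (-(R + 1)) :=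
    integral_eq_of_hasDerivAt_off_countable (s := {0}) H H' (countable_singleton _)
      hc.continuousOn (fun y hy => hd y hy.2) hi.intervalIntegrable
  rw [hz, hz, sub_zero, intervalIntegral.integral_of_le (by linarith),
    setIntegral_eq_integral_of_forall_compl_eq_zero] at h1
  · exact h1
  · intro y hy
    refine hz' y ?_
    by_contra hcon
    exact hy ⟨by linarith [neg_abs_le y], by linarith [le_abs_self y]⟩
  · rw [abs_neg, abs_of_pos] <;> linarith
  · rw [abs_of_pos] <;> linarith

lemma integral_wd (a : ℝ) {χ : ℝ → ℝ} (hχ : FlatTest χ) : ∫ y, wd a χ y = 0 :=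
  integral_eq_zero_of_hasDerivAt_of_hasCompactSupport (hχ.smc_flux a).smooth.continuous
    (hχ.smc_flux a).cs
    (fun y _ => ((hχ.smc_flux a).smooth.differentiable (by simp) y).hasDerivAt)
    (hχ.smc_wd.smooth.continuous.integrable_of_hasCompactSupport hχ.smc_wd.cs)

lemma continuous_mul_abs_rpow {c : ℝ} (hc : -1 < c) : Continuous fun y : ℝ => y * |y| ^ c := by
  rw [continuous_iff_continuousAt]
  intro y
  rcases eq_or_ne y 0 with rfl | hy
  · have h : Tendsto (fun y : ℝ => |y| ^ (c + 1)) (𝓝 0) (𝓝 0) := by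
      have : ContinuousAt (fun y : ℝ => |y| ^ (c + 1)) 0 :=
        continuous_abs.continuousAt.rpow_const (Or.inr (by linarith))
      simpa [ContinuousAt, Real.zero_rpow (by linarith : c + 1 ≠ 0)] using this
    have : Tendsto (fun y : ℝ => y * |y| ^ c) (𝓝 0) (𝓝 0) := by
      refine squeeze_zero_norm (fun y => ?_) h
      rcases eq_or_ne y 0 with rfl | hy
      · simp [Real.rpow_nonneg]
      · rw [norm_mul, Real.norm_eq_abs, Real.norm_of_nonneg (by positivity),
          Real.rpow_add_one (abs_ne_zero.2 hy), mul_comm]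
    simpa [ContinuousAt] using this
  · exact continuousAt_id.mul
      (continuous_abs.continuousAt.rpow_const (Or.inl (abs_ne_zero.2 hy)))

lemma hasDerivAt_abs_rpow (p : ℝ) {y : ℝ} (hy : y ≠ 0) :
    HasDerivAt (fun y : ℝ => |y| ^ p) (p * (y * |y| ^ (p - 2))) y := by
  have := (hasDerivAt_abs hy).rpow_const (p := p) (Or.inl (abs_ne_zero.2 hy))
  convert this using 1
  have h1 : |y| ^ (p - 1) = |y| ^ (p - 2) * |y| := by
    rw [← Real.rpow_add_one (abs_ne_zero.2 hy)]; ring_nf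
  rw [h1]
  have h2 : (SignType.sign y : ℝ) * |y| = y := sign_mul_abs y
  calc p * (y * |y| ^ (p - 2)) = p * (((SignType.sign y : ℝ) * |y|) * |y| ^ (p - 2)) := by rw [h2]
    _ = _ := by ring

lemma hasDerivAt_mul_abs_rpow (c : ℝ) {y : ℝ} (hy : y ≠ 0) :
    HasDerivAt (fun y : ℝ => y * |y| ^ c) ((c + 1) * |y| ^ c) y := by
  refine HasDerivAt.congr_deriv ((hasDerivAt_id y).mul (hasDerivAt_abs_rpow c hy)) ?_
  have h1 : |y| ^ c = |y| ^ (c - 2) * (y * y) := by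
    rw [← abs_mul_abs_self, ← pow_two, ← Real.rpow_add_natCast (abs_ne_zero.2 hy)]
    norm_num
  simp only [id]
  rw [h1]
  ring

lemma continuous_abs_rpow_mul_of_eventually_zero {f : ℝ → ℝ} (b : ℝ) (hf : Continuous f)
    (h0 : ∀ᶠ y in 𝓝 0, f y = 0) : Continuous fun y => |y| ^ b * f y := by
  rw [continuous_iff_continuousAt]
  intro y
  rcases eq_or_ne y 0 with rfl | hy
  · refine (continuousAt_const (y := (0 : ℝ))).congr ?_
    filter_upwards [h0] with y hy using by simp [hy]
  · exact (continuous_abs.continuousAt.rpow_const (Or.inl (abs_ne_zero.2 hy))).mul hf.continuousAt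

lemma FlatTest.wd_eventually_zero (a : ℝ) {χ : ℝ → ℝ} (hχ : FlatTest χ) :
    ∀ᶠ y in 𝓝 0, wd a χ y = 0 := by
  filter_upwards [hχ.flat.eventually_nhds] with y hy
  have : (fun y => |y| ^ a * deriv χ y) =ᶠ[𝓝 y] fun _ => 0 := by
    filter_upwards [hy] with z hz using by simp [hz]
  unfold wd
  rw [this.deriv_eq]
  simp

lemma integrable_abs_rpow_mul {χ : ℝ → ℝ} (hχ : Smc χ) {b : ℝ}
    (hb : -1 < b ∨ (0 : ℝ) ∉ tsupport χ) : Integrable fun y => |y| ^ b * χ y := by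
  rcases hb with hb | hb
  · exact (locallyIntegrable_abs_rpow hb).integrable_smul_right_of_hasCompactSupport
      hχ.smooth.continuous hχ.cs
  · exact (continuous_abs_rpow_mul_of_eventually_zero b hχ.smooth.continuous
      (notMem_tsupport_iff_eventuallyEq.1 hb)).integrable_of_hasCompactSupport hχ.cs.mul_left

/-- `L_a |y|^p = p (p - 1 + a) |y|^{p - 2 + a}` in weak form. -/
lemma integral_abs_rpow_mul_wd {χ : ℝ → ℝ} (hχ : FlatTest χ) {p : ℝ}
    (hp : 1 < p + a ∨ (0 : ℝ) ∉ tsupport χ) :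
    ∫ y, |y| ^ p * wd a χ y = p * (p - 1 + a) * ∫ y, |y| ^ (p - 2 + a) * χ y := by
  have i1 : Integrable fun y => |y| ^ p * wd a χ y :=
    (continuous_abs_rpow_mul_of_eventually_zero p hχ.smc_wd.smooth.continuous
      (hχ.wd_eventually_zero a)).integrable_of_hasCompactSupport hχ.smc_wd.cs.mul_left
  have i2 : Integrable fun y => |y| ^ (p - 2 + a) * χ y :=
    integrable_abs_rpow_mul hχ.toSmc (hp.imp (fun h => by linarith) id)
  have hflux := hχ.smc_flux a
  -- Both integrations by parts at once: the function is the boundary term |y|^p·|y|^a χ' -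
  -- |y|^a(|y|^p)'χ. It is continuous at 0 because p - 2 + a > -1, or because χ vanishes near 0.
  have key := integral_eq_zero_of_hasDerivAt_of_hasCompactSupport
    (H := fun y => |y| ^ p * (|y| ^ a * deriv χ y) - p * ((y * |y| ^ (p - 2 + a)) * χ y))
    (H' := fun y => |y| ^ p * wd a χ y - p * (p - 1 + a) * (|y| ^ (p - 2 + a) * χ y))
    ?_ ?_ ?_ (i1.sub (i2.const_mul _))
  · rw [integral_sub i1 (i2.const_mul _), integral_const_mul] at key
    linarith
  · refine Continuous.sub ?_ (continuous_const.mul ?_)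
    · refine continuous_abs_rpow_mul_of_eventually_zero p hflux.smooth.continuous ?_
      filter_upwards [hχ.flat] with y hy using by simp [hy]
    · rcases hp with hp | hp
      · exact (continuous_mul_abs_rpow (by linarith)).mul hχ.smooth.continuous
      · simp_rw [mul_assoc]
        exact continuous_id.mul (continuous_abs_rpow_mul_of_eventually_zero _ hχ.smooth.continuous
          (notMem_tsupport_iff_eventuallyEq.1 hp))
  · exact (hflux.cs.mul_left).sub (hχ.cs.mul_left.mul_left)
  · intro y hy
    have d1 := (hasDerivAt_abs_rpow p hy).mul
      (hflux.smooth.differentiable (by simp) y).hasDerivAt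
    have d2 := ((hasDerivAt_mul_abs_rpow (p - 2 + a) hy).mul
      (hχ.smooth.differentiable (by simp) y).hasDerivAt).const_mul p
    refine HasDerivAt.congr_deriv (d1.sub d2) ?_
    have e : |y| ^ (p - 2 + a) = |y| ^ (p - 2) * |y| ^ a := Real.rpow_add (abs_pos.2 hy) _ _
    simp only [wd]
    rw [e]
    ring

/-! ### Test functions that detect a strict minimum -/

/-- A smooth monotone step that rises from `0` to `1` on `[c, c + w]`. -/
def step (c w z : ℝ) : ℝ := Real.smoothTransition ((z - c) / w)

lemma contDiff_step (c w : ℝ) : ContDiff ℝ ∞ (step c w) :=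
  Real.smoothTransition.contDiff.comp ((contDiff_id.sub contDiff_const).div_const w)

lemma step_eq_zero {c w z : ℝ} (hw : 0 < w) (h : z ≤ c) : step c w z = 0 :=
  Real.smoothTransition.zero_of_nonpos (div_nonpos_of_nonpos_of_nonneg (by linarith) hw.le)

lemma step_eq_one {c w z : ℝ} (hw : 0 < w) (h : c + w ≤ z) : step c w z = 1 :=
  Real.smoothTransition.one_of_one_le ((one_le_div hw).2 (by linarith))

lemma monotone_step {c w : ℝ} (hw : 0 < w) : Monotone (step c w) := fun z z' h =>
  Real.smoothTransition.monotone (by gcongr)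

lemma deriv_step_nonneg {c w : ℝ} (hw : 0 < w) (z : ℝ) : 0 ≤ deriv (step c w) z :=
  (monotone_step hw).deriv_nonneg

lemma deriv_step_eq_zero {c w z : ℝ} (hw : 0 < w) (h : z ∉ Icc c (c + w)) :
    deriv (step c w) z = 0 := by
  rw [mem_Icc, not_and_or, not_le, not_le] at h
  rcases h with h | h
  · have : step c w =ᶠ[𝓝 z] fun _ => 0 := by
      filter_upwards [gt_mem_nhds h] with t ht using step_eq_zero hw ht.le
    rw [this.deriv_eq]; simp
  · have : step c w =ᶠ[𝓝 z] fun _ => 1 := by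
      filter_upwards [lt_mem_nhds h] with t ht using step_eq_one hw ht.le
    rw [this.deriv_eq]; simp

lemma continuous_deriv_step (c w : ℝ) : Continuous (deriv (step c w)) :=
  (contDiff_infty_iff_deriv.1 (contDiff_step c w)).2.continuous

lemma hasCompactSupport_deriv_step {c w : ℝ} (hw : 0 < w) :
    HasCompactSupport (deriv (step c w)) :=
  HasCompactSupport.intro isCompact_Icc fun _ h => deriv_step_eq_zero hw h

lemma integral_deriv_step {c w : ℝ} (hw : 0 < w) : ∫ z, deriv (step c w) z = 1 := by
  have h1 : ∫ z in (c - 1)..(c + w), deriv (step c w) z = step c w (c + w) - step c w (c - 1) :=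
    intervalIntegral.integral_deriv_eq_sub
      (fun x _ => (contDiff_step c w).differentiable (by simp) x)
      ((continuous_deriv_step c w).intervalIntegrable _ _)
  rw [step_eq_one hw le_rfl, step_eq_zero hw (by linarith),
    intervalIntegral.integral_of_le (by linarith),
    setIntegral_eq_integral_of_forall_compl_eq_zero] at h1
  · simpa using h1
  · intro z hz
    exact deriv_step_eq_zero hw fun h => hz ⟨by linarith [h.1], h.2⟩

lemma integrable_mul_deriv_step {c w : ℝ} (hw : 0 < w) {D : ℝ → ℝ} (hD : Continuous D) :
    Integrable fun z => D z * deriv (step c w) z :=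
  (hD.mul (continuous_deriv_step c w)).integrable_of_hasCompactSupport
    (hasCompactSupport_deriv_step hw).mul_left

lemma le_integral_mul_deriv_step {c w m : ℝ} (hw : 0 < w) {D : ℝ → ℝ} (hD : Continuous D)
    (h : ∀ z ∈ Icc c (c + w), m ≤ D z) : m ≤ ∫ z, D z * deriv (step c w) z := by
  have := integral_mono (integrable_mul_deriv_step hw continuous_const)
    (integrable_mul_deriv_step hw hD) (fun z => by
      show m * deriv (step c w) z ≤ D z * deriv (step c w) z
      by_cases hz : z ∈ Icc c (c + w)
      · exact mul_le_mul_of_nonneg_right (h z hz) (deriv_step_nonneg hw z)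
      · simp [deriv_step_eq_zero hw hz])
  rwa [integral_const_mul, integral_deriv_step hw, mul_one] at this

lemma integral_mul_deriv_step_le {c w m : ℝ} (hw : 0 < w) {D : ℝ → ℝ} (hD : Continuous D)
    (h : ∀ z ∈ Icc c (c + w), D z ≤ m) : ∫ z, D z * deriv (step c w) z ≤ m := by
  have := le_integral_mul_deriv_step (m := -m) hw hD.neg fun z hz => neg_le_neg (h z hz)
  have e : ∫ z, (-D) z * deriv (step c w) z = - ∫ z, D z * deriv (step c w) z := by
    rw [← integral_neg]
    simp
  linarith

/-- A smooth plateau supported in `[δ/2, 3r/4]`. -/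
def plateau (δ r z : ℝ) : ℝ := step (δ / 2) (δ / 2) z - step (r / 2) (r / 4) z

section plateau
variable {δ r : ℝ}

lemma contDiff_plateau (δ r : ℝ) : ContDiff ℝ ∞ (plateau δ r) :=
  (contDiff_step _ _).sub (contDiff_step _ _)

lemma plateau_eq_zero_of_le (hδ : 0 < δ) (hδr : δ < r / 2) {z : ℝ} (h : z ≤ δ / 2) :
    plateau δ r z = 0 := by
  unfold plateau
  rw [step_eq_zero (by linarith) h, step_eq_zero (by linarith) (by linarith), sub_zero]

lemma plateau_eq_zero_of_ge (hδ : 0 < δ) (hδr : δ < r / 2) {z : ℝ} (h : 3 * r / 4 ≤ z) :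
    plateau δ r z = 0 := by
  unfold plateau
  rw [step_eq_one (by linarith) (by linarith), step_eq_one (by linarith) (by linarith), sub_self]

lemma plateau_nonneg (hδ : 0 < δ) (hδr : δ < r / 2) (z : ℝ) : 0 ≤ plateau δ r z := by
  unfold plateau
  rcases le_total z (r / 2) with h | h
  · rw [step_eq_zero (by linarith : 0 < r / 4) h, sub_zero]
    exact Real.smoothTransition.nonneg _
  · rw [step_eq_one (by linarith : 0 < δ / 2) (by linarith)]
    exact sub_nonneg.2 (Real.smoothTransition.le_one _)

lemma plateau_eq_one (hδ : 0 < δ) (hδr : δ < r / 2) : plateau δ r (r / 2) = 1 := by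
  unfold plateau
  rw [step_eq_one (by linarith) (by linarith), step_eq_zero (by linarith) le_rfl, sub_zero]

/-- The derivative of the plateau is a probability density on [δ/2, δ] minus one on [r/2, 3r/4]. The
integral is thus an average of D where D ≤ μ/2 minus an average where D ≥ μ. -/
lemma integral_mul_deriv_plateau_neg (hδ : 0 < δ) (hδr : δ < r / 2) {μ : ℝ} (hμ : 0 < μ)
    {D : ℝ → ℝ} (hD : Continuous D) (h1 : ∀ z ∈ Icc 0 δ, D z ≤ μ / 2)
    (h2 : ∀ z ∈ Icc (r / 2) r, μ ≤ D z) : ∫ z, D z * deriv (plateau δ r) z < 0 := by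
  have e : ∀ z, D z * deriv (plateau δ r) z =
      D z * deriv (step (δ / 2) (δ / 2)) z - D z * deriv (step (r / 2) (r / 4)) z := fun z => by
    have : deriv (plateau δ r) z =
        deriv (step (δ / 2) (δ / 2)) z - deriv (step (r / 2) (r / 4)) z :=
      deriv_sub ((contDiff_step _ _).differentiable (by simp) z)
        ((contDiff_step _ _).differentiable (by simp) z)
    rw [this]; ring
  simp_rw [e]
  rw [integral_sub (integrable_mul_deriv_step (by linarith) hD)
    (integrable_mul_deriv_step (by linarith) hD)]
  have i1 := integral_mul_deriv_step_le (by linarith : 0 < δ / 2) hD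
    fun z (hz : z ∈ Icc (δ / 2) (δ / 2 + δ / 2)) => h1 z ⟨by linarith [hz.1], by linarith [hz.2]⟩
  have i2 := le_integral_mul_deriv_step (by linarith : 0 < r / 4) hD
    fun z (hz : z ∈ Icc (r / 2) (r / 2 + r / 4)) => h2 z ⟨hz.1, by linarith [hz.2]⟩
  linarith

end plateau

/-- A smooth compactly supported function with zero integral that is nonnegative on `(-∞, c]` and
nonpositive on `[c, ∞)` has a nonnegative smooth compactly supported primitive. -/
lemma exists_primitive {κ : ℝ → ℝ} {c r : ℝ} (hκ : ContDiff ℝ ∞ κ)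
    (hs : ∀ t, t ∉ closedBall c r → κ t = 0) (h0 : ∫ t, κ t = 0)
    (hl : ∀ t ≤ c, 0 ≤ κ t) (hg : ∀ t, c ≤ t → κ t ≤ 0) :
    ∃ χ : ℝ → ℝ, ContDiff ℝ ∞ χ ∧ deriv χ = κ ∧ (∀ y, 0 ≤ χ y) ∧
      tsupport χ ⊆ closedBall c r := by
  have hcs : HasCompactSupport κ := HasCompactSupport.intro (isCompact_closedBall c r) hs
  have hi : Integrable κ := hκ.continuous.integrable_of_hasCompactSupport hcs
  set χ : ℝ → ℝ := fun y => ∫ t in Iic y, κ t with hχ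
  have hder : ∀ y, HasDerivAt χ (κ y) y := fun y => by
    have e : χ = fun y => (∫ t in (0 : ℝ)..y, κ t) + ∫ t in Iic 0, κ t := by
      ext y
      rw [← intervalIntegral.integral_Iic_sub_Iic hi.integrableOn hi.integrableOn, sub_add_cancel]
    rw [e]
    exact (intervalIntegral.integral_hasDerivAt_right (hκ.continuous.intervalIntegrable _ _)
      (hκ.continuous.stronglyMeasurableAtFilter _ _) hκ.continuous.continuousAt).add_const _
  have hd : deriv χ = κ := funext fun y => (hder y).deriv
  -- Vanishing total integral lets the primitive be computed from the right as well, which gives its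
  -- sign and its support beyond c.
  have hright : ∀ y, χ y = - ∫ t in Ioi y, κ t := fun y => by
    have := integral_add_compl (measurableSet_Iic (a := y)) hi
    rw [compl_Iic, h0] at this
    simp only [hχ]
    linarith
  refine ⟨χ, ?_, hd, fun y => ?_, ?_⟩
  · rw [contDiff_infty_iff_deriv, hd]
    exact ⟨fun y => (hder y).differentiableAt, hκ⟩
  · rcases le_total y c with h | h
    · exact setIntegral_nonneg measurableSet_Iic fun t ht => hl t (ht.trans h)
    · rw [hright, neg_nonneg]
      exact setIntegral_nonpos measurableSet_Ioi fun t ht => hg t (h.trans ht.le)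
  · refine closure_minimal (fun y hy => ?_) isClosed_closedBall
    by_contra hy'
    rw [Real.closedBall_eq_Icc, mem_Icc, not_and_or, not_le, not_le] at hy'
    apply hy
    rcases hy' with h | h
    · refine setIntegral_eq_zero_of_forall_eq_zero fun t ht => hs t ?_
      rw [Real.closedBall_eq_Icc]
      exact fun h' => by linarith [h'.1, mem_Iic.1 ht]
    · rw [hright, neg_eq_zero]
      refine setIntegral_eq_zero_of_forall_eq_zero fun t ht => hs t ?_
      rw [Real.closedBall_eq_Icc]
      exact fun h' => by linarith [h'.2, mem_Ioi.1 ht]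

/-- If `d` has a local minimum at `y₁` that is strict at distances in `[r/2, r]`, then `d` is not a
weak supersolution of `(|y|^a d')' ≤ 0` near `y₁`. -/
lemma exists_flatTest_integral_pos (a : ℝ) {d : ℝ → ℝ} (hd : Continuous d) {y₁ r μ : ℝ}
    (hr : 0 < r) (hμ : 0 < μ) (hy : y₁ = 0 ∨ r < |y₁|)
    (h2 : ∀ y, r / 2 ≤ |y - y₁| → |y - y₁| ≤ r → d y₁ + μ ≤ d y) :
    ∃ χ, FlatTest χ ∧ (∀ y, 0 ≤ χ y) ∧ tsupport χ ⊆ closedBall y₁ r ∧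
      0 < ∫ y, d y * wd a χ y := by
  obtain ⟨δ', hδ', hδd⟩ := Metric.continuous_iff.1 hd y₁ (μ / 2) (by positivity)
  set δ := min (δ' / 2) (r / 4) with hδdef
  have hδ : 0 < δ := by positivity
  have hδr : δ < r / 2 := (min_le_right _ _).trans_lt (by linarith)
  have hδδ' : δ < δ' := (min_le_left _ _).trans_lt (by linarith)
  have hdδ : ∀ y, |y - y₁| ≤ δ → d y - d y₁ ≤ μ / 2 := fun y hy => by
    have := hδd y (by rw [Real.dist_eq]; linarith)
    rw [Real.dist_eq] at this
    linarith [le_abs_self (d y - d y₁)]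
  have hP := contDiff_plateau δ r
  set P := plateau δ r with hPdef
  have hP0 := plateau_nonneg hδ hδr
  let Pr : ℝ → ℝ := fun y => P (y - y₁)
  let Pl : ℝ → ℝ := fun y => P (y₁ - y)
  have hPr : ContDiff ℝ ∞ Pr := hP.comp (contDiff_id.sub contDiff_const)
  have hPl : ContDiff ℝ ∞ Pl := hP.comp (contDiff_const.sub contDiff_id)
  have hPrs : ∀ y, y ∉ closedBall y₁ r → Pr y = 0 := fun y hy => by
    rw [Real.closedBall_eq_Icc, mem_Icc, not_and_or, not_le, not_le] at hy
    rcases hy with h | h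
    · exact plateau_eq_zero_of_le hδ hδr (by linarith)
    · exact plateau_eq_zero_of_ge hδ hδr (by linarith)
  have hPls : ∀ y, y ∉ closedBall y₁ r → Pl y = 0 := fun y hy => by
    rw [Real.closedBall_eq_Icc, mem_Icc, not_and_or, not_le, not_le] at hy
    rcases hy with h | h
    · exact plateau_eq_zero_of_ge hδ hδr (by linarith)
    · exact plateau_eq_zero_of_le hδ hδr (by linarith)
  -- Source of flatness: the flux vanishes near y = 0, either because 0 is the centre, where both
  -- plateaus vanish, or because 0 lies outside the closed ball.
  have hnear : ∀ᶠ y in 𝓝 (0 : ℝ), Pr y = 0 ∧ Pl y = 0 := by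
    rcases hy with rfl | hy
    · filter_upwards [Metric.ball_mem_nhds (0 : ℝ) (by positivity : 0 < δ / 2)] with y hy
      rw [mem_ball_zero_iff, Real.norm_eq_abs] at hy
      exact ⟨plateau_eq_zero_of_le hδ hδr (by linarith [le_abs_self y]),
        plateau_eq_zero_of_le hδ hδr (by linarith [neg_abs_le y])⟩
    · filter_upwards [Metric.ball_mem_nhds (0 : ℝ) (sub_pos.2 hy)] with y hyy
      have : y ∉ closedBall y₁ r := fun h => by
        rw [mem_ball_zero_iff, Real.norm_eq_abs] at hyy
        rw [mem_closedBall, Real.dist_eq] at h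
        have := abs_sub_abs_le_abs_sub y₁ y
        rw [abs_sub_comm] at this
        linarith
      exact ⟨hPrs y this, hPls y this⟩
  have hwr : ContDiff ℝ ∞ fun y => |y| ^ (-a) * Pr y :=
    contDiff_abs_rpow_mul _ hPr (hnear.mono fun _ h => h.1)
  have hwl : ContDiff ℝ ∞ fun y => |y| ^ (-a) * Pl y :=
    contDiff_abs_rpow_mul _ hPl (hnear.mono fun _ h => h.2)
  have hir : Integrable fun y => |y| ^ (-a) * Pr y :=
    hwr.continuous.integrable_of_hasCompactSupport
      (HasCompactSupport.intro (isCompact_closedBall y₁ r) fun y hy => by simp [hPrs y hy])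
  have hil : Integrable fun y => |y| ^ (-a) * Pl y :=
    hwl.continuous.integrable_of_hasCompactSupport
      (HasCompactSupport.intro (isCompact_closedBall y₁ r) fun y hy => by simp [hPls y hy])
  have hne : ∀ t, t - y₁ = r / 2 ∨ y₁ - t = r / 2 → t ≠ 0 := by
    rintro t ht rfl
    rcases hy with rfl | hy
    · rcases ht with ht | ht <;> linarith
    · rcases ht with ht | ht
      · rw [show y₁ = -(r / 2) by linarith, abs_neg, abs_of_pos (by linarith)] at hy; linarith
      · rw [show y₁ = r / 2 by linarith, abs_of_pos (by linarith)] at hy; linarith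
  have hpos : ∀ Q : ℝ → ℝ, Continuous (fun y => |y| ^ (-a) * Q y) →
      Integrable (fun y => |y| ^ (-a) * Q y) → (∀ y, 0 ≤ Q y) → (∃ t, t ≠ 0 ∧ Q t = 1) →
      0 < ∫ y, |y| ^ (-a) * Q y := by
    rintro Q hQ hQi hQ0 ⟨t, ht, hQt⟩
    refine integral_pos_of_integrable_nonneg_nonzero (x := t) hQ hQi
      (fun y => mul_nonneg (Real.rpow_nonneg (abs_nonneg _) _) (hQ0 y)) ?_
    rw [hQt, mul_one]
    exact (Real.rpow_pos_of_pos (abs_pos.2 ht) _).ne'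
  have hAr := hpos Pr hwr.continuous hir (fun y => hP0 _)
    ⟨y₁ + r / 2, hne _ (Or.inl (by ring)), by
      show P (y₁ + r / 2 - y₁) = 1
      rw [add_sub_cancel_left]; exact plateau_eq_one hδ hδr⟩
  have hAl := hpos Pl hwl.continuous hil (fun y => hP0 _)
    ⟨y₁ - r / 2, hne _ (Or.inr (by ring)), by
      show P (y₁ - (y₁ - r / 2)) = 1
      rw [sub_sub_cancel]; exact plateau_eq_one hδ hδr⟩
  set Ar := ∫ y, |y| ^ (-a) * Pr y
  set Al := ∫ y, |y| ^ (-a) * Pl y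
  -- Ψ is the prescribed flux |y|^a χ'. It is nonnegative left of y₁ and nonpositive right of it, so
  -- χ rises and then falls. The crossed weights make ∫|y|^{-a}Ψ = 0, so χ has compact support.
  let Ψ : ℝ → ℝ := fun y => Ar * Pl y - Al * Pr y
  have hΨ : ContDiff ℝ ∞ Ψ := (contDiff_const.mul hPl).sub (contDiff_const.mul hPr)
  have hΨ0 : ∀ᶠ y in 𝓝 (0 : ℝ), Ψ y = 0 := hnear.mono fun y h => by simp [Ψ, h.1, h.2]
  obtain ⟨χ, hχ, hχd, hχ0, hχs⟩ := exists_primitive (κ := fun y => |y| ^ (-a) * Ψ y)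
    (c := y₁) (r := r) (contDiff_abs_rpow_mul _ hΨ hΨ0)
    (fun t ht => by simp [Ψ, hPrs t ht, hPls t ht])
    (by
      have e : ∀ y, |y| ^ (-a) * Ψ y =
          Ar * (|y| ^ (-a) * Pl y) - Al * (|y| ^ (-a) * Pr y) := fun y => by
        simp only [Ψ]; ring
      simp_rw [e]
      rw [integral_sub (hil.const_mul _) (hir.const_mul _), integral_const_mul,
        integral_const_mul]
      exact sub_eq_zero.2 (mul_comm _ _))
    (fun t ht => by
      have : Pr t = 0 := plateau_eq_zero_of_le hδ hδr (by linarith)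
      have h3 : 0 ≤ Pl t := hP0 _
      simp only [Ψ, this, mul_zero, sub_zero]
      positivity)
    (fun t ht => by
      have : Pl t = 0 := plateau_eq_zero_of_le hδ hδr (by linarith)
      have h3 : 0 ≤ Pr t := hP0 _
      simp only [Ψ, this, mul_zero, zero_sub]
      rw [mul_neg, neg_nonpos]
      positivity)
  have hflat : FlatTest χ :=
    { smooth := hχ
      cs := HasCompactSupport.of_support_subset_isCompact (isCompact_closedBall y₁ r)
        ((subset_tsupport χ).trans hχs)
      flat := by
        rw [hχd]
        exact hΨ0.mono fun y h => by simp [h] }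
  refine ⟨χ, hflat, hχ0, hχs, ?_⟩
  have hwd : wd a χ = deriv Ψ := by
    unfold wd
    congr 1
    ext y
    rw [hχd]
    rcases eq_or_ne y 0 with rfl | hy0
    · simp [hΨ0.self_of_nhds]
    · rw [← mul_assoc, ← Real.rpow_add (abs_pos.2 hy0)]
      simp
  have hdΨ : ∀ y, deriv Ψ y = -(Ar * deriv P (y₁ - y)) - Al * deriv P (y - y₁) := fun y => by
    have d1 : HasDerivAt Pr (deriv P (y - y₁)) y := by
      have := (hP.differentiable (by simp) (y - y₁)).hasDerivAt
      exact this.comp_sub_const y y₁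
    have d2 : HasDerivAt Pl (-deriv P (y₁ - y)) y := by
      have := (hP.differentiable (by simp) (y₁ - y)).hasDerivAt
      exact this.comp_const_sub y₁ y
    have : HasDerivAt Ψ _ y := (d2.const_mul Ar).sub (d1.const_mul Al)
    rw [this.deriv]
    ring
  have hcP : Continuous (deriv P) := (contDiff_infty_iff_deriv.1 hP).2.continuous
  have hPc : HasCompactSupport P := HasCompactSupport.intro (isCompact_Icc (a := 0) (b := r))
    fun z hz => by
      rw [mem_Icc, not_and_or, not_le, not_le] at hz
      rcases hz with h | h
      · exact plateau_eq_zero_of_le hδ hδr (by linarith)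
      · exact plateau_eq_zero_of_ge hδ hδr (by linarith)
  have n1 := integral_mul_deriv_plateau_neg hδ hδr hμ (D := fun z => d (y₁ + z) - d y₁)
    (by fun_prop)
    (fun z hz => hdδ _ (by rw [add_sub_cancel_left, abs_of_nonneg hz.1]; exact hz.2))
    (fun z hz => by
      have := h2 (y₁ + z) (by rw [add_sub_cancel_left]; exact hz.1.trans (le_abs_self z))
        (by rw [add_sub_cancel_left, abs_of_nonneg (by linarith [hz.1])]; exact hz.2)
      show μ ≤ d (y₁ + z) - d y₁
      linarith)
  have n2 := integral_mul_deriv_plateau_neg hδ hδr hμ (D := fun z => d (y₁ - z) - d y₁)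
    (by fun_prop)
    (fun z hz => hdδ _ (by rw [sub_sub_cancel_left, abs_neg, abs_of_nonneg hz.1]; exact hz.2))
    (fun z hz => by
      have := h2 (y₁ - z) (by rw [sub_sub_cancel_left, abs_neg]; exact hz.1.trans (le_abs_self z))
        (by rw [sub_sub_cancel_left, abs_neg, abs_of_nonneg (by linarith [hz.1])]; exact hz.2)
      show μ ≤ d (y₁ - z) - d y₁
      linarith)
  have e1 : ∫ z, (d (y₁ + z) - d y₁) * deriv P z = ∫ y, (d y - d y₁) * deriv P (y - y₁) := by
    rw [← integral_sub_right_eq_self _ y₁]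
    simp
  have e2 : ∫ z, (d (y₁ - z) - d y₁) * deriv P z = ∫ y, (d y - d y₁) * deriv P (y₁ - y) := by
    rw [← integral_sub_left_eq_self _ volume y₁]
    simp
  rw [← hPdef, e1] at n1
  rw [← hPdef, e2] at n2
  have hi1 : Integrable fun y => (d y - d y₁) * deriv P (y - y₁) :=
    Continuous.integrable_of_hasCompactSupport (by fun_prop)
      ((hPc.deriv.comp_homeomorph (Homeomorph.subRight y₁)).mul_left)
  have hi2 : Integrable fun y => (d y - d y₁) * deriv P (y₁ - y) :=
    Continuous.integrable_of_hasCompactSupport (by fun_prop)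
      ((hPc.deriv.comp_homeomorph (Homeomorph.subLeft y₁)).mul_left)
  have hiw : Integrable (wd a χ) :=
    hflat.smc_wd.smooth.continuous.integrable_of_hasCompactSupport hflat.smc_wd.cs
  have hid : Integrable fun y => d y * wd a χ y :=
    (hd.mul hflat.smc_wd.smooth.continuous).integrable_of_hasCompactSupport
      hflat.smc_wd.cs.mul_left
  -- Since ∫(|y|^a χ')' = 0, d may be replaced by its excess over d(y₁). Testing it with Ψ' gives
  -- -Ar and -Al times the two negative plateau integrals.
  have e3 : ∫ y, d y * wd a χ y = ∫ y, (d y - d y₁) * wd a χ y := by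
    simp_rw [sub_mul]
    rw [integral_sub hid (hiw.const_mul _), integral_const_mul, integral_wd a hflat, mul_zero,
      sub_zero]
  have e4 : ∀ y, (d y - d y₁) * wd a χ y = (-Ar) * ((d y - d y₁) * deriv P (y₁ - y)) -
      Al * ((d y - d y₁) * deriv P (y - y₁)) := fun y => by
    rw [hwd, hdΨ]; ring
  rw [e3]
  simp_rw [e4]
  rw [integral_sub (hi2.const_mul _) (hi1.const_mul _), integral_const_mul,
    integral_const_mul]
  nlinarith [mul_pos hAr (neg_pos.2 n2), mul_pos hAl (neg_pos.2 n1)]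

/-! ### The comparison principle -/

/-- `L_a w ≤ f |y|^a` in `O`, tested against products `η(x) χ(y) ≥ 0`. -/
def WeakSuper (a : ℝ) (O : Set (E n × ℝ)) (w : E n × ℝ → ℝ) (f : ℝ) : Prop :=
  ∀ η χ, Smc η → FlatTest χ → (∀ x, 0 ≤ η x) → (∀ y, 0 ≤ χ y) →
    tsupport η ×ˢ tsupport χ ⊆ O → form a w η χ ≤ f * ((∫ y, |y| ^ a * χ y) * ∫ x, η x)

/-- `(|y|^a β')' ≥ κ |y|^a` weakly in `J`. -/
def WeakSubY (a : ℝ) (J : Set ℝ) (β : ℝ → ℝ) (κ : ℝ) : Prop :=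
  ∀ χ, FlatTest χ → (∀ y, 0 ≤ χ y) → tsupport χ ⊆ J →
    κ * ∫ y, |y| ^ a * χ y ≤ ∫ y, β y * wd a χ y

lemma nonneg_of_isLocalMin_of_hasDerivAt {f f' : ℝ → ℝ} {f₂ : ℝ}
    (hf : ∀ s, HasDerivAt f (f' s) s) (hf' : HasDerivAt f' f₂ 0) (hmin : IsLocalMin f 0) :
    0 ≤ f₂ := by
  by_contra! hneg
  have hd : deriv f = f' := funext fun s => (hf s).deriv
  have h0 : f' 0 = 0 := hmin.hasDerivAt_eq_zero (hf 0)
  -- With a negative second derivative the point would be both a local minimum and a local maximum,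
  -- so f would be locally constant and its second derivative zero.
  have hmax : IsLocalMax f 0 := isLocalMax_of_deriv_deriv_neg
    (by rw [hd, hf'.deriv]; exact hneg) (by rw [hd, h0]) (hf 0).continuousAt
  have hconst : f =ᶠ[𝓝 0] fun _ => f 0 := by
    filter_upwards [hmin, hmax] with s h1 h2 using le_antisymm h2 h1
  have hz : f' =ᶠ[𝓝 0] fun _ => 0 := by
    rw [← hd]
    simpa using hconst.deriv
  have := hf'.unique ((hasDerivAt_const (0 : ℝ) (0 : ℝ)).congr_of_eventuallyEq hz)
  linarith

lemma hasDerivAt_integral_mul_line {f ρ : E n → ℝ} (hf : Continuous f) (hρ : Smc ρ)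
    (x v : E n) (s : ℝ) :
    HasDerivAt (fun s : ℝ => ∫ t, f t * ρ (x + s • v - t))
      (∫ t, f t * fderiv ℝ ρ (x + s • v - t) v) s := by
  have h1 := hρ.cs.hasFDerivAt_convolution_right (ContinuousLinearMap.mul ℝ ℝ)
    (μ := volume) hf.locallyIntegrable (hρ.smooth.of_le (by simp)) (x + s • v)
  have hl : HasDerivAt (fun s : ℝ => x + s • v) v s := by
    simpa using ((hasDerivAt_id s).smul_const v).const_add x
  have h2 := h1.comp_hasDerivAt s hl
  rw [convolution_precompR_apply _ hf.locallyIntegrable (hρ.cs.fderiv ℝ)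
    (hρ.smooth.continuous_fderiv (by simp))] at h2
  exact h2

lemma fderiv_comp_const_sub_apply {ρ : E n → ℝ} (hρ : Smc ρ) (x t v : E n) :
    fderiv ℝ (fun t => ρ (x - t)) t v = - fderiv ℝ ρ (x - t) v := by
  have h1 : HasFDerivAt (fun t : E n => x - t) (-ContinuousLinearMap.id ℝ (E n)) t :=
    (hasFDerivAt_id t).const_sub x
  have := ((hρ.smooth.differentiable (by simp) (x - t)).hasFDerivAt.comp t h1).fderiv
  rw [show (fun t => ρ (x - t)) = ρ ∘ fun t => x - t from rfl, this]
  simp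

lemma Smc.comp_const_sub {ρ : E n → ℝ} (hρ : Smc ρ) (x : E n) : Smc fun t => ρ (x - t) where
  smooth := hρ.smooth.comp (contDiff_const.sub contDiff_id)
  cs := hρ.cs.comp_homeomorph (Homeomorph.subLeft x)

lemma lap_comp_const_sub {ρ : E n → ℝ} (hρ : Smc ρ) (x t : E n) :
    lap (fun t => ρ (x - t)) t = lap ρ (x - t) := by
  unfold lap
  refine Finset.sum_congr rfl fun i _ => ?_
  have e : (fun z => fderiv ℝ (fun t => ρ (x - t)) z (EuclideanSpace.single i 1)) =
      fun z => -(fun z' => fderiv ℝ ρ z' (EuclideanSpace.single i 1)) (x - z) :=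
    funext fun z => fderiv_comp_const_sub_apply hρ x z _
  rw [e, fderiv_fun_neg, _root_.neg_apply,
    fderiv_comp_const_sub_apply (hρ.fderiv_apply _), neg_neg]

/-- At a point where `x ↦ (f ⋆ ρ)(x) + A |x - x₀|²` has a local minimum, `Δ(f ⋆ ρ) ≥ -2nA`. -/
lemma laplacian_mollified_ge {f ρ : E n → ℝ} (hf : Continuous f) (hρ : Smc ρ) {A : ℝ}
    {x₀ x₁ : E n}
    (hmin : IsLocalMin (fun x => (∫ t, f t * ρ (x - t)) + A * ‖x - x₀‖ ^ 2) x₁) :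
    -(2 * n * A) ≤ ∫ t, f t * lap (fun t => ρ (x₁ - t)) t := by
  have hdir : ∀ i, -(2 * A) ≤ ∫ t, f t * fderiv ℝ (fun z => fderiv ℝ ρ z
      (EuclideanSpace.single i 1)) (x₁ - t) (EuclideanSpace.single i 1) := by
    intro i
    set v : E n := EuclideanSpace.single i 1 with hv
    have hvn : ‖v‖ = 1 := by simp [hv]
    have hd0 : ∀ s : ℝ, HasDerivAt (fun s : ℝ => A * ‖x₁ + s • v - x₀‖ ^ 2)
        (A * (2 * inner ℝ (x₁ - x₀) v + 2 * s)) s := by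
      intro s
      have e : (fun s : ℝ => A * ‖x₁ + s • v - x₀‖ ^ 2) =
          fun s : ℝ => A * (‖x₁ - x₀‖ ^ 2 + s * (2 * inner ℝ (x₁ - x₀) v) + s ^ 2) := by
        ext s
        rw [show x₁ + s • v - x₀ = (x₁ - x₀) + s • v by abel, norm_add_sq_real, norm_smul, hvn,
          inner_smul_right, mul_one, Real.norm_eq_abs, sq_abs]
        ring
      rw [e]
      have h1 := ((((hasDerivAt_id s).mul_const (2 * inner ℝ (x₁ - x₀) v)).const_add
        (‖x₁ - x₀‖ ^ 2)).add (hasDerivAt_pow 2 s)).const_mul A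
      exact HasDerivAt.congr_deriv h1 (by simp)
    have h1 := fun s => (hasDerivAt_integral_mul_line hf hρ x₁ v s).add (hd0 s)
    have h2 := (hasDerivAt_integral_mul_line hf (hρ.fderiv_apply v) x₁ v 0).add
      ((((hasDerivAt_id (0 : ℝ)).const_mul 2).const_add (2 * inner ℝ (x₁ - x₀) v)).const_mul A)
    have hm : IsLocalMin (fun s : ℝ => (∫ t, f t * ρ (x₁ + s • v - t)) +
        A * ‖x₁ + s • v - x₀‖ ^ 2) 0 := by
      have hc : ContinuousAt (fun s : ℝ => x₁ + s • v) 0 := by fun_prop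
      have ht : Tendsto (fun s : ℝ => x₁ + s • v) (𝓝 0) (𝓝 x₁) := by
        simpa [ContinuousAt] using hc
      have := ht.eventually hmin
      filter_upwards [this] with s hs
      simpa using hs
    have := nonneg_of_isLocalMin_of_hasDerivAt h1 h2 hm
    simp only [zero_smul, add_zero, mul_one] at this
    linarith
  have hint : ∀ i, Integrable fun t => f t * fderiv ℝ (fun z => fderiv ℝ ρ z
      (EuclideanSpace.single i 1)) (x₁ - t) (EuclideanSpace.single i 1) := fun i => by
    have h := (((hρ.fderiv_apply (EuclideanSpace.single i 1)).fderiv_apply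
      (EuclideanSpace.single i 1)).comp_const_sub x₁)
    exact (hf.mul h.smooth.continuous).integrable_of_hasCompactSupport h.cs.mul_left
  have e : ∀ t, f t * lap (fun t => ρ (x₁ - t)) t = ∑ i, f t * fderiv ℝ (fun z => fderiv ℝ ρ z
      (EuclideanSpace.single i 1)) (x₁ - t) (EuclideanSpace.single i 1) := fun t => by
    rw [lap_comp_const_sub hρ, lap, Finset.mul_sum]
  simp_rw [e]
  rw [integral_finsetSum _ fun i _ => hint i]
  calc -(2 * n * A) = ∑ _i : Fin n, -(2 * A) := by simp; ring
    _ ≤ _ := Finset.sum_le_sum fun i _ => hdir i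

lemma continuous_integral_mul_of_smc {Y : Type*} [TopologicalSpace Y] [FirstCountableTopology Y]
    [LocallyCompactSpace Y] {F : Y → E n → ℝ} (hF : Continuous F.uncurry) {η : E n → ℝ}
    (hη : Smc η) : Continuous fun y => ∫ x, F y x * η x := by
  have h := continuous_parametric_integral_of_continuous (μ := (volume : Measure (E n)))
    (f := fun y x => F y x * η x)
    (hF.mul (hη.smooth.continuous.comp continuous_snd)) hη.cs.isCompact
  refine h.congr fun y => ?_
  refine setIntegral_eq_integral_of_forall_compl_eq_zero fun x hx => ?_
  simp [image_eq_zero_of_notMem_tsupport hx]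

/-- The one-dimensional core of the comparison principle. -/
lemma not_isLocalMin_of_weak (ha : -1 < a) {m l β : ℝ → ℝ} (hm : Continuous m) (hl : Continuous l)
    (hβ : Continuous β) {y₁ f L κ R : ℝ} (hR : 0 < R)
    (hweak : ∀ χ, FlatTest χ → (∀ y, 0 ≤ χ y) → tsupport χ ⊆ ball y₁ R →
      ∫ y, (|y| ^ a * χ y * l y + wd a χ y * m y) ≤ f * ∫ y, |y| ^ a * χ y)
    (hsub : WeakSubY a (ball y₁ R) β κ)
    (hmin : ∀ y ∈ ball y₁ R, m y₁ - β y₁ ≤ m y - β y)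
    (hL : L ≤ l y₁) (hstrict : f - L < κ) : False := by
  -- A quarter of the strictness gap. One θ pays for the oscillation of l near y₁ and one for the
  -- quartic correction; the rest keeps the inequality favourable.
  set θ := (κ - f + L) / 4 with hθ
  have hθ0 : 0 < θ := by rw [hθ]; linarith
  obtain ⟨r₁, hr₁, hlr⟩ := Metric.continuous_iff.1 hl y₁ θ hθ0
  obtain ⟨r, hr, hrR, hr1, hrr, hry⟩ : ∃ r, 0 < r ∧ r < R ∧ r ≤ 1 ∧ r < r₁ ∧
      (y₁ = 0 ∨ r < |y₁|) := by
    rcases eq_or_ne y₁ 0 with h0 | h0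
    · exact ⟨min (R / 2) (min 1 (r₁ / 2)), by positivity,
        (min_le_left _ _).trans_lt (by linarith), (min_le_right _ _).trans (min_le_left _ _),
        ((min_le_right _ _).trans (min_le_right _ _)).trans_lt (by linarith), Or.inl h0⟩
    · have := abs_pos.2 h0
      exact ⟨min (min (R / 2) (|y₁| / 2)) (min 1 (r₁ / 2)), by positivity,
        ((min_le_left _ _).trans (min_le_left _ _)).trans_lt (by linarith),
        (min_le_right _ _).trans (min_le_left _ _),
        ((min_le_right _ _).trans (min_le_right _ _)).trans_lt (by linarith),
        Or.inr (((min_le_left _ _).trans (min_le_right _ _)).trans_lt (by linarith))⟩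
  set Y := |y₁| + 1 with hY
  have hY0 : 0 < Y := by positivity
  have ha3 : 0 < 3 + a := by linarith
  -- Chosen so that the quartic part costs at most θ: (|y|^a(y⁴)')' = 4(3 + a)y²|y|^a, and |y| ≤ Y
  -- on the support of χ.
  set γ := θ / (4 * (3 + a) * Y ^ 2) with hγ
  have hγ0 : 0 < γ := by positivity
  -- The correction makes the minimum at y₁ strict. It is even in y because odd powers need not
  -- behave under (|y|^a ∂_y)' across y = 0. Its other zero -y₁ is harmless since r < |y₁| unless y₁
  -- = 0.
  set d : ℝ → ℝ := fun y => m y - β y + γ * (y ^ 2 - y₁ ^ 2) ^ 2 with hd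
  have hdc : Continuous d := by fun_prop
  obtain ⟨χ, hχ, hχ0, hχs, hpos⟩ := exists_flatTest_integral_pos a hdc hr
    (μ := γ * (r / 2) ^ 4) (by positivity) hry (fun y h1 h2 => by
      have h3 := hmin y (by rw [mem_ball, Real.dist_eq]; linarith)
      have h4 : r / 2 ≤ |y + y₁| := by
        rcases hry with h0 | h0
        · simpa [h0] using h1
        · have := abs_sub_abs_le_abs_sub (2 * y₁) (y₁ - y)
          rw [abs_mul, abs_two, abs_sub_comm y₁ y] at this
          have e : 2 * y₁ - (y₁ - y) = y + y₁ := by ring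
          rw [e] at this
          linarith
      have h5 : (r / 2) ^ 4 ≤ (y ^ 2 - y₁ ^ 2) ^ 2 := by
        have : |y ^ 2 - y₁ ^ 2| = |y - y₁| * |y + y₁| := by rw [← abs_mul]; ring_nf
        rw [← sq_abs (y ^ 2 - y₁ ^ 2), this]
        calc (r / 2) ^ 4 = ((r / 2) * (r / 2)) ^ 2 := by ring
          _ ≤ _ := by gcongr
      have h6 := mul_le_mul_of_nonneg_left h5 hγ0.le
      simp only [hd, sub_self]
      nlinarith)
  set I := ∫ y, |y| ^ a * χ y with hI
  have hχi := integrable_abs_rpow_mul hχ.toSmc (Or.inl ha)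
  have hI0 : 0 ≤ I := integral_nonneg fun y => mul_nonneg (Real.rpow_nonneg (abs_nonneg _) _) (hχ0 y)
  have hcw := (hχ.smc_wd (a := a)).smooth.continuous
  have hsw := (hχ.smc_wd (a := a)).cs
  have hχs' : tsupport χ ⊆ ball y₁ R := hχs.trans (closedBall_subset_ball hrR)
  have w1 := hweak χ hχ hχ0 hχs'
  have w2 := hsub χ hχ hχ0 hχs'
  have il : Integrable fun y => |y| ^ a * χ y * l y := by
    have := (locallyIntegrable_abs_rpow ha).integrable_smul_right_of_hasCompactSupport
      (hχ.smooth.continuous.mul hl) hχ.cs.mul_right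
    simpa [mul_assoc] using this
  have im : Integrable fun y => wd a χ y * m y :=
    (hcw.mul hm).integrable_of_hasCompactSupport hsw.mul_right
  have iβ : Integrable fun y => β y * wd a χ y :=
    (hβ.mul hcw).integrable_of_hasCompactSupport hsw.mul_left
  rw [integral_add il im] at w1
  have w3 : (L - θ) * I ≤ ∫ y, |y| ^ a * χ y * l y := by
    rw [hI, ← integral_const_mul]
    refine integral_mono (hχi.const_mul _) il fun y => ?_
    show (L - θ) * (|y| ^ a * χ y) ≤ |y| ^ a * χ y * l y
    by_cases hy : y ∈ tsupport χ
    · have h1 := hχs hy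
      have h2 := hlr y ((mem_closedBall.1 h1).trans_lt hrr)
      rw [Real.dist_eq] at h2
      rw [mul_comm]
      refine mul_le_mul_of_nonneg_left ?_ (mul_nonneg (Real.rpow_nonneg (abs_nonneg _) _) (hχ0 y))
      linarith [neg_abs_le (l y - l y₁)]
    · simp [image_eq_zero_of_notMem_tsupport hy]
  -- the quartic correction
  have p2 : ∫ y, y ^ 2 * wd a χ y = 2 * (1 + a) * I := by
    have := integral_abs_rpow_mul_wd (a := a) hχ (p := 2) (Or.inl (by linarith))
    simp only [Real.rpow_two, sq_abs] at this
    rw [this, hI]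
    norm_num
  have p4 : ∫ y, y ^ 4 * wd a χ y ≤ 4 * (3 + a) * (Y ^ 2 * I) := by
    have := integral_abs_rpow_mul_wd (a := a) hχ (p := 4) (Or.inl (by linarith))
    have e : ∀ y : ℝ, |y| ^ (4 : ℝ) = y ^ 4 := fun y => by
      rw [show (4 : ℝ) = ((4 : ℕ) : ℝ) by norm_num, Real.rpow_natCast, ← abs_pow,
        abs_of_nonneg (by positivity)]
    simp only [e] at this
    rw [this, show (4 : ℝ) * (4 - 1 + a) = 4 * (3 + a) by ring]
    refine mul_le_mul_of_nonneg_left ?_ (by positivity)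
    rw [hI, ← integral_const_mul]
    refine integral_mono (integrable_abs_rpow_mul hχ.toSmc (Or.inl (by linarith)))
      (hχi.const_mul _) fun y => ?_
    show |y| ^ (4 - 2 + a) * χ y ≤ Y ^ 2 * (|y| ^ a * χ y)
    by_cases hy : y ∈ tsupport χ
    · have h1 := hχs hy
      rw [mem_closedBall, Real.dist_eq] at h1
      have h2 : |y| ≤ Y := by linarith [abs_sub_abs_le_abs_sub y y₁]
      have h3 : |y| ^ (4 - 2 + a) ≤ Y ^ 2 * |y| ^ a := by
        rcases eq_or_ne y 0 with h0 | h0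
        · rw [h0, abs_zero, Real.zero_rpow (by linarith)]
          have := Real.rpow_nonneg (le_refl (0 : ℝ)) a
          positivity
        · rw [Real.rpow_add (abs_pos.2 h0), show (4 : ℝ) - 2 = 2 by norm_num, Real.rpow_two]
          gcongr
      rw [← mul_assoc]
      exact mul_le_mul_of_nonneg_right h3 (hχ0 y)
    · simp [image_eq_zero_of_notMem_tsupport hy]
  have i2 : Integrable fun y => y ^ 2 * wd a χ y :=
    ((continuous_pow 2).mul hcw).integrable_of_hasCompactSupport hsw.mul_left
  have i4 : Integrable fun y => y ^ 4 * wd a χ y :=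
    ((continuous_pow 4).mul hcw).integrable_of_hasCompactSupport hsw.mul_left
  have i0 : Integrable fun y => wd a χ y := hcw.integrable_of_hasCompactSupport hsw
  have e : ∀ y, d y * wd a χ y = (wd a χ y * m y - β y * wd a χ y) +
      γ * (y ^ 4 * wd a χ y - 2 * y₁ ^ 2 * (y ^ 2 * wd a χ y) + y₁ ^ 4 * wd a χ y) := fun y => by
    simp only [hd]; ring
  simp_rw [e] at hpos
  have j1 : Integrable fun y => wd a χ y * m y - β y * wd a χ y := im.sub iβ
  have j2 : Integrable fun y => y ^ 4 * wd a χ y - 2 * y₁ ^ 2 * (y ^ 2 * wd a χ y) :=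
    i4.sub (i2.const_mul _)
  have j3 : Integrable fun y => y ^ 4 * wd a χ y - 2 * y₁ ^ 2 * (y ^ 2 * wd a χ y) +
    y₁ ^ 4 * wd a χ y := j2.add (i0.const_mul _)
  rw [integral_add j1 (j3.const_mul _), integral_sub im iβ, integral_const_mul,
    integral_add j2 (i0.const_mul _), integral_sub i4 (i2.const_mul _), integral_const_mul,
    integral_const_mul, integral_wd a hχ, p2] at hpos
  have hq : γ * (4 * (3 + a) * (Y ^ 2 * I)) = θ * I := by
    rw [hγ]; field_simp
  have h7 : 0 ≤ y₁ ^ 2 * ((1 + a) * I) := by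
    have : 0 < 1 + a := by linarith
    positivity
  have h8 : γ * (∫ y, y ^ 4 * wd a χ y) ≤ θ * I := by
    rw [← hq]; exact mul_le_mul_of_nonneg_left p4 hγ0.le
  have h9 : 0 ≤ γ * (y₁ ^ 2 * ((1 + a) * I)) := by positivity
  have h10 : κ = 4 * θ + f - L := by rw [hθ]; ring
  have h11 := mul_nonneg hθ0.le hI0
  rw [h10] at w2
  nlinarith

/-- Comparison principle: a supersolution `L_a w ≤ f |y|^a` in `O` that lies above the strict
subsolution `β(y) - A |x - x₀|²` on `K \ O` lies above it in `K`. -/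
theorem comparison (ha : -1 < a) {w : E n × ℝ → ℝ} (hw : Continuous w) {β : ℝ → ℝ}
    (hβ : Continuous β) {K O : Set (E n × ℝ)} (hK : IsCompact K) (hO : IsOpen O) (hOK : O ⊆ K)
    {J : Set ℝ} (hJ : ∀ p ∈ O, p.2 ∈ J) {f κ A : ℝ} {x₀ : E n} (hsub : WeakSubY a J β κ)
    (hsup : WeakSuper a O w f) (hstrict : 2 * n * A + f < κ)
    (hb : ∀ p ∈ K, p ∉ O → β p.2 - A * ‖p.1 - x₀‖ ^ 2 ≤ w p) :
    ∀ p ∈ K, β p.2 - A * ‖p.1 - x₀‖ ^ 2 ≤ w p := by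
  set b : E n × ℝ → ℝ := fun p => β p.2 - A * ‖p.1 - x₀‖ ^ 2 with hbdef
  have hbc : Continuous b := by fun_prop
  by_contra! hcon
  obtain ⟨q, hqK, hq⟩ := hcon
  obtain ⟨p₀, hp₀K, hp₀⟩ := hK.exists_isMinOn ⟨q, hqK⟩ (hw.sub hbc).continuousOn
  have hp₀q : w p₀ - b p₀ ≤ w q - b q := hp₀ hqK
  set m := -(w p₀ - b p₀) with hm
  have hm0 : 0 < m := by
    have : w q < b q := hq
    rw [hm]; linarith
  -- The deep sublevel set avoids K \ O, where w ≥ b. It is therefore compact inside O and leaves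
  -- room for mollification.
  set S : Set (E n × ℝ) := K ∩ {p | w p - b p ≤ -m / 2} with hS
  have hSc : IsCompact S := hK.inter_right (isClosed_le (hw.sub hbc) continuous_const)
  have hSO : S ⊆ O := fun p hp => by
    by_contra hpO
    have h1 : b p ≤ w p := hb p hp.1 hpO
    have h2 : w p - b p ≤ -m / 2 := hp.2
    linarith
  obtain ⟨r₀, hr₀, hr₀O⟩ := hSc.exists_cthickening_subset_open hO hSO
  have hKc : IsCompact (cthickening r₀ S) := hSc.cthickening
  have hK₁ : IsCompact (cthickening (r₀ / 2) S) := hSc.cthickening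
  obtain ⟨ε', hε', hunif⟩ := Metric.uniformContinuousOn_iff.1
    (hKc.uniformContinuousOn_of_continuous hw.continuousOn) (m / 8) (by positivity)
  set ε := min (ε' / 2) (r₀ / 4) with hε
  have hε0 : 0 < ε := by positivity
  have hεε' : ε < ε' := (min_le_left _ _).trans_lt (by linarith)
  have hεr : ε < r₀ / 2 := (min_le_right _ _).trans_lt (by linarith)
  let φ : ContDiffBump (0 : E n) := ⟨ε / 2, ε, by positivity, by linarith⟩
  set ρ : E n → ℝ := φ.normed volume with hρdef
  have hρ : Smc ρ := ⟨φ.contDiff_normed, φ.hasCompactSupport_normed⟩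
  have hρs : tsupport ρ = closedBall 0 ε := φ.tsupport_normed_eq
  have hρ0 : ∀ x, 0 ≤ ρ x := fun x => φ.nonneg_normed x
  -- Mollification in x only: η = ρ(x₁ - ·) is then a legitimate factor of a product test, and no
  -- regularization in y disturbs the weight.
  set W : E n × ℝ → ℝ := fun p => ∫ t, w (t, p.2) * ρ (p.1 - t) with hW
  have hWalt : ∀ p : E n × ℝ, W p = ∫ t, w (p.1 - t, p.2) * ρ t := fun p => by
    simp only [hW]
    rw [← integral_sub_left_eq_self _ volume p.1]
    simp
  have hWc : Continuous W := by
    have : Continuous fun p : E n × ℝ => ∫ t, w (p.1 - t, p.2) * ρ t :=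
      continuous_integral_mul_of_smc (F := fun (p : E n × ℝ) t => w (p.1 - t, p.2))
        (by simp only [Function.uncurry_def]; fun_prop) hρ
    exact this.congr fun p => (hWalt p).symm
  have hnear : ∀ p ∈ cthickening (r₀ / 2) S, ∀ q, dist q p ≤ r₀ / 2 → q ∈ cthickening r₀ S := by
    intro p hp q hqp
    rw [hSc.cthickening_eq_biUnion_closedBall (by positivity)] at hp
    obtain ⟨z, hz, hzp⟩ := mem_iUnion₂.1 hp
    refine mem_cthickening_of_dist_le q z r₀ S hz ?_
    have := dist_triangle q p z
    have h2 : dist p z ≤ r₀ / 2 := hzp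
    linarith
  have hWw : ∀ p ∈ cthickening (r₀ / 2) S, |W p - w p| ≤ m / 8 := by
    rintro ⟨x, y⟩ hp
    have hcont : Continuous fun t => w (t, y) := by fun_prop
    have := φ.dist_normed_convolution_le (μ := volume) (g := fun t => w (t, y)) (x₀ := x)
      (ε := m / 8) hcont.aestronglyMeasurable (fun t ht => by
        have hd : dist ((t, y) : E n × ℝ) (x, y) < ε := by
          simpa [Prod.dist_eq] using ht
        exact (hunif (t, y) (hnear _ hp _ (hd.le.trans hεr.le)) (x, y)
          (hnear _ hp _ (by simp; positivity)) (hd.trans hεε')).le)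
    rw [Real.dist_eq] at this
    have e : (convolution (φ.normed volume) (fun t => w (t, y))
        (ContinuousLinearMap.lsmul ℝ ℝ) volume) x = W (x, y) := by
      rw [hWalt, convolution_def]
      simp [mul_comm, hρdef]
    rwa [e] at this
  have hSK₁ : S ⊆ cthickening (r₀ / 2) S := self_subset_cthickening S
  have hp₀S : p₀ ∈ S := ⟨hp₀K, by show w p₀ - b p₀ ≤ -m / 2; linarith⟩
  obtain ⟨p₁, hp₁K, hp₁⟩ := hK₁.exists_isMinOn ⟨p₀, hSK₁ hp₀S⟩ (hWc.sub hbc).continuousOn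
  -- The mollification error m/8 enters twice, so w - b ≤ -m + m/4 at the minimum of W - b. The
  -- minimizer stays in S, and the whole ball of radius r₀/2 around it competes.
  have hp₁S : p₁ ∈ S := by
    have h1 : W p₁ - b p₁ ≤ W p₀ - b p₀ := hp₁ (hSK₁ hp₀S)
    have h2 := abs_le.1 (hWw p₁ hp₁K)
    have h3 := abs_le.1 (hWw p₀ (hSK₁ hp₀S))
    refine ⟨hOK (hr₀O (hnear p₁ hp₁K p₁ (by simp; positivity))), ?_⟩
    show w p₁ - b p₁ ≤ -m / 2
    linarith [h2.1, h3.2]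
  have hmin : ∀ q, dist q p₁ ≤ r₀ / 2 → W p₁ - b p₁ ≤ W q - b q := fun q hq =>
    hp₁ (mem_cthickening_of_dist_le q p₁ _ S hp₁S hq)
  obtain ⟨x₁, y₁⟩ := p₁
  set η : E n → ℝ := fun t => ρ (x₁ - t) with hη
  have hηs : Smc η := hρ.comp_const_sub x₁
  have hηt : tsupport η ⊆ closedBall x₁ ε := by
    refine closure_minimal (fun t ht => ?_) isClosed_closedBall
    have : x₁ - t ∈ tsupport ρ := subset_tsupport _ ht
    rw [hρs, mem_closedBall_zero_iff] at this
    rwa [mem_closedBall, dist_comm, dist_eq_norm]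
  have hηi : ∫ t, η t = 1 := by
    rw [hη, integral_sub_left_eq_self ρ volume x₁]
    exact φ.integral_normed
  have hlap : -(2 * n * A) ≤ ∫ t, w (t, y₁) * lap η t := by
    refine laplacian_mollified_ge (f := fun t => w (t, y₁)) (x₀ := x₀) (by fun_prop) hρ ?_
    filter_upwards [ball_mem_nhds x₁ (by positivity : 0 < r₀ / 2)] with x hx
    have := hmin (x, y₁) (by simpa [Prod.dist_eq] using (mem_ball.1 hx).le)
    simp only [hbdef, hW] at this
    linarith
  refine not_isLocalMin_of_weak ha (m := fun y => W (x₁, y)) (l := fun y => ∫ t, w (t, y) * lap η t)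
    (by fun_prop) ?_ hβ (y₁ := y₁) (f := f) (κ := κ) (L := -(2 * n * A)) (R := r₀ / 2)
    (by positivity) ?_ ?_ ?_ hlap (by linarith)
  · exact continuous_integral_mul_of_smc (F := fun y t => w (t, y))
      (by simp only [Function.uncurry_def]; fun_prop) hηs.lap
  · intro χ hχ hχ0 hχs
    have := hsup η χ hηs hχ (fun t => hρ0 _) hχ0 (fun p hp => hr₀O (hnear _ hp₁K _ (by
      have h1 := mem_closedBall.1 (hηt hp.1)
      have h2 := mem_ball.1 (hχs hp.2)
      rw [Prod.dist_eq]
      exact max_le (h1.trans hεr.le) h2.le)))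
    rw [hηi, mul_one] at this
    exact this
  · intro χ hχ hχ0 hχs
    refine hsub χ hχ hχ0 fun y hy => ?_
    refine hJ (x₁, y) (hr₀O (hnear _ hp₁K _ ?_))
    simpa [Prod.dist_eq] using (mem_ball.1 (hχs hy)).le
  · intro y hy
    have := hmin (x₁, y) (by simpa [Prod.dist_eq] using (mem_ball.1 hy).le)
    simp only [hbdef] at this
    show W (x₁, y₁) - β y₁ ≤ W (x₁, y) - β y
    linarith

/-! ### Barriers, and the algebra of the weak form -/

/-- The barriers `C + B y² + D |y|^{1-a}` in weak form. -/
lemma weakSubY_barrier (ha : -1 < a) (ha' : a < 1) {J : Set ℝ} (C B D : ℝ)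
    (hJ : D = 0 ∨ (0 : ℝ) ∉ J) :
    WeakSubY a J (fun y => C + B * y ^ 2 + D * |y| ^ (1 - a)) (2 * (1 + a) * B) := by
  intro χ hχ _ hχs
  have hcw := (hχ.smc_wd (a := a)).smooth.continuous
  have hsw := (hχ.smc_wd (a := a)).cs
  have p2 : ∫ y, y ^ 2 * wd a χ y = 2 * (1 + a) * ∫ y, |y| ^ a * χ y := by
    have := integral_abs_rpow_mul_wd (a := a) hχ (p := 2) (Or.inl (by linarith))
    simp only [Real.rpow_two, sq_abs] at this
    rw [this]
    norm_num
  have pD : D * ∫ y, |y| ^ (1 - a) * wd a χ y = 0 := by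
    rcases hJ with h | h
    · simp [h]
    -- The factor p - 1 + a vanishes for p = 1 - a.
    · rw [integral_abs_rpow_mul_wd hχ (Or.inr fun h' => h (hχs h'))]
      ring
  have i0 : Integrable fun y => wd a χ y := hcw.integrable_of_hasCompactSupport hsw
  have i2 : Integrable fun y => y ^ 2 * wd a χ y :=
    ((continuous_pow 2).mul hcw).integrable_of_hasCompactSupport hsw.mul_left
  have i1 : Integrable fun y => |y| ^ (1 - a) * wd a χ y :=
    ((continuous_abs.rpow_const fun _ => Or.inr (by linarith)).mul
      hcw).integrable_of_hasCompactSupport hsw.mul_left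
  have e : ∀ y, (C + B * y ^ 2 + D * |y| ^ (1 - a)) * wd a χ y =
      C * wd a χ y + B * (y ^ 2 * wd a χ y) + D * (|y| ^ (1 - a) * wd a χ y) := fun y => by ring
  simp_rw [e]
  have j : Integrable fun y => C * wd a χ y + B * (y ^ 2 * wd a χ y) :=
    (i0.const_mul C).add (i2.const_mul B)
  rw [integral_add j (i1.const_mul D), integral_add (i0.const_mul C) (i2.const_mul B),
    integral_const_mul, integral_const_mul, integral_const_mul, pD, p2, integral_wd a hχ]
  refine le_of_eq ?_
  ring

lemma continuous_barrier (ha' : a < 1) (C B D : ℝ) :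
    Continuous fun y : ℝ => C + B * y ^ 2 + D * |y| ^ (1 - a) := by
  have : Continuous fun y : ℝ => |y| ^ (1 - a) :=
    continuous_abs.rpow_const fun _ => Or.inr (by linarith)
  fun_prop

lemma integrable_form_integrand (ha : -1 < a) {w : E n × ℝ → ℝ} (hw : Continuous w) {η : E n → ℝ}
    {χ : ℝ → ℝ} (hη : Smc η) (hχ : FlatTest χ) :
    Integrable fun y => |y| ^ a * χ y * (∫ x, w (x, y) * lap η x) +
      wd a χ y * ∫ x, w (x, y) * η x := by
  have h1 : Continuous fun y => ∫ x, w (x, y) * lap η x :=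
    continuous_integral_mul_of_smc (F := fun y x => w (x, y))
      (by simp only [Function.uncurry_def]; fun_prop) hη.lap
  have h2 : Continuous fun y => ∫ x, w (x, y) * η x :=
    continuous_integral_mul_of_smc (F := fun y x => w (x, y))
      (by simp only [Function.uncurry_def]; fun_prop) hη
  refine Integrable.add ?_ ?_
  · have := (locallyIntegrable_abs_rpow ha).integrable_smul_right_of_hasCompactSupport
      (hχ.smooth.continuous.mul h1) hχ.cs.mul_right
    simpa [mul_assoc] using this
  · exact ((hχ.smc_wd (a := a)).smooth.continuous.mul h2).integrable_of_hasCompactSupport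
      (hχ.smc_wd (a := a)).cs.mul_right

lemma form_sub (ha : -1 < a) {w v : E n × ℝ → ℝ} (hw : Continuous w) (hv : Continuous v)
    {η : E n → ℝ} {χ : ℝ → ℝ} (hη : Smc η) (hχ : FlatTest χ) :
    form a (fun p => w p - v p) η χ = form a w η χ - form a v η χ := by
  unfold form
  rw [← integral_sub (integrable_form_integrand ha hw hη hχ)
    (integrable_form_integrand ha hv hη hχ)]
  have hi : ∀ (w : E n × ℝ → ℝ) (ψ : E n → ℝ) (y : ℝ), Continuous w → Smc ψ →
      Integrable fun x => w (x, y) * ψ x := fun w ψ y hw hψ =>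
    Continuous.integrable_of_hasCompactSupport
      ((by fun_prop : Continuous fun x => w (x, y)).mul hψ.smooth.continuous) hψ.cs.mul_left
  refine integral_congr_ae (.of_forall fun y => ?_)
  simp only [sub_mul]
  rw [integral_sub (hi w _ y hw hη.lap) (hi v _ y hv hη.lap),
    integral_sub (hi w _ y hw hη) (hi v _ y hv hη)]
  ring

lemma form_const_mul (c : ℝ) (w : E n × ℝ → ℝ) (η : E n → ℝ) (χ : ℝ → ℝ) :
    form a (fun p => c * w p) η χ = c * form a w η χ := by
  unfold form
  simp only [mul_assoc c, integral_const_mul]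
  rw [← integral_const_mul]
  exact integral_congr_ae (.of_forall fun y => by simp only []; ring)

lemma fderiv_comp_sub_right (η : E n → ℝ) (h x : E n) :
    fderiv ℝ (fun x => η (x - h)) x = fderiv ℝ η (x - h) := by
  simp_rw [sub_eq_add_neg]
  exact fderiv_comp_add_right (-h)

lemma lap_comp_sub_right (η : E n → ℝ) (h x : E n) :
    lap (fun x => η (x - h)) x = lap η (x - h) := by
  unfold lap
  refine Finset.sum_congr rfl fun i _ => ?_
  have e : (fun z => fderiv ℝ (fun x => η (x - h)) z (EuclideanSpace.single i 1)) =
      fun z => (fun z' => fderiv ℝ η z' (EuclideanSpace.single i 1)) (z - h) :=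
    funext fun z => by rw [fderiv_comp_sub_right]
  rw [e, fderiv_comp_sub_right (fun z' => fderiv ℝ η z' (EuclideanSpace.single i 1))]

lemma form_translate (w : E n × ℝ → ℝ) (h : E n) (η : E n → ℝ) (χ : ℝ → ℝ) :
    form a (fun p => w (p.1 + h, p.2)) η χ = form a w (fun x => η (x - h)) χ := by
  unfold form
  refine integral_congr_ae (.of_forall fun y => ?_)
  have e1 := integral_add_right_eq_self (μ := (volume : Measure (E n)))
    (fun x => w (x, y) * lap η (x - h)) h
  have e2 := integral_add_right_eq_self (μ := (volume : Measure (E n)))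
    (fun x => w (x, y) * η (x - h)) h
  simp only [add_sub_cancel_right] at e1 e2
  simp only [e1, e2, lap_comp_sub_right]

lemma Smc.comp_sub_right {η : E n → ℝ} (hη : Smc η) (h : E n) : Smc fun x => η (x - h) where
  smooth := hη.smooth.comp (contDiff_id.sub contDiff_const)
  cs := hη.cs.comp_homeomorph (Homeomorph.subRight h)

lemma tsupport_comp_sub_right (η : E n → ℝ) (h : E n) {x : E n}
    (hx : x ∈ tsupport fun x => η (x - h)) : x - h ∈ tsupport η := by
  have := tsupport_comp_subset_preimage η (f := fun x : E n => x - h) (by fun_prop) hx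
  exact this

/-! ### The explicit two-dimensional profile -/

/-- The distance to the origin in the `(t, y)` plane. -/
def rad (t y : ℝ) : ℝ := √(t ^ 2 + y ^ 2)

/-- `(ρ + t) / 2`, the square of the real part of `√(t + i y)`. -/
def qf (t y : ℝ) : ℝ := (rad t y + t) / 2

/-- The two-dimensional profile of degree `1 + s`. -/
def prof (s t y : ℝ) : ℝ := qf t y ^ s * (t - s * rad t y)

lemma rad_nonneg (t y : ℝ) : 0 ≤ rad t y := Real.sqrt_nonneg _

lemma rad_sq (t y : ℝ) : rad t y ^ 2 = t ^ 2 + y ^ 2 := Real.sq_sqrt (by positivity)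

lemma rad_pos (t : ℝ) {y : ℝ} (hy : y ≠ 0) : 0 < rad t y :=
  Real.sqrt_pos.2 (by positivity)

lemma abs_le_rad (t y : ℝ) : |t| ≤ rad t y := Real.abs_le_sqrt (by nlinarith [sq_nonneg y])

lemma qf_nonneg (t y : ℝ) : 0 ≤ qf t y := by
  have := abs_le_rad t y
  have := neg_abs_le t
  unfold qf; linarith

lemma qf_le_rad (t y : ℝ) : qf t y ≤ rad t y := by
  have := abs_le_rad t y
  have := le_abs_self t
  unfold qf; linarith

/-- This is y² = (ρ + t)(ρ - t). It reduces the differential equation of the profile to algebra in q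
and ρ, and later bounds q below by y²/4 when ρ ≤ 1. -/
lemma y_sq_eq (t y : ℝ) : y ^ 2 = 4 * qf t y * (rad t y - qf t y) := by
  have := rad_sq t y
  unfold qf; linarith

lemma qf_pos (t : ℝ) {y : ℝ} (hy : y ≠ 0) : 0 < qf t y := by
  refine (qf_nonneg t y).lt_of_ne fun h => ?_
  have := y_sq_eq t y
  rw [← h] at this
  have : y ^ 2 = 0 := by linarith
  exact hy (by simpa using this)

lemma continuous_rad : Continuous fun p : ℝ × ℝ => rad p.1 p.2 := by unfold rad; fun_prop

lemma continuous_qf : Continuous fun p : ℝ × ℝ => qf p.1 p.2 := by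
  have := continuous_rad
  unfold qf; fun_prop

lemma continuous_qf_rpow {s : ℝ} (hs : 0 ≤ s) : Continuous fun p : ℝ × ℝ => qf p.1 p.2 ^ s :=
  continuous_qf.rpow_const fun _ => Or.inr hs

lemma continuous_prof {s : ℝ} (hs : 0 ≤ s) : Continuous fun p : ℝ × ℝ => prof s p.1 p.2 :=
  (continuous_qf_rpow hs).mul (continuous_fst.sub (continuous_const.mul continuous_rad))

lemma hasDerivAt_rad_left (t : ℝ) {y : ℝ} (hy : y ≠ 0) :
    HasDerivAt (fun t => rad t y) (t / rad t y) t := by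
  have h : HasDerivAt (fun t : ℝ => t ^ 2 + y ^ 2) (2 * t) t := by
    simpa using (hasDerivAt_pow 2 t).add_const (y ^ 2)
  refine (h.sqrt (by positivity)).congr_deriv ?_
  have := rad_pos t hy
  unfold rad at this ⊢
  field_simp

lemma hasDerivAt_rad_right (t : ℝ) {y : ℝ} (hy : y ≠ 0) :
    HasDerivAt (fun y => rad t y) (y / rad t y) y := by
  have h : HasDerivAt (fun y : ℝ => t ^ 2 + y ^ 2) (2 * y) y := by
    simpa using (hasDerivAt_pow 2 y).const_add (t ^ 2)
  refine (h.sqrt (by positivity)).congr_deriv ?_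
  have := rad_pos t hy
  unfold rad at this ⊢
  field_simp

lemma hasDerivAt_qf_left (t : ℝ) {y : ℝ} (hy : y ≠ 0) :
    HasDerivAt (fun t => qf t y) (qf t y / rad t y) t := by
  refine (((hasDerivAt_rad_left t hy).add (hasDerivAt_id t)).div_const 2).congr_deriv ?_
  have := rad_pos t hy
  unfold qf
  field_simp
  ring

lemma hasDerivAt_qf_right (t : ℝ) {y : ℝ} (hy : y ≠ 0) :
    HasDerivAt (fun y => qf t y) (y / (2 * rad t y)) y := by
  refine (((hasDerivAt_rad_right t hy).add_const t).div_const 2).congr_deriv ?_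
  have := rad_pos t hy
  field_simp

lemma hasDerivAt_qf_rpow_left (s t : ℝ) {y : ℝ} (hy : y ≠ 0) :
    HasDerivAt (fun t => qf t y ^ s) (s * qf t y ^ s / rad t y) t := by
  have hq := qf_pos t hy
  refine ((hasDerivAt_qf_left t hy).rpow_const (p := s) (Or.inl hq.ne')).congr_deriv ?_
  have h1 : qf t y ^ s = qf t y ^ (s - 1) * qf t y := by
    rw [← Real.rpow_add_one hq.ne']; ring_nf
  rw [h1]
  ring

lemma hasDerivAt_prof_left (s t : ℝ) {y : ℝ} (hy : y ≠ 0) :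
    HasDerivAt (fun t => prof s t y) ((1 - s ^ 2) * qf t y ^ s) t := by
  have hr := rad_pos t hy
  refine ((hasDerivAt_qf_rpow_left s t hy).mul
    ((hasDerivAt_id t).sub ((hasDerivAt_rad_left t hy).const_mul s))).congr_deriv ?_
  simp only [Pi.sub_apply, id]
  field_simp
  ring

lemma hasDerivAt_prof_right (s t : ℝ) {y : ℝ} (hy : y ≠ 0) :
    HasDerivAt (fun y => prof s t y) (-(s * (1 + s) / 2) * (y * qf t y ^ (s - 1))) y := by
  have hq := qf_pos t hy
  have hr := rad_pos t hy
  refine (((hasDerivAt_qf_right t hy).rpow_const (p := s) (Or.inl hq.ne')).mul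
    (((hasDerivAt_rad_right t hy).const_mul s).const_sub t)).congr_deriv ?_
  have h1 : qf t y ^ s = qf t y ^ (s - 1) * qf t y := by
    rw [← Real.rpow_add_one hq.ne']; ring_nf
  have h2 : t = 2 * qf t y - rad t y := by unfold qf; ring
  rw [h1]
  generalize qf t y ^ (s - 1) = Q at *
  generalize rad t y = r at *
  generalize qf t y = q at *
  subst h2
  field_simp
  ring

/-- The second `t`-derivative of `prof`. -/
def profTT (s t y : ℝ) : ℝ := (1 - s ^ 2) * (s * qf t y ^ s / rad t y)

/-- The pointwise equation L_a(prof) = 0 off y = 0. The cancellation uses exactly the relation a = 1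
- 2s. -/
lemma hasDerivAt_flux_prof {s : ℝ} (hs : s = (1 - a) / 2) (t : ℝ) {y : ℝ} (hy : y ≠ 0) :
    HasDerivAt (fun y => -(s * (1 + s) / 2) * (y * |y| ^ a * qf t y ^ (s - 1)))
      (-(|y| ^ a * profTT s t y)) y := by
  have hq := qf_pos t hy
  have hr := rad_pos t hy
  refine (((hasDerivAt_mul_abs_rpow a hy).mul ((hasDerivAt_qf_right t hy).rpow_const
    (p := s - 1) (Or.inl hq.ne'))).const_mul (-(s * (1 + s) / 2))).congr_deriv ?_
  have h1 : qf t y ^ (s - 1) = qf t y ^ (s - 1 - 1) * qf t y := by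
    rw [← Real.rpow_add_one hq.ne']; ring_nf
  have h2 : qf t y ^ s = qf t y ^ (s - 1 - 1) * qf t y * qf t y := by
    rw [← h1, ← Real.rpow_add_one hq.ne']; ring_nf
  have h3 := y_sq_eq t y
  have ha : a = 1 - 2 * s := by rw [hs]; ring
  unfold profTT
  rw [h1, h2]
  generalize qf t y ^ (s - 1 - 1) = Q at *
  generalize rad t y = r at *
  generalize qf t y = q at *
  generalize |y| ^ a = z at *
  subst ha
  field_simp
  ring_nf
  rw [h3]
  ring

lemma integral_prof_mul_wd {s : ℝ} (hs : s = (1 - a) / 2) (hs0 : 0 < s) (t : ℝ) {χ : ℝ → ℝ}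
    (hχ : FlatTest χ) (h0 : (0 : ℝ) ∉ tsupport χ) :
    ∫ y, prof s t y * wd a χ y = - ∫ y, |y| ^ a * χ y * profTT s t y := by
  have hflux := hχ.smc_flux a
  have hχ0 : ∀ᶠ y in 𝓝 0, χ y = 0 := notMem_tsupport_iff_eventuallyEq.1 h0
  have hpc : Continuous fun y => prof s t y :=
    (continuous_prof hs0.le).comp (by fun_prop : Continuous fun y : ℝ => (t, y))
  have hqc : Continuous fun y => qf t y :=
    continuous_qf.comp (by fun_prop : Continuous fun y : ℝ => (t, y))
  have hrc : Continuous fun y => rad t y :=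
    continuous_rad.comp (by fun_prop : Continuous fun y : ℝ => (t, y))
  have i1 : Integrable fun y => prof s t y * wd a χ y :=
    (hpc.mul (hχ.smc_wd (a := a)).smooth.continuous).integrable_of_hasCompactSupport
      (hχ.smc_wd (a := a)).cs.mul_left
  have i2 : Integrable fun y => |y| ^ a * χ y * profTT s t y := by
    refine Continuous.integrable_of_hasCompactSupport ?_ hχ.cs.mul_left.mul_right
    rw [continuous_iff_continuousAt]
    intro y
    rcases eq_or_ne y 0 with rfl | hy
    · refine (continuousAt_const (y := (0 : ℝ))).congr ?_
      filter_upwards [hχ0] with y hy using by simp [hy]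
    · refine ((continuous_abs.continuousAt.rpow_const (Or.inl (abs_ne_zero.2 hy))).mul
        hχ.smooth.continuous.continuousAt).mul (continuousAt_const.mul ?_)
      exact (continuousAt_const.mul (hqc.continuousAt.rpow_const (Or.inr hs0.le))).div
        hrc.continuousAt (rad_pos t hy).ne'
  have hder : ∀ y ≠ 0, HasDerivAt (fun y => prof s t y * (|y| ^ a * deriv χ y) -
      -(s * (1 + s) / 2) * (y * |y| ^ a * qf t y ^ (s - 1)) * χ y)
      (prof s t y * wd a χ y + |y| ^ a * χ y * profTT s t y) y := fun y hy => by
    refine (((hasDerivAt_prof_right s t hy).mul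
      (hflux.smooth.differentiable (by simp) y).hasDerivAt).sub
      ((hasDerivAt_flux_prof hs t hy).mul
        (hχ.smooth.differentiable (by simp) y).hasDerivAt)).congr_deriv ?_
    simp only [wd]
    ring
  have key := integral_eq_zero_of_hasDerivAt_of_hasCompactSupport
    (H := fun y => prof s t y * (|y| ^ a * deriv χ y) -
      -(s * (1 + s) / 2) * (y * |y| ^ a * qf t y ^ (s - 1)) * χ y)
    (H' := fun y => prof s t y * wd a χ y + |y| ^ a * χ y * profTT s t y) ?_ ?_ hder (i1.add i2)
  · rw [integral_add i1 i2] at key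
    linarith
  · rw [continuous_iff_continuousAt]
    intro y
    rcases eq_or_ne y 0 with rfl | hy
    · refine (continuousAt_const (y := (0 : ℝ))).congr ?_
      filter_upwards [hχ0, hχ.flat] with y hy hy' using by simp [hy, hy']
    · exact (hder y hy).continuousAt
  · exact (hflux.cs.mul_left).sub hχ.cs.mul_left

/-- The profile in the direction `e`. -/
def profE (s : ℝ) (e : E n) (p : E n × ℝ) : ℝ := prof s (inner ℝ p.1 e) p.2

lemma continuous_inner_pair (e : E n) :
    Continuous fun p : E n × ℝ => ((inner ℝ p.1 e : ℝ), p.2) :=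
  (continuous_fst.inner continuous_const).prodMk continuous_snd

lemma continuous_profE {s : ℝ} (hs : 0 ≤ s) (e : E n) : Continuous (profE s e) := by
  have := (continuous_prof hs).comp (continuous_inner_pair e)
  exact this

lemma hasFDerivAt_comp_inner {f : ℝ → ℝ} {f' : ℝ} {e x : E n}
    (hf : HasDerivAt f f' (inner ℝ x e)) :
    HasFDerivAt (fun x : E n => f (inner ℝ x e)) (f' • innerSL ℝ e) x := by
  have h : HasFDerivAt (fun x : E n => (inner ℝ x e : ℝ)) (innerSL ℝ e) x := by
    have := (innerSL ℝ e).hasFDerivAt (x := x)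
    refine this.congr_of_eventuallyEq (.of_forall fun z => ?_)
    simp [real_inner_comm]
  exact hf.comp_hasFDerivAt x h

lemma integral_mul_fderiv_of_smc {f f' η : E n → ℝ} {v : E n} (hf : Differentiable ℝ f)
    (hf' : ∀ x, fderiv ℝ f x v = f' x) (hc : Continuous f') (hη : Smc η) :
    ∫ x, f x * fderiv ℝ η x v = - ∫ x, f' x * η x := by
  have := integral_mul_fderiv_eq_neg_fderiv_mul_of_integrable (μ := (volume : Measure (E n)))
    (f := f) (g := η) (v := v) ?_ ?_ ?_ (fun x _ => hf x)
    (fun x _ => hη.smooth.differentiable (by simp) x)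
  · simpa [hf'] using this
  · simp_rw [hf']
    exact (hc.mul hη.smooth.continuous).integrable_of_hasCompactSupport hη.cs.mul_left
  · exact (hf.continuous.mul (hη.fderiv_apply v).smooth.continuous).integrable_of_hasCompactSupport
      (hη.fderiv_apply v).cs.mul_left
  · exact (hf.continuous.mul hη.smooth.continuous).integrable_of_hasCompactSupport hη.cs.mul_left

lemma integral_lap {η : E n → ℝ} (hη : Smc η) : ∫ x, lap η x = 0 := by
  unfold lap
  rw [integral_finsetSum _ fun i _ =>
    (((hη.fderiv_apply _).fderiv_apply _).smooth.continuous.integrable_of_hasCompactSupport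
      ((hη.fderiv_apply _).fderiv_apply _).cs)]
  refine Finset.sum_eq_zero fun i _ => ?_
  have := integral_mul_fderiv_of_smc (f := fun _ : E n => (1 : ℝ)) (f' := fun _ => 0)
    (v := EuclideanSpace.single i 1) (by fun_prop) (by simp) (by fun_prop)
    (hη.fderiv_apply (EuclideanSpace.single i 1))
  simpa using this

/-- The profile depends on x only through x·e, so each coordinate contributes e_i² times the second
t-derivative, and these squares sum to 1. -/
lemma integral_profE_mul_lap {s : ℝ} (hs0 : 0 < s) {e : E n} (he : ‖e‖ = 1) {y : ℝ} (hy : y ≠ 0)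
    {η : E n → ℝ} (hη : Smc η) :
    ∫ x, profE s e (x, y) * lap η x = ∫ x, profTT s (inner ℝ x e) y * η x := by
  have hqc : Continuous fun x : E n => qf (inner ℝ x e) y :=
    continuous_qf.comp (by fun_prop : Continuous fun x : E n => ((inner ℝ x e : ℝ), y))
  have hrc : Continuous fun x : E n => rad (inner ℝ x e) y :=
    continuous_rad.comp (by fun_prop : Continuous fun x : E n => ((inner ℝ x e : ℝ), y))
  have hc1 : Continuous fun x : E n => (1 - s ^ 2) * qf (inner ℝ x e) y ^ s :=
    continuous_const.mul (hqc.rpow_const fun _ => Or.inr hs0.le)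
  have hc2 : Continuous fun x : E n => profTT s (inner ℝ x e) y :=
    continuous_const.mul ((continuous_const.mul (hqc.rpow_const fun _ => Or.inr hs0.le)).div hrc
      fun x => (rad_pos _ hy).ne')
  have d1 := fun x : E n => hasFDerivAt_comp_inner (hasDerivAt_prof_left s (inner ℝ x e) hy)
  have d2 := fun x : E n => hasFDerivAt_comp_inner
    ((hasDerivAt_qf_rpow_left s (inner ℝ x e) hy).const_mul (1 - s ^ 2))
  have hdir : ∀ i, ∫ x, profE s e (x, y) * fderiv ℝ (fun z => fderiv ℝ η z
      (EuclideanSpace.single i 1)) x (EuclideanSpace.single i 1) =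
      ∫ x, (e i) ^ 2 * (profTT s (inner ℝ x e) y * η x) := by
    intro i
    have hei : inner ℝ e (EuclideanSpace.single i (1 : ℝ)) = e i := by
      simp [EuclideanSpace.inner_single_right]
    have b1 := integral_mul_fderiv_of_smc (f := fun x : E n => prof s (inner ℝ x e) y)
      (f' := fun x => ((1 - s ^ 2) * qf (inner ℝ x e) y ^ s) * e i)
      (v := EuclideanSpace.single i 1) (fun x => (d1 x).differentiableAt)
      (fun x => by rw [(d1 x).fderiv]; simp [hei]) (hc1.mul continuous_const)
      (hη.fderiv_apply (EuclideanSpace.single i 1))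
    have b2 := integral_mul_fderiv_of_smc
      (f := fun x : E n => (1 - s ^ 2) * qf (inner ℝ x e) y ^ s)
      (f' := fun x => profTT s (inner ℝ x e) y * e i)
      (v := EuclideanSpace.single i 1) (fun x => (d2 x).differentiableAt)
      (fun x => by rw [(d2 x).fderiv]; simp [hei, profTT]) (hc2.mul continuous_const) hη
    simp only [profE]
    rw [b1]
    have e1 : ∀ x : E n, (1 - s ^ 2) * qf (inner ℝ x e) y ^ s * e i *
        fderiv ℝ η x (EuclideanSpace.single i 1) = e i * ((1 - s ^ 2) * qf (inner ℝ x e) y ^ s *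
        fderiv ℝ η x (EuclideanSpace.single i 1)) := fun x => by ring
    have e2 : ∀ x : E n, (e i) ^ 2 * (profTT s (inner ℝ x e) y * η x) =
      e i * (profTT s (inner ℝ x e) y * e i * η x) := fun x => by ring
    simp_rw [e1, e2]
    rw [integral_const_mul, integral_const_mul, b2]
    ring
  have hpc : Continuous fun x : E n => profE s e (x, y) :=
    (continuous_profE hs0.le e).comp (by fun_prop)
  unfold lap
  simp_rw [Finset.mul_sum]
  rw [integral_finsetSum]
  · simp_rw [hdir, integral_const_mul]
    rw [← Finset.sum_mul]
    have : ∑ i, (e i) ^ 2 = 1 := by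
      have := EuclideanSpace.norm_sq_eq e
      rw [he] at this
      simpa using this.symm
    rw [this, one_mul]
  · intro i _
    exact (hpc.mul ((hη.fderiv_apply _).fderiv_apply _).smooth.continuous
      ).integrable_of_hasCompactSupport ((hη.fderiv_apply _).fderiv_apply _).cs.mul_left

/-- `L_a` annihilates the profile for `y ≠ 0`. -/
lemma form_profE {s : ℝ} (hs : s = (1 - a) / 2) (hs0 : 0 < s) {e : E n} (he : ‖e‖ = 1)
    {η : E n → ℝ} {χ : ℝ → ℝ} (hη : Smc η) (hχ : FlatTest χ) (h0 : (0 : ℝ) ∉ tsupport χ) :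
    form a (profE s e) η χ = 0 := by
  have hχ0 : ∀ᶠ y in 𝓝 0, χ y = 0 := notMem_tsupport_iff_eventuallyEq.1 h0
  have hpc := continuous_profE hs0.le e
  have hwdc := (hχ.smc_wd (a := a)).smooth.continuous
  have hVc : Continuous fun p : E n × ℝ =>
      |p.2| ^ a * χ p.2 * profTT s (inner ℝ p.1 e) p.2 * η p.1 := by
    rw [continuous_iff_continuousAt]
    rintro ⟨x, y⟩
    rcases eq_or_ne y 0 with rfl | hy
    · refine (continuousAt_const (y := (0 : ℝ))).congr ?_
      have hsnd : Tendsto (Prod.snd : E n × ℝ → ℝ) (𝓝 (x, 0)) (𝓝 0) :=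
        continuous_snd.tendsto (x, (0 : ℝ))
      have : ∀ᶠ p : E n × ℝ in 𝓝 (x, 0), χ p.2 = 0 := hsnd.eventually hχ0
      filter_upwards [this] with p hp using by simp [hp]
    · have hq : ContinuousAt (fun p : E n × ℝ => qf (inner ℝ p.1 e) p.2) (x, y) :=
        (continuous_qf.comp (continuous_inner_pair e)).continuousAt
      have hr : ContinuousAt (fun p : E n × ℝ => rad (inner ℝ p.1 e) p.2) (x, y) :=
        (continuous_rad.comp (continuous_inner_pair e)).continuousAt
      have h1 : ContinuousAt (fun p : E n × ℝ => |p.2| ^ a) (x, y) :=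
        (continuous_snd.abs.continuousAt).rpow_const (Or.inl (abs_ne_zero.2 hy))
      exact ((h1.mul (hχ.smooth.continuous.comp continuous_snd).continuousAt).mul
        (continuousAt_const.mul ((continuousAt_const.mul (hq.rpow_const (Or.inr hs0.le))).div hr
          (rad_pos _ hy).ne'))).mul (hη.smooth.continuous.comp continuous_fst).continuousAt
  have hcsV : HasCompactSupport fun p : E n × ℝ =>
      |p.2| ^ a * χ p.2 * profTT s (inner ℝ p.1 e) p.2 * η p.1 :=
    HasCompactSupport.intro (hη.cs.isCompact.prod hχ.cs.isCompact) fun p hp => by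
      rw [mem_prod, not_and_or] at hp
      rcases hp with hp | hp <;> simp [image_eq_zero_of_notMem_tsupport hp]
  have hcsU : HasCompactSupport fun p : E n × ℝ => wd a χ p.2 * (profE s e p * η p.1) :=
    HasCompactSupport.intro (hη.cs.isCompact.prod (hχ.smc_wd (a := a)).cs.isCompact) fun p hp => by
      rw [mem_prod, not_and_or] at hp
      rcases hp with hp | hp <;> simp [image_eq_zero_of_notMem_tsupport hp]
  have hUc : Continuous fun p : E n × ℝ => wd a χ p.2 * (profE s e p * η p.1) :=
    (hwdc.comp continuous_snd).mul (hpc.mul (hη.smooth.continuous.comp continuous_fst))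
  have iU := hUc.integrable_of_hasCompactSupport (μ := (volume : Measure (E n × ℝ))) hcsU
  have iV := hVc.integrable_of_hasCompactSupport (μ := (volume : Measure (E n × ℝ))) hcsV
  have s1 : form a (profE s e) η χ =
      ∫ y, ∫ x, (|y| ^ a * χ y * profTT s (inner ℝ x e) y * η x +
        wd a χ y * (profE s e (x, y) * η x)) := by
    rw [Measure.volume_eq_prod] at iU iV
    unfold form
    refine integral_congr_ae ?_
    filter_upwards [iU.prod_left_ae, iV.prod_left_ae] with y h1 h2
    rw [integral_add h2 h1, integral_const_mul]
    congr 1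
    simp only [mul_assoc, integral_const_mul]
    rcases eq_or_ne y 0 with rfl | hy
    · simp [image_eq_zero_of_notMem_tsupport h0]
    · rw [integral_profE_mul_lap hs0 he hy hη]
  rw [s1, integral_integral_swap_of_hasCompactSupport
    (f := fun y x => |y| ^ a * χ y * profTT s (inner ℝ x e) y * η x +
        wd a χ y * (profE s e (x, y) * η x))
    ((hVc.add hUc).comp continuous_swap)
    ((hcsV.add hcsU).comp_homeomorph (Homeomorph.prodComm ℝ (E n)))]
  refine integral_eq_zero_of_ae (.of_forall fun x => ?_)
  have i1 : Integrable fun y => |y| ^ a * χ y * profTT s (inner ℝ x e) y * η x :=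
    (hVc.comp (by fun_prop : Continuous fun y : ℝ => (x, y))).integrable_of_hasCompactSupport
      hχ.cs.mul_left.mul_right.mul_right
  have i2 : Integrable fun y => wd a χ y * (profE s e (x, y) * η x) :=
    (hUc.comp (by fun_prop : Continuous fun y : ℝ => (x, y))).integrable_of_hasCompactSupport
      (hχ.smc_wd (a := a)).cs.mul_right
  simp only [Pi.zero_apply]
  rw [integral_add i1 i2, integral_mul_const]
  have e3 : ∀ y, wd a χ y * (profE s e (x, y) * η x) =
      prof s (inner ℝ x e) y * wd a χ y * η x := fun y => by simp only [profE]; ring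
  simp_rw [e3]
  rw [integral_mul_const, integral_prof_mul_wd hs hs0 _ hχ h0]
  ring

lemma rad_smul {l : ℝ} (hl : 0 ≤ l) (t y : ℝ) : rad (l * t) (l * y) = l * rad t y := by
  unfold rad
  rw [show (l * t) ^ 2 + (l * y) ^ 2 = l ^ 2 * (t ^ 2 + y ^ 2) by ring,
    Real.sqrt_mul (by positivity), Real.sqrt_sq hl]

lemma qf_smul {l : ℝ} (hl : 0 ≤ l) (t y : ℝ) : qf (l * t) (l * y) = l * qf t y := by
  unfold qf
  rw [rad_smul hl]; ring

lemma prof_smul {s l : ℝ} (hl : 0 < l) (t y : ℝ) :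
    prof s (l * t) (l * y) = l ^ (1 + s) * prof s t y := by
  unfold prof
  rw [rad_smul hl.le, qf_smul hl.le, Real.mul_rpow hl.le (qf_nonneg _ _), Real.rpow_add hl,
    Real.rpow_one]
  ring

lemma prof_neg_right (s t y : ℝ) : prof s t (-y) = prof s t y := by simp [prof, qf, rad]

lemma prof_zero_right {s : ℝ} (hs : 0 < s) (t : ℝ) :
    prof s t 0 = (1 - s) * (max t 0) ^ (1 + s) := by
  have hr : rad t 0 = |t| := by simp [rad, Real.sqrt_sq_eq_abs]
  unfold prof qf
  rw [hr]
  rcases le_total t 0 with h | h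
  · rw [abs_of_nonpos h, max_eq_right h, Real.zero_rpow (by linarith)]
    simp [Real.zero_rpow hs.ne']
  · rw [abs_of_nonneg h, max_eq_left h]
    rcases h.eq_or_lt with rfl | h
    · simp [Real.zero_rpow hs.ne', Real.zero_rpow (by linarith : 1 + s ≠ 0)]
    · rw [Real.rpow_add h, Real.rpow_one, show (t + t) / 2 = t by ring]
      ring

lemma abs_prof_le {s : ℝ} (hs : 0 < s) (hs1 : s < 1) (t y : ℝ) :
    |prof s t y| ≤ 2 * (rad t y ^ s * rad t y) := by
  unfold prof
  rw [abs_mul, abs_of_nonneg (Real.rpow_nonneg (qf_nonneg _ _) _)]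
  have h1 : qf t y ^ s ≤ rad t y ^ s :=
    Real.rpow_le_rpow (qf_nonneg _ _) (qf_le_rad _ _) hs.le
  have h2 : |t - s * rad t y| ≤ 2 * rad t y := by
    have h3 := abs_le.1 (abs_le_rad t y)
    have := rad_nonneg t y
    rw [abs_le]
    constructor <;> nlinarith
  have h4 : 0 ≤ rad t y ^ s := Real.rpow_nonneg (rad_nonneg _ _) _
  calc _ ≤ rad t y ^ s * (2 * rad t y) := by gcongr
    _ = _ := by ring

lemma rad_le_add_abs (t y : ℝ) : rad t y ≤ |t| + |y| := by
  unfold rad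
  rw [Real.sqrt_le_left (by positivity)]
  nlinarith [sq_abs t, sq_abs y, mul_nonneg (abs_nonneg t) (abs_nonneg y)]

lemma abs_prof_sub_le {s : ℝ} (hs : 0 < s) (hs1 : s < 1) {y R t t' : ℝ} (hy : y ≠ 0)
    (hyR : |y| ≤ R) (ht : |t| ≤ 2 * R) (ht' : |t'| ≤ 2 * R) :
    |prof s t' y - prof s t y| ≤ (3 * R) ^ s * |t' - t| := by
  have h := (convex_Icc (-(2 * R)) (2 * R)).norm_image_sub_le_of_norm_hasDerivWithin_le
    (f := fun t => prof s t y) (f' := fun t => (1 - s ^ 2) * qf t y ^ s) (C := (3 * R) ^ s)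
    (x := t) (y := t')
    (fun z _ => (hasDerivAt_prof_left s z hy).hasDerivWithinAt) (fun z hz => ?_)
    (abs_le.1 ht) (abs_le.1 ht')
  · simpa [Real.norm_eq_abs] using h
  · have h1 : qf z y ^ s ≤ (3 * R) ^ s := by
      refine Real.rpow_le_rpow (qf_nonneg _ _) ((qf_le_rad _ _).trans ?_) hs.le
      have := rad_le_add_abs z y
      have := abs_le.2 hz
      linarith
    have h0 : 0 ≤ qf z y ^ s := Real.rpow_nonneg (qf_nonneg _ _) _
    rw [Real.norm_of_nonneg (mul_nonneg (by nlinarith) h0)]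
    nlinarith [sq_nonneg s]

/-! ### Boundary decay -/

/-- Boundary decay: a bounded supersolution in a half cylinder that vanishes on `y = 0` is bounded
below by a multiple of `-y^{1-a}` at the axis. -/
lemma decay_of_bounded (ha : -1 < a) (ha' : a < 1) {w : E n × ℝ → ℝ} (hw : Continuous w)
    {x₀ : E n} {M R : ℝ} (hM : 0 < M) (hR : 0 < R)
    (hsup : WeakSuper a (univ ×ˢ Ioi 0) w 0) (h0 : ∀ x, w (x, 0) = 0)
    (hb : ∀ x ∈ closedBall x₀ R, ∀ y ∈ Icc 0 R, -M ≤ w (x, y)) {y₀ : ℝ} (hy₀ : y₀ ∈ Icc 0 R) :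
    -(M * ((n + 1) / (1 + a) + 1)) * (y₀ / R) ^ (1 - a) ≤ w (x₀, y₀) := by
  have h1a : 0 < 1 + a := by linarith
  set B := (n + 1) * M / ((1 + a) * R ^ 2) with hB
  -- B makes the barrier strict against the paraboloid coefficient A = M/R². D makes the y-part at
  -- most -M(y/R)^{1-a}, since (y/R)² ≤ (y/R)^{1-a}. Then the top is below -M, and on the side the
  -- paraboloid alone supplies -M.
  set D := -(B * R ^ 2 + M) / R ^ (1 - a) with hD
  have hB0 : 0 < B := by positivity
  have hRa : 0 < R ^ (1 - a) := Real.rpow_pos_of_pos hR _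
  have hrat : ∀ y ∈ Icc (0 : ℝ) R, B * y ^ 2 + D * |y| ^ (1 - a) ≤ -M * (y / R) ^ (1 - a) := by
    intro y hy
    have h1 : (y / R) ^ 2 ≤ (y / R) ^ (1 - a) := by
      rw [← Real.rpow_two]
      rcases hy.1.eq_or_lt with h | h
      · rw [← h, zero_div, Real.zero_rpow (by norm_num), Real.zero_rpow (by linarith)]
      · exact Real.rpow_le_rpow_of_exponent_ge (div_pos h hR) ((div_le_one hR).2 hy.2)
          (by linarith)
    have h2 : |y| ^ (1 - a) = R ^ (1 - a) * (y / R) ^ (1 - a) := by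
      rw [abs_of_nonneg hy.1, ← Real.mul_rpow hR.le (div_nonneg hy.1 hR.le),
        mul_div_cancel₀ _ hR.ne']
    have h3 : y ^ 2 = R ^ 2 * (y / R) ^ 2 := by field_simp
    rw [h2, h3, hD]
    have h4 : -(B * R ^ 2 + M) / R ^ (1 - a) * (R ^ (1 - a) * (y / R) ^ (1 - a)) =
      -(B * R ^ 2 + M) * (y / R) ^ (1 - a) := by field_simp
    rw [h4]
    nlinarith [mul_le_mul_of_nonneg_left h1 (by positivity : 0 ≤ B * R ^ 2)]
  have key := comparison ha hw (continuous_barrier ha' 0 B D)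
    (K := closedBall x₀ R ×ˢ Icc 0 R) (O := ball x₀ R ×ˢ Ioo 0 R)
    ((isCompact_closedBall x₀ R).prod isCompact_Icc) (isOpen_ball.prod isOpen_Ioo)
    (prod_mono ball_subset_closedBall Ioo_subset_Icc_self) (J := Ioi 0)
    (fun p hp => hp.2.1) (f := 0) (A := M / R ^ 2) (x₀ := x₀)
    (weakSubY_barrier ha ha' 0 B D (Or.inr (by simp)))
    (fun η χ h1 h2 h3 h4 h5 => hsup η χ h1 h2 h3 h4
      (h5.trans (prod_mono (subset_univ _) fun y hy => hy.1)))
    (by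
      have : 2 * (1 + a) * B = 2 * (n + 1) * (M / R ^ 2) := by rw [hB]; field_simp
      rw [this]
      have : 0 < M / R ^ 2 := by positivity
      nlinarith)
    (by
      rintro ⟨x, y⟩ ⟨hx, hy⟩ hO
      change x ∈ closedBall x₀ R at hx
      change y ∈ Icc 0 R at hy
      have hA : 0 ≤ M / R ^ 2 * ‖x - x₀‖ ^ 2 := by positivity
      have hr := hrat y hy
      have hp : 0 ≤ (y / R) ^ (1 - a) := Real.rpow_nonneg (div_nonneg hy.1 hR.le) _
      have hwb := hb x hx y hy
      simp only
      rcases hy.1.eq_or_lt with h | h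
      · rw [← h, h0, abs_zero, Real.zero_rpow (by linarith)]
        simp only [ne_eq, OfNat.ofNat_ne_zero, not_false_eq_true, zero_pow, mul_zero, add_zero]
        linarith
      rcases hy.2.eq_or_lt with h' | h'
      · rw [h', div_self hR.ne', Real.one_rpow] at hr
        rw [h'] at hwb ⊢
        linarith
      · have hxR : R ≤ ‖x - x₀‖ := by
          by_contra hcon
          exact hO ⟨by rw [mem_ball, dist_eq_norm]; linarith, h, h'⟩
        have : M ≤ M / R ^ 2 * ‖x - x₀‖ ^ 2 := by
          calc M = M / R ^ 2 * R ^ 2 := by field_simp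
            _ ≤ _ := by gcongr
        nlinarith)
    (x₀, y₀) ⟨mem_closedBall_self hR.le, hy₀⟩
  simp only [sub_self, norm_zero] at key
  refine le_trans ?_ key
  have h2 : |y₀| ^ (1 - a) = R ^ (1 - a) * (y₀ / R) ^ (1 - a) := by
    rw [abs_of_nonneg hy₀.1, ← Real.mul_rpow hR.le (div_nonneg hy₀.1 hR.le),
      mul_div_cancel₀ _ hR.ne']
  have h4 : D * |y₀| ^ (1 - a) = -(M * ((n + 1) / (1 + a) + 1)) * (y₀ / R) ^ (1 - a) := by
    rw [h2, hD, hB]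
    field_simp
  rw [h4]
  have : 0 ≤ B * y₀ ^ 2 := by positivity
  simp only [ne_eq, OfNat.ofNat_ne_zero, not_false_eq_true, zero_pow, mul_zero, sub_zero]
  linarith

/-! ### Rigidity of profiles with half-space contact set -/

section Profile

variable {u₀ : E (n + 1) → ℝ} {e : E n}

lemma sExp_pos (ha' : a < 1) : 0 < sExp a := by unfold sExp; linarith
lemma sExp_lt_one (ha : -1 < a) : sExp a < 1 := by unfold sExp; linarith

lemma IsGlobalProfile.continuous (hu : IsGlobalProfile a u₀) : Continuous u₀ :=
  continuousOn_univ.1 hu.solution.continuousOn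

lemma IsGlobalProfile.trace_nonneg (hu : IsGlobalProfile a u₀) (x : E n) : 0 ≤ u₀ (pt x 0) :=
  hu.solution.nonneg x (mem_univ _)

lemma trace_eq_zero_iff
    (hΛ : contactSet univ u₀ = {X | yPart X = 0 ∧ inner ℝ (xPart X) e ≤ 0}) (x : E n) :
    u₀ (pt x 0) = 0 ↔ inner ℝ x e ≤ 0 := by
  have := Set.ext_iff.1 hΛ (pt x 0)
  simpa [contactSet] using this

/-- The trace of a profile is monotone in the directions that point out of the contact set. -/
lemma IsGlobalProfile.trace_mono (hu : IsGlobalProfile a u₀)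
    (hΛ : contactSet univ u₀ = {X | yPart X = 0 ∧ inner ℝ (xPart X) e ≤ 0}) (x : E n) {v : E n}
    (hv : 0 < inner ℝ v e) : u₀ (pt x 0) ≤ u₀ (pt (x + v) 0) := by
  obtain ⟨t, ht0, ht⟩ : ∃ t : ℝ, 0 < t ∧ inner ℝ x e ≤ t * inner ℝ v e :=
    ⟨|inner ℝ x e| / inner ℝ v e + 1, by positivity, by
      rw [add_mul, div_mul_cancel₀ _ hv.ne']
      linarith [le_abs_self (inner ℝ x e)]⟩
  have hz : u₀ (pt (x - t • v) 0) = 0 := (trace_eq_zero_iff hΛ _).2 (by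
    rw [inner_sub_left, real_inner_smul_left]; linarith)
  -- x lies between x + v and the contact point x - tv, so its value is at most t/(1 + t) times the
  -- value at x + v.
  have hc := (hu.convex 0).2 (mem_univ (x - t • v)) (mem_univ (x + v))
    (by positivity : 0 ≤ 1 / (1 + t)) (by positivity : 0 ≤ t / (1 + t)) (by field_simp)
  have hx : (1 / (1 + t)) • (x - t • v) + (t / (1 + t)) • (x + v) = x := by
    have h1 : (1 / (1 + t)) + (t / (1 + t)) = 1 := by field_simp
    calc _ = ((1 / (1 + t)) + (t / (1 + t))) • x +
          (t / (1 + t) - (1 / (1 + t)) * t) • v := by module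
      _ = x := by rw [h1]; ring_nf; simp
  simp only [hx, hz, smul_eq_mul] at hc
  have h2 : t / (1 + t) ≤ 1 := (div_le_one (by positivity)).2 (by linarith)
  nlinarith [hu.trace_nonneg (x + v)]

/-- Monotonicity along every outward direction, tangential ones included by a limit, shows that the
trace depends only on x·e. Homogeneity does the rest. -/
lemma IsGlobalProfile.trace_eq (hu : IsGlobalProfile a u₀) (he : ‖e‖ = 1)
    (hΛ : contactSet univ u₀ = {X | yPart X = 0 ∧ inner ℝ (xPart X) e ≤ 0}) (ha' : a < 1)
    (x : E n) : u₀ (pt x 0) = (max (inner ℝ x e) 0) ^ (1 + sExp a) * u₀ (pt e 0) := by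
  have hs := sExp_pos ha'
  have hee : inner ℝ e e = (1 : ℝ) := by rw [real_inner_self_eq_norm_sq, he]; norm_num
  rcases le_or_gt (inner ℝ x e) 0 with h | h
  · rw [max_eq_right h, (trace_eq_zero_iff hΛ x).2 h, Real.zero_rpow (by linarith), zero_mul]
  have hle : ∀ x x' : E n, inner ℝ x e = inner ℝ x' e → u₀ (pt x 0) ≤ u₀ (pt x' 0) := by
    intro x x' hxx
    have hcont : Continuous fun ε : ℝ => u₀ (pt (x' + ε • e) 0) :=
      hu.continuous.comp (continuous_pt.comp (by fun_prop : Continuous fun ε : ℝ =>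
        ((x' + ε • e, 0) : E n × ℝ)))
    have ht : Tendsto (fun ε : ℝ => u₀ (pt (x' + ε • e) 0)) (𝓝[>] 0) (𝓝 (u₀ (pt x' 0))) := by
      have := hcont.tendsto 0
      simp only [zero_smul, add_zero] at this
      exact this.mono_left nhdsWithin_le_nhds
    refine ge_of_tendsto ht ?_
    filter_upwards [self_mem_nhdsWithin] with ε hε
    have := hu.trace_mono hΛ x (v := x' + ε • e - x) (by
      rw [inner_sub_left, inner_add_left, real_inner_smul_left, hee, hxx]
      have : (0 : ℝ) < ε := hε
      linarith)
    simpa using this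
  have h1 : inner ℝ x e = inner ℝ ((inner ℝ x e : ℝ) • e) e := by
    rw [real_inner_smul_left, hee, mul_one]
  have h2 : u₀ (pt x 0) = u₀ (pt ((inner ℝ x e : ℝ) • e) 0) :=
    le_antisymm (hle _ _ h1) (hle _ _ h1.symm)
  have h3 := hu.homogeneous (inner ℝ x e) h (pt e 0)
  rw [smul_pt, mul_zero] at h3
  rw [h2, h3, max_eq_left h.le]

end Profile

section

variable {u₀ : E (n + 1) → ℝ} {e : E n}

lemma IsGlobalProfile.exists_growth (hu : IsGlobalProfile a u₀) :
    ∃ M, 0 ≤ M ∧ ∀ R, 0 < R → ∀ X, ‖X‖ ≤ R → |u₀ X| ≤ M * R ^ (1 + sExp a) := by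
  obtain ⟨M, hM⟩ := (isCompact_closedBall (0 : E (n + 1)) 1).exists_bound_of_continuousOn
    hu.continuous.continuousOn
  refine ⟨M, (norm_nonneg _).trans (hM 0 (by simp)), fun R hR X hX => ?_⟩
  have h1 := hu.homogeneous R hR (R⁻¹ • X)
  rw [smul_inv_smul₀ hR.ne'] at h1
  have h2 := hM (R⁻¹ • X) (by
    rw [mem_closedBall_zero_iff, norm_smul, norm_inv, Real.norm_of_nonneg hR.le]
    exact inv_mul_le_one_of_le₀ hX hR.le)
  rw [h1, abs_mul, abs_of_nonneg (Real.rpow_nonneg hR.le _), mul_comm]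
  exact mul_le_mul_of_nonneg_right h2 (Real.rpow_nonneg hR.le _)

lemma norm_pt_le (x : E n) (y : ℝ) : ‖pt x y‖ ≤ ‖x‖ + |y| := by
  refine le_of_sq_le_sq ?_ (by positivity)
  rw [norm_pt_sq]
  nlinarith [sq_abs y, mul_nonneg (norm_nonneg x) (abs_nonneg y)]

/-- A convex function bounded by M(4R)^{1+s} on the ball of radius 3R is Lipschitz on the ball of
radius 2R with constant 2M(4R)^{1+s}/R. This replaces derivative estimates for u₀. -/
lemma IsGlobalProfile.exists_lipschitz (hu : IsGlobalProfile a u₀) :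
    ∃ C, 0 ≤ C ∧ ∀ R, 0 < R → ∀ y, |y| ≤ R → ∀ x x' : E n, ‖x‖ < 2 * R → ‖x'‖ < 2 * R →
      |u₀ (pt x' y) - u₀ (pt x y)| ≤ C * R ^ sExp a * ‖x' - x‖ := by
  obtain ⟨M, hM0, hM⟩ := hu.exists_growth
  refine ⟨2 * (M * 4 ^ (1 + sExp a)), by positivity, fun R hR y hy x x' hx hx' => ?_⟩
  have hL := ((hu.convex y).subset (subset_univ (ball (0 : E n) (3 * R)))
    (convex_ball _ _)).lipschitzOnWith_of_abs_le hR (M := M * (4 * R) ^ (1 + sExp a))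
    (fun z hz => hM (4 * R) (by positivity) _ (by
      rw [dist_zero_right] at hz
      have := norm_pt_le z y
      linarith))
  have h1 := hL.dist_le_mul x' (by rw [mem_ball_zero_iff]; linarith) x
    (by rw [mem_ball_zero_iff]; linarith)
  rw [Real.dist_eq, dist_eq_norm] at h1
  refine h1.trans (le_of_eq ?_)
  rw [Real.coe_toNNReal _ (by positivity), Real.mul_rpow (by norm_num) hR.le,
    Real.rpow_add hR, Real.rpow_one]
  field_simp

/-- A profile whose contact set is a half-space is a multiple of the explicit one. -/
theorem IsGlobalProfile.eq_profE (ha : -1 < a) (ha' : a < 1) (hu : IsGlobalProfile a u₀)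
    (he : ‖e‖ = 1)
    (hΛ : contactSet univ u₀ = {X | yPart X = 0 ∧ inner ℝ (xPart X) e ≤ 0}) :
    ∃ k, 0 < k ∧ ∀ x y, u₀ (pt x y) = k * prof (sExp a) (inner ℝ x e) y := by
  have hs := sExp_pos ha'
  have hs1 := sExp_lt_one ha
  set s := sExp a with hsdef
  have hs2 : 1 - a = 2 * s := by rw [hsdef, sExp]; ring
  have hee : inner ℝ e e = (1 : ℝ) := by rw [real_inner_self_eq_norm_sq, he]; norm_num
  set k := u₀ (pt e 0) / (1 - s) with hk
  have hk0 : 0 < k := by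
    refine div_pos ((hu.trace_nonneg e).lt_of_ne fun h => ?_) (by linarith)
    have := (trace_eq_zero_iff hΛ e).1 h.symm
    linarith
  set v : E n × ℝ → ℝ := fun p => u₀ (pt p.1 p.2) with hv
  have hvc : Continuous v := hu.continuous.comp continuous_pt
  set Z : E n × ℝ → ℝ := fun p => v p - k * profE s e p with hZ
  have hkc : Continuous fun p : E n × ℝ => k * profE s e p :=
    continuous_const.mul (continuous_profE hs.le e)
  have hZc : Continuous Z := hvc.sub hkc
  have hZ0 : ∀ x, Z (x, 0) = 0 := fun x => by
    simp only [hZ, hv, profE]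
    rw [hu.trace_eq he hΛ ha' x, prof_zero_right hs, hk]
    have : 1 - s ≠ 0 := by linarith
    field_simp
    ring
  have hZform : ∀ η χ, Smc η → FlatTest χ → tsupport χ ⊆ Ioi 0 → form a Z η χ = 0 := by
    intro η χ hη hχ hχs
    have h0 : (0 : ℝ) ∉ tsupport χ := fun h => lt_irrefl (0 : ℝ) (hχs h)
    rw [hZ, form_sub ha hvc hkc hη hχ,
      form_const_mul, form_profE (s := s) rfl hs he hη hχ h0,
      hu.solution.form_eq ha isOpen_univ hη hχ fun x _ y hy => ⟨mem_univ _, fun h => ?_⟩]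
    · simp
    · have h1 : yPart (pt x y) = 0 := h.2.1
      rw [yPart_pt] at h1
      exact h0 (h1 ▸ hy)
  obtain ⟨C₀, hC₀, hLip⟩ := hu.exists_lipschitz
  have hDZ : ∀ (h x : E n) (y : ℝ), 0 < y → Z (x + h, y) = Z (x, y) := by
    intro h x₀ y₀ hy₀
    set C := C₀ + k * 3 ^ s with hC
    have hC0 : 0 ≤ C := by positivity
    have hbound : ∀ R, 0 < R → ∀ y, 0 ≤ y → y ≤ R → ∀ x : E n, ‖x‖ < 2 * R → ‖x + h‖ < 2 * R →
        |Z (x + h, y) - Z (x, y)| ≤ C * R ^ s * ‖h‖ := by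
      intro R hR y hy0 hyR x hx hxh
      have hRs : 0 ≤ R ^ s := Real.rpow_nonneg hR.le _
      rcases hy0.eq_or_lt with h0 | h0
      · rw [← h0, hZ0, hZ0, sub_self, abs_zero]
        positivity
      · have h1 := hLip R hR y (by rwa [abs_of_pos h0]) x (x + h) hx hxh
        have hin : ∀ z : E n, |inner ℝ z e| ≤ ‖z‖ := fun z => by
          have := abs_real_inner_le_norm z e
          rwa [he, mul_one] at this
        have h2 := abs_prof_sub_le hs hs1 h0.ne' (by rwa [abs_of_pos h0])
          ((hin x).trans hx.le) ((hin (x + h)).trans hxh.le)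
        have h3 : |inner ℝ (x + h) e - inner ℝ x e| ≤ ‖h‖ := by
          rw [inner_add_left, add_sub_cancel_left]; exact hin h
        have e1 : Z (x + h, y) - Z (x, y) = (u₀ (pt (x + h) y) - u₀ (pt x y)) -
            k * (prof s (inner ℝ (x + h) e) y - prof s (inner ℝ x e) y) := by
          simp only [hZ, hv, profE]; ring
        rw [e1]
        refine (abs_sub _ _).trans ?_
        rw [abs_mul, abs_of_pos hk0]
        rw [add_sub_cancel_left] at h1
        rw [Real.mul_rpow (by norm_num) hR.le] at h2
        have h4 : k * |prof s (inner ℝ (x + h) e) y - prof s (inner ℝ x e) y| ≤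
            k * (3 ^ s * R ^ s * ‖h‖) :=
          mul_le_mul_of_nonneg_left (h2.trans (by gcongr)) hk0.le
        calc _ ≤ C₀ * R ^ s * ‖h‖ + k * (3 ^ s * R ^ s * ‖h‖) := add_le_add h1 h4
          _ = _ := by rw [hC]; ring
    -- both signs of the increment decay
    have hsign : ∀ σ : ℝ, |σ| = 1 → 0 ≤ σ * (Z (x₀ + h, y₀) - Z (x₀, y₀)) := by
      intro σ hσ
      set w : E n × ℝ → ℝ := fun p => σ * (Z (p.1 + h, p.2) - Z p) with hw
      have hZh : Continuous fun p : E n × ℝ => Z (p.1 + h, p.2) := by fun_prop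
      have hwc : Continuous w := by fun_prop
      have hsup : WeakSuper a (univ ×ˢ Ioi 0) w 0 := by
        intro η χ hη hχ _ _ hsupp
        rw [zero_mul, hw, form_const_mul, form_sub ha hZh hZc hη hχ, form_translate]
        by_cases hne : (tsupport η).Nonempty
        · obtain ⟨x, hx⟩ := hne
          have hχs : tsupport χ ⊆ Ioi 0 := fun y hy => (hsupp (mk_mem_prod hx hy)).2
          rw [hZform _ _ (hη.comp_sub_right h) hχ hχs, hZform _ _ hη hχ hχs]
          simp
        · have hη0 : η = 0 := by
            rw [not_nonempty_iff_eq_empty, tsupport_eq_empty_iff] at hne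
            exact hne
          have hlap0 : ∀ x, lap (0 : E n → ℝ) x = 0 := fun x => by simp [lap]
          have e0 : (fun x => η (x - h)) = 0 := by ext; simp [hη0]
          rw [e0, hη0]
          simp
      -- Size R^s of the increment times the decay (y₀/R)^{2s} leaves R^{-s}. The extra 1's only
      -- keep the bound M positive.
      have hlim : Tendsto (fun R : ℝ => -(C * (‖h‖ + 1) + 1) * ((n + 1) / (1 + a) + 1) *
          y₀ ^ (2 * s) * R ^ (-s)) atTop (𝓝 0) := by
        have := (tendsto_rpow_neg_atTop hs).const_mul
          (-(C * (‖h‖ + 1) + 1) * ((n + 1) / (1 + a) + 1) * y₀ ^ (2 * s))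
        simpa using this
      refine le_of_tendsto hlim ?_
      filter_upwards [eventually_gt_atTop (‖x₀‖ + ‖h‖ + y₀ + 1)] with R hR
      have hx0 := norm_nonneg x₀
      have hh0 := norm_nonneg h
      have hR0 : 0 < R := by linarith
      have hRs : 0 < R ^ s := Real.rpow_pos_of_pos hR0 _
      have hdec := decay_of_bounded ha ha' hwc (x₀ := x₀)
        (M := (C * (‖h‖ + 1) + 1) * R ^ s) (R := R) (by positivity) hR0 hsup
        (fun x => by simp only [hw, hZ0, sub_self, mul_zero])
        (fun x hx y hy => by
          rw [mem_closedBall, dist_eq_norm] at hx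
          have hx1 : ‖x‖ ≤ ‖x₀‖ + R := by
            have := norm_le_norm_add_norm_sub' x x₀
            linarith
          have hx2 := norm_add_le x h
          have hb := hbound R hR0 y hy.1 hy.2 x (by linarith) (by linarith)
          have h1 : |w (x, y)| ≤ C * R ^ s * ‖h‖ := by
            simp only [hw]
            rwa [abs_mul, hσ, one_mul]
          have h2 := (abs_le.1 h1).1
          nlinarith [mul_nonneg hC0 hRs.le])
        (y₀ := y₀) ⟨hy₀.le, by linarith⟩
      refine le_trans (le_of_eq ?_) hdec
      rw [hs2, Real.div_rpow hy₀.le hR0.le, Real.rpow_neg hR0.le,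
        show 2 * s = s + s by ring, Real.rpow_add hR0]
      field_simp
    have h1 := hsign 1 (by simp)
    have h2 := hsign (-1) (by simp)
    linarith
  have hval : ∀ x y, 0 < y → Z (x, y) = |y| ^ (1 + s) * Z (0, 1) := by
    intro x y hy
    have h1 := hDZ x 0 y hy
    rw [zero_add] at h1
    rw [h1, abs_of_pos hy]
    have h2 := hu.homogeneous y hy (pt 0 1)
    rw [smul_pt, smul_zero, mul_one] at h2
    have h3 := prof_smul (s := s) hy 0 1
    rw [mul_zero, mul_one] at h3
    simp only [hZ, hv, profE, inner_zero_left]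
    rw [h2, h3]
    ring
  -- Z is now Z(0, 1)·y^{1+s} for y > 0, and L_a y^{1+s} = (1 + s)(s + a)y^{s-1+a}, where s + a = (1
  -- + a)/2 > 0. One positive test function in y > 0 excludes a nonzero coefficient.
  have hZ1 : Z (0, 1) = 0 := by
    let φ : ContDiffBump (0 : E n) := ⟨1, 2, by norm_num, by norm_num⟩
    let ψ : ContDiffBump (2 : ℝ) := ⟨1 / 2, 1, by norm_num, by norm_num⟩
    have hη : Smc (φ : E n → ℝ) := ⟨φ.contDiff, φ.hasCompactSupport⟩
    have hψs : tsupport (ψ : ℝ → ℝ) ⊆ Ioi 0 := by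
      rw [ψ.tsupport_eq, Real.closedBall_eq_Icc]
      intro y hy
      have : (2 : ℝ) - 1 ≤ y := hy.1
      show 0 < y
      linarith
    have h0 : (0 : ℝ) ∉ tsupport (ψ : ℝ → ℝ) := fun h => lt_irrefl (0 : ℝ) (hψs h)
    have hχ : FlatTest (ψ : ℝ → ℝ) :=
      { smooth := ψ.contDiff
        cs := ψ.hasCompactSupport
        flat := by
          have := (notMem_tsupport_iff_eventuallyEq.1 h0).deriv
          filter_upwards [this] with y hy
          rw [hy]
          simp }
    have hf := hZform _ _ hη hχ hψs
    have hform : form a Z φ ψ = (Z (0, 1) * ∫ x, φ x) * ∫ y, |y| ^ (1 + s) * wd a ψ y := by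
      unfold form
      rw [← integral_const_mul]
      refine integral_congr_ae (.of_forall fun y => ?_)
      simp only
      by_cases hy : y ∈ tsupport (ψ : ℝ → ℝ)
      · have hy0 : 0 < y := hψs hy
        simp only [hval _ y hy0, integral_const_mul, integral_lap hη]
        ring
      · rw [image_eq_zero_of_notMem_tsupport hy,
          image_eq_zero_of_notMem_tsupport fun h => hy (tsupport_wd_subset a ψ h)]
        simp
    rw [hform, integral_abs_rpow_mul_wd hχ (Or.inr h0)] at hf
    have hI1 : 0 < ∫ x, φ x := φ.integral_pos
    have hI2 : 0 < ∫ y, |y| ^ (1 + s - 2 + a) * ψ y := by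
      refine integral_pos_of_integrable_nonneg_nonzero (x := 2)
        (continuous_abs_rpow_mul_of_eventually_zero _ ψ.continuous
          (notMem_tsupport_iff_eventuallyEq.1 h0))
        (integrable_abs_rpow_mul hχ.toSmc (Or.inr h0))
        (fun y => mul_nonneg (Real.rpow_nonneg (abs_nonneg _) _) ψ.nonneg) ?_
      have h2 : ψ 2 = 1 := ψ.one_of_mem_closedBall (by simp; exact ψ.rIn_pos.le)
      rw [h2, mul_one]
      exact (Real.rpow_pos_of_pos (by norm_num) _).ne'
    have hsa : 0 < (1 + s) * (1 + s - 1 + a) := by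
      have : 0 < s + a := by rw [hsdef, sExp]; linarith
      have : 0 < 1 + s - 1 + a := by linarith
      positivity
    have := (mul_eq_zero.1 hf).resolve_right (mul_pos hsa hI2).ne'
    exact (mul_eq_zero.1 this).resolve_right hI1.ne'
  have hpos : ∀ x y, 0 < y → u₀ (pt x y) = k * prof s (inner ℝ x e) y := by
    intro x y hy
    have h1 := hval x y hy
    rw [hZ1, mul_zero] at h1
    simp only [hZ, hv, profE] at h1
    linarith
  refine ⟨k, hk0, fun x y => ?_⟩
  rcases lt_trichotomy y 0 with hy | rfl | hy
  · rw [hu.solution.even x y (mem_univ _), hpos x (-y) (by linarith), prof_neg_right]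
  · have := hZ0 x
    simp only [hZ, hv, profE] at this
    linarith
  · exact hpos x y hy

end

/-! ### Uniform lower bounds for profiles -/

section

variable {u₀ : E (n + 1) → ℝ} {e : E n}

lemma weight_smul (a : ℝ) {r : ℝ} (hr : 0 < r) (X : E (n + 1)) :
    weight a (r • X) = r ^ a * weight a X := by
  have : yPart (r • X) = r * yPart X := by simp [yPart]
  rw [weight, weight, this, abs_mul, abs_of_pos hr, Real.mul_rpow hr.le (abs_nonneg _)]

/-- The weight is integrable on the unit ball, so in polar coordinates almost every sphere of radius
r < 1 carries an integrable weight; homogeneity transfers this to radius 1. Integrability matters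
because the Bochner integral would otherwise be 0 by default and bound nothing. -/
lemma integrable_weight_toSphere (ha : -1 < a) :
    Integrable (fun θ : sphere (0 : E (n + 1)) 1 => weight a (θ : E (n + 1)))
      (volume : Measure (E (n + 1))).toSphere := by
  have h0 : Integrable ((ball (0 : E (n + 1)) 1).indicator (weight a)) := by
    rw [integrable_indicator_iff measurableSet_ball]
    exact ((locallyIntegrable_weight' ha).integrableOn_isCompact
      (isCompact_closedBall (0 : E (n + 1)) 1)).mono_set ball_subset_closedBall
  have h1 := h0.integrableOn (s := ({0}ᶜ : Set (E (n + 1))))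
  rw [integrableOn_iff_comap_subtypeVal (measurableSet_singleton _).compl] at h1
  have h2 := ((volume : Measure (E (n + 1))).measurePreserving_homeomorphUnitSphereProd.symm
    (homeomorphUnitSphereProd (E (n + 1))).toMeasurableEquiv).integrable_comp_emb
    (Homeomorph.measurableEmbedding (homeomorphUnitSphereProd (E (n + 1))).symm)
    (g := (ball (0 : E (n + 1)) 1).indicator (weight a) ∘ Subtype.val)
  have h3 := (h2.2 h1).prod_left_ae
  have hpos : Measure.volumeIoiPow (Module.finrank ℝ (E (n + 1)) - 1)
      (Iio ⟨1, mem_Ioi.2 one_pos⟩) ≠ 0 := by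
    rw [Measure.volumeIoiPow_apply_Iio]
    simp only [ne_eq, ENNReal.ofReal_eq_zero, not_le]
    positivity
  obtain ⟨r, hr1, hr⟩ := Frequently.exists
    ((frequently_ae_mem_iff.2 hpos).and_eventually h3)
  have hr0 : 0 < (r : ℝ) := r.2
  have hr1' : (r : ℝ) < 1 := hr1
  refine (hr.const_mul (((r : ℝ) ^ a)⁻¹)).congr (.of_forall fun θ => ?_)
  have hθ : ‖(θ : E (n + 1))‖ = 1 := by simp
  have hmem : (r : ℝ) • (θ : E (n + 1)) ∈ ball (0 : E (n + 1)) 1 := by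
    rw [mem_ball_zero_iff, norm_smul, hθ, mul_one, Real.norm_of_nonneg hr0.le]
    exact hr1'
  have : ((r : ℝ) ^ a) ≠ 0 := (Real.rpow_pos_of_pos hr0 _).ne'
  show ((r : ℝ) ^ a)⁻¹ * ((ball (0 : E (n + 1)) 1).indicator (weight a) ((r : ℝ) • (θ : E (n + 1))))
    = _
  rw [indicator_of_mem hmem, weight_smul a hr0, inv_mul_cancel_left₀ this]

/-- The factor in front of the explicit profile is bounded below by a constant that depends only on
`n` and `a`. -/
lemma exists_profile_const (n : ℕ) (ha : -1 < a) (ha' : a < 1) :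
    ∃ k₀, 0 < k₀ ∧ ∀ (u₀ : E (n + 1) → ℝ) (e : E n), IsGlobalProfile a u₀ → ‖e‖ = 1 →
      contactSet univ u₀ = {X | yPart X = 0 ∧ inner ℝ (xPart X) e ≤ 0} →
      ∃ k, k₀ ≤ k ∧ ∀ x y, u₀ (pt x y) = k * prof (sExp a) (inner ℝ x e) y := by
  have hs := sExp_pos ha'
  have hs1 := sExp_lt_one ha
  set I := ∫ θ : sphere (0 : E (n + 1)) 1, weight a (θ : E (n + 1))
    ∂(volume : Measure (E (n + 1))).toSphere with hI
  have hI0 : 0 ≤ I := integral_nonneg fun θ => weight_nonneg _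
  refine ⟨1 / (2 * (I + 1)), by positivity, fun u₀ e hu he hΛ => ?_⟩
  obtain ⟨k, hk, hkeq⟩ := hu.eq_profE ha ha' he hΛ
  refine ⟨k, ?_, hkeq⟩
  have hle : ∀ θ : sphere (0 : E (n + 1)) 1, weight a (θ : E (n + 1)) * u₀ θ ^ 2 ≤
      4 * k ^ 2 * weight a (θ : E (n + 1)) := by
    intro θ
    have hθ : ‖(θ : E (n + 1))‖ = 1 := by simp
    obtain ⟨x, y, hxy⟩ : ∃ x y, (θ : E (n + 1)) = pt x y := ⟨_, _, (pt_xPart_yPart _).symm⟩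
    have h1 := norm_pt_sq x y
    rw [← hxy, hθ] at h1
    have h2 : |inner ℝ x e| ≤ ‖x‖ := by
      have := abs_real_inner_le_norm x e
      rwa [he, mul_one] at this
    have h3 : rad (inner ℝ x e) y ≤ 1 := by
      rw [rad, Real.sqrt_le_one]
      have := sq_le_sq' (by linarith [abs_nonneg (inner ℝ x e : ℝ), norm_nonneg x]) h2
      rw [sq_abs] at this
      linarith
    have h4 : |prof (sExp a) (inner ℝ x e) y| ≤ 2 := by
      refine (abs_prof_le hs hs1 _ _).trans ?_
      have := Real.rpow_le_one (rad_nonneg (inner ℝ x e) y) h3 hs.le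
      have := mul_le_one₀ this (rad_nonneg _ _) h3
      linarith
    have h5 : u₀ θ ^ 2 ≤ 4 * k ^ 2 := by
      rw [hxy, hkeq, mul_pow]
      have : prof (sExp a) (inner ℝ x e) y ^ 2 ≤ 4 := by
        rw [← sq_abs]; nlinarith [abs_nonneg (prof (sExp a) (inner ℝ x e) y)]
      nlinarith [sq_nonneg k]
    rw [mul_comm]
    exact mul_le_mul_of_nonneg_right h5 (weight_nonneg _)
  -- On the unit sphere |prof| ≤ 2, so the normalization forces 4k²I ≥ 1. Comparing with (I + 1)²
  -- avoids a square root of I.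
  have h1 : (1 : ℝ) ≤ 4 * k ^ 2 * I := by
    rw [← hu.normalized, hI, ← integral_const_mul]
    exact integral_mono_of_nonneg (.of_forall fun θ => mul_nonneg (weight_nonneg _) (sq_nonneg _))
      ((integrable_weight_toSphere ha).const_mul _) (.of_forall hle)
  rw [div_le_iff₀ (by positivity)]
  by_contra! hcon
  have h2 : (k * (2 * (I + 1))) ^ 2 < 1 := by
    have : 0 ≤ k * (2 * (I + 1)) := by positivity
    nlinarith
  nlinarith [sq_nonneg k, mul_nonneg (sq_nonneg k) hI0, mul_nonneg (sq_nonneg k) (sq_nonneg I)]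

lemma inner_ge_of_norm_sub_lt {τ e : E n} (hτ : ‖τ‖ = 1) (he : ‖e‖ = 1) (h : ‖τ - e‖ < 1 / 2) :
    1 / 2 ≤ inner ℝ τ e := by
  have h1 := norm_sub_sq_real τ e
  rw [hτ, he] at h1
  nlinarith [norm_nonneg (τ - e)]

/-- The profile increases in directions close to the normal. -/
lemma exists_profile_gradient_bound (n : ℕ) (ha : -1 < a) (ha' : a < 1) :
    ∃ c₀, 0 < c₀ ∧ ∀ (u₀ : E (n + 1) → ℝ) (e : E n), IsGlobalProfile a u₀ → ‖e‖ = 1 →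
      contactSet univ u₀ = {X | yPart X = 0 ∧ inner ℝ (xPart X) e ≤ 0} →
      ∀ τ : E n, ‖τ‖ = 1 → ‖τ - e‖ < 1 / 2 → ∀ x y, pt x y ∈ ball (0 : E (n + 1)) 1 →
        c₀ * |y| ^ (2 * sExp a) ≤ inner ℝ (gradX u₀ (pt x y)) τ := by
  obtain ⟨k₀, hk₀, H⟩ := exists_profile_const n ha ha'
  have hs := sExp_pos ha'
  have hs1 := sExp_lt_one ha
  set s := sExp a with hsdef
  have hs2 : 0 < 1 - s ^ 2 := by nlinarith
  refine ⟨k₀ * (1 - s ^ 2) * (1 / 2) * (1 / 4) ^ s, by positivity,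
    fun u₀ e hu he hΛ τ hτ hτe x y hxy => ?_⟩
  obtain ⟨k, hk, hkeq⟩ := H u₀ e hu he hΛ
  have hin := inner_ge_of_norm_sub_lt hτ he hτe
  rw [gradX, xPart_pt, yPart_pt]
  -- On y = 0 the claim is only nonnegativity. It follows from monotonicity of the trace where u₀ is
  -- differentiable in x, and from the default value 0 of `gradient` otherwise.
  rcases eq_or_ne y 0 with rfl | hy
  · rw [abs_zero, Real.zero_rpow (by positivity), mul_zero]
    by_cases hd : DifferentiableAt ℝ (fun x : E n => u₀ (pt x 0)) x
    · rw [inner_gradient_left]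
      have hl := (hd.hasFDerivAt.hasLineDerivAt τ).tendsto_slope_zero_right
      refine ge_of_tendsto hl ?_
      filter_upwards [self_mem_nhdsWithin] with t ht
      have ht0 : (0 : ℝ) < t := ht
      have := hu.trace_mono hΛ x (v := t • τ) (by
        rw [real_inner_smul_left]; exact mul_pos ht0 (by linarith))
      exact smul_nonneg (inv_nonneg.2 ht0.le) (sub_nonneg.2 (by simpa using this))
    · rw [gradient_eq_zero_of_not_differentiableAt hd, inner_zero_left]
  · have hfd : HasFDerivAt (fun x : E n => u₀ (pt x y))
        ((k * ((1 - s ^ 2) * qf (inner ℝ x e) y ^ s)) • innerSL ℝ e) x := by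
      have h1 := hasFDerivAt_comp_inner (x := x) (e := e)
        ((hasDerivAt_prof_left s (inner ℝ x e) hy).const_mul k)
      refine h1.congr_of_eventuallyEq (.of_forall fun z => ?_)
      exact hkeq z y
    rw [inner_gradient_left, hfd.fderiv]
    simp only [smul_apply, innerSL_apply_apply, smul_eq_mul]
    rw [real_inner_comm τ e]
    have hq : (1 / 4) * y ^ 2 ≤ qf (inner ℝ x e) y := by
      have h1 := y_sq_eq (inner ℝ x e) y
      have h2 : rad (inner ℝ x e) y ≤ 1 := by
        rw [rad, Real.sqrt_le_one]
        rw [mem_ball_zero_iff] at hxy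
        have h3 := norm_pt_sq x y
        have h4 : |inner ℝ x e| ≤ ‖x‖ := by
          have := abs_real_inner_le_norm x e
          rwa [he, mul_one] at this
        have h5 := sq_le_sq' (by linarith [abs_nonneg (inner ℝ x e : ℝ), norm_nonneg x]) h4
        rw [sq_abs] at h5
        nlinarith [norm_nonneg (pt x y)]
      nlinarith [qf_nonneg (inner ℝ x e) y, qf_le_rad (inner ℝ x e) y]
    have hq2 : (1 / 4) ^ s * |y| ^ (2 * s) ≤ qf (inner ℝ x e) y ^ s := by
      have h1 : |y| ^ (2 * s) = (y ^ 2) ^ s := by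
        rw [Real.rpow_mul (abs_nonneg _)]; norm_num
      rw [h1, ← Real.mul_rpow (by norm_num) (sq_nonneg _)]
      exact Real.rpow_le_rpow (by positivity) hq hs.le
    have hq0 : 0 ≤ (1 / 4 : ℝ) ^ s * |y| ^ (2 * s) := by positivity
    calc k₀ * (1 - s ^ 2) * (1 / 2) * (1 / 4) ^ s * |y| ^ (2 * s)
        = k₀ * ((1 - s ^ 2) * ((1 / 4) ^ s * |y| ^ (2 * s))) * (1 / 2) := by ring
      _ ≤ k * ((1 - s ^ 2) * qf (inner ℝ x e) y ^ s) * inner ℝ τ e := by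
        have : 0 ≤ k := hk₀.le.trans hk
        have := qf_nonneg (inner ℝ x e) y
        gcongr

/-- The tangential gradient of the profile vanishes on the thin half-ball inside the contact set. -/
lemma gradX_eq_zero_of_inner_neg
    (hΛ : contactSet univ u₀ = {X | yPart X = 0 ∧ inner ℝ (xPart X) e ≤ 0}) {x : E n}
    (hx : inner ℝ x e < 0) : gradX u₀ (pt x 0) = 0 := by
  rw [gradX, xPart_pt, yPart_pt]
  have : (fun x : E n => u₀ (pt x 0)) =ᶠ[𝓝 x] fun _ => 0 := by
    have hc : Continuous fun x : E n => inner ℝ x e := by fun_prop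
    filter_upwards [hc.continuousAt.eventually_lt continuousAt_const hx] with z hz
    exact (trace_eq_zero_iff hΛ z).2 hz.le
  rw [this.gradient_eq]
  simp

end

/-! ### The barrier argument for increments -/

section

lemma WeakSuper.mono {O O' : Set (E n × ℝ)} {w : E n × ℝ → ℝ} {f : ℝ} (h : WeakSuper a O w f)
    (hO : O' ⊆ O) : WeakSuper a O' w f :=
  fun η χ hη hχ hη0 hχ0 hs => h η χ hη hχ hη0 hχ0 (hs.trans hO)

/-- The properties of a difference quotient of a solution in a tangential direction that enter the
barrier argument: `N` stands for the contact set. -/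
structure IsIncrement (a c₀ ε : ℝ) (N : Set (E n × ℝ)) (w : E n × ℝ → ℝ) : Prop where
  continuous : Continuous w
  isClosed : IsClosed N
  snd_eq_zero : ∀ p ∈ N, p.2 = 0
  super : WeakSuper a ((ball 0 (7 / 8) ×ˢ Ioo (-(1 / 8)) (1 / 8)) \ N) w ε
  lower : ∀ x y, ‖x‖ ≤ 7 / 8 → |y| ≤ 1 / 8 → c₀ * |y| ^ (1 - a) - ε ≤ w (x, y)
  contact : ∀ p ∈ N, ‖p.1‖ ≤ 7 / 8 → 0 ≤ w p

variable {ε D l : ℝ} {N : Set (E n × ℝ)} {w : E n × ℝ → ℝ}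

/-- Comparison with a barrier in a cylinder. -/
lemma barrier_le (ha : -1 < a) (ha' : a < 1) (hw : Continuous w) (hN : IsClosed N) (hε : 0 < ε)
    {x₀ : E n} {r y₁ y₂ C A D : ℝ} (hD : D = 0 ∨ 0 ≤ y₁)
    (hsup : WeakSuper a ((ball x₀ r ×ˢ Ioo y₁ y₂) \ N) w ε)
    (hb : ∀ x y, ‖x - x₀‖ ≤ r → y ∈ Icc y₁ y₂ →
      (‖x - x₀‖ = r ∨ y = y₁ ∨ y = y₂ ∨ (x, y) ∈ N) →
      C + (n * A + ε) / (1 + a) * y ^ 2 + D * |y| ^ (1 - a) - A * ‖x - x₀‖ ^ 2 ≤ w (x, y))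
    (hr : 0 ≤ r) {y₀ : ℝ} (hy₀ : y₀ ∈ Icc y₁ y₂) :
    C + (n * A + ε) / (1 + a) * y₀ ^ 2 + D * |y₀| ^ (1 - a) ≤ w (x₀, y₀) := by
  have h1a : 0 < 1 + a := by linarith
  have hcomp := comparison ha hw (continuous_barrier ha' C ((n * A + ε) / (1 + a)) D)
    (K := closedBall x₀ r ×ˢ Icc y₁ y₂) (O := (ball x₀ r ×ˢ Ioo y₁ y₂) \ N)
    ((isCompact_closedBall x₀ r).prod isCompact_Icc)
    ((isOpen_ball.prod isOpen_Ioo).sdiff hN)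
    (sdiff_subset.trans (prod_mono ball_subset_closedBall Ioo_subset_Icc_self))
    (J := Ioo y₁ y₂) (fun p hp => hp.1.2) (A := A) (x₀ := x₀)
    (weakSubY_barrier ha ha' C ((n * A + ε) / (1 + a)) D
      (hD.imp_right fun h h' => absurd h'.1 (not_lt.2 h)))
    hsup (by
      have : 2 * (1 + a) * ((n * A + ε) / (1 + a)) = 2 * (n * A + ε) := by field_simp
      rw [this]; linarith)
    (by
      rintro ⟨x, y⟩ ⟨hx, hy⟩ hxy
      rw [mem_closedBall, dist_eq_norm] at hx
      refine hb x y hx hy ?_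
      by_contra! hcon
      refine hxy ⟨⟨?_, ?_⟩, hcon.2.2.2⟩
      · rw [mem_ball, dist_eq_norm]
        exact lt_of_le_of_ne hx hcon.1
      · exact ⟨lt_of_le_of_ne hy.1 (Ne.symm hcon.2.1), lt_of_le_of_ne hy.2 hcon.2.2.1⟩)
    (x₀, y₀) ⟨mem_closedBall_self hr, hy₀⟩
  simpa using hcomp

namespace IsIncrement

lemma super_cylinder (hw : IsIncrement a (4 * D) ε N w) {x₀ : E n} {r y₁ y₂ : ℝ}
    (hx : ‖x₀‖ + r ≤ 7 / 8) (h1 : -(1 / 8) ≤ y₁) (h2 : y₂ ≤ 1 / 8) :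
    WeakSuper a ((ball x₀ r ×ˢ Ioo y₁ y₂) \ N) w ε := by
  refine hw.super.mono (sdiff_subset_sdiff_left (prod_mono (ball_subset_ball' ?_)
    (Ioo_subset_Ioo h1 h2)))
  rw [dist_zero_right]; linarith

/-- Barrier By² - 128ε|x - x₀|² in a cylinder of radius 1/8: on the side the paraboloid equals 2ε
and By² ≤ ε, matching w ≥ -ε. At |y| = l one has w ≥ 3ε, and on N both y = 0 and w ≥ 0. -/
lemma nonneg (ha : -1 < a) (ha' : a < 1) (hw : IsIncrement a (4 * D) ε N w) (hε : 0 < ε)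
    (hl0 : 0 < l) (hl : l ≤ 1 / 8) (hln : (128 * n + 1) * l ^ 2 ≤ 1 + a)
    (hεD : ε ≤ D * l ^ (1 - a)) {x₀ : E n} (hx₀ : ‖x₀‖ ≤ 3 / 4) {y₀ : ℝ} (hy₀ : |y₀| ≤ l) :
    0 ≤ w (x₀, y₀) := by
  have h1a : 0 < 1 + a := by linarith
  set B := (n * (128 * ε) + ε) / (1 + a) with hB
  have hB0 : 0 ≤ B := by positivity
  have hBl : B * l ^ 2 ≤ ε := by
    rw [hB, div_mul_eq_mul_div, div_le_iff₀ h1a]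
    nlinarith
  have hBy : ∀ y, |y| ≤ l → B * y ^ 2 ≤ ε := fun y hy => by
    have : y ^ 2 ≤ l ^ 2 := sq_le_sq' (abs_le.1 hy).1 (abs_le.1 hy).2
    nlinarith
  have hnorm : ∀ x : E n, ‖x - x₀‖ ≤ 1 / 8 → ‖x‖ ≤ 7 / 8 := fun x hx => by
    have := norm_le_norm_add_norm_sub' x x₀
    linarith
  have key := barrier_le ha ha' hw.continuous hw.isClosed hε (x₀ := x₀) (r := 1 / 8) (y₁ := -l)
    (y₂ := l) (C := 0) (A := 128 * ε) (D := 0) (Or.inl rfl)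
    (hw.super_cylinder (by linarith) (by linarith) hl) (by
      intro x y hx hy hcase
      have hyl : |y| ≤ l := abs_le.2 hy
      have hlow := hw.lower x y (hnorm x hx) (hyl.trans hl)
      have h1 := hBy y hyl
      have hDl : 0 ≤ D * l ^ (1 - a) := hε.le.trans hεD
      have hD0 : 0 ≤ D := nonneg_of_mul_nonneg_left hDl (Real.rpow_pos_of_pos hl0 _)
      have hend : |y| = l → 3 * ε ≤ w (x, y) := fun h => by
        rw [h] at hlow; linarith
      have hyp : 0 ≤ D * |y| ^ (1 - a) := by positivity
      rw [← hB]
      rcases hcase with h | h | h | h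
      · rw [h]; nlinarith
      · have := hend (by rw [h, abs_neg, abs_of_pos hl0])
        nlinarith [mul_nonneg hε.le (sq_nonneg ‖x - x₀‖)]
      · have := hend (by rw [h, abs_of_pos hl0])
        nlinarith [mul_nonneg hε.le (sq_nonneg ‖x - x₀‖)]
      · have := hw.contact _ h (hnorm x hx)
        have h0 : y = 0 := hw.snd_eq_zero _ h
        have : B * y ^ 2 = 0 := by rw [h0]; ring
        nlinarith [mul_nonneg hε.le (sq_nonneg ‖x - x₀‖)])
    (by norm_num) (abs_le.1 hy₀)
  rw [← hB] at key
  nlinarith [mul_nonneg hB0 (sq_nonneg y₀)]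

/-- With w ≥ 0 known, the barrier By² + D|y|^{1-a} - 128m|x - x₀|², m = Dl^{1-a}, lies below w on
the boundary of the upper half cylinder: at most 2m - 2m on the side, 0 at y = 0, and 2m ≤ 4m - ε at
y = l. Working in y > 0 keeps the singular set of |y|^{1-a} out of the open region. -/
lemma rpow_le (ha : -1 < a) (ha' : a < 1) (hw : IsIncrement a (4 * D) ε N w) (hε : 0 < ε)
    (hl0 : 0 < l) (hl : l ≤ 1 / 8) (hln : (128 * n + 1) * l ^ 2 ≤ 1 + a)
    (hεD : ε ≤ D * l ^ (1 - a)) {x₀ : E n} (hx₀ : ‖x₀‖ ≤ 5 / 8) {y₀ : ℝ} (hy₀ : 0 ≤ y₀)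
    (hy₀' : y₀ ≤ l) : D * |y₀| ^ (1 - a) ≤ w (x₀, y₀) := by
  have h1a : 0 < 1 + a := by linarith
  set m := D * l ^ (1 - a) with hm
  have hm0 : 0 < m := hε.trans_le hεD
  have hD0 : 0 ≤ D := nonneg_of_mul_nonneg_left hm0.le (Real.rpow_pos_of_pos hl0 _)
  set B := (n * (128 * m) + ε) / (1 + a) with hB
  have hB0 : 0 ≤ B := by positivity
  have hBl : B * l ^ 2 ≤ m := by
    rw [hB, div_mul_eq_mul_div, div_le_iff₀ h1a]
    nlinarith [sq_nonneg l]
  have hnorm : ∀ x : E n, ‖x - x₀‖ ≤ 1 / 8 → ‖x‖ ≤ 3 / 4 := fun x hx => by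
    have := norm_le_norm_add_norm_sub' x x₀
    linarith
  have key := barrier_le ha ha' hw.continuous hw.isClosed hε (x₀ := x₀) (r := 1 / 8) (y₁ := 0)
    (y₂ := l) (C := 0) (A := 128 * m) (D := D) (Or.inr le_rfl)
    (hw.super_cylinder (by linarith) (by norm_num) hl) (by
      intro x y hx hy hcase
      have hyl : |y| ≤ l := by rw [abs_of_nonneg hy.1]; exact hy.2
      have h0 := hw.nonneg ha ha' hε hl0 hl hln hεD (hnorm x hx) hyl
      have h1 : B * y ^ 2 ≤ m := by
        have : y ^ 2 ≤ l ^ 2 := pow_le_pow_left₀ hy.1 hy.2 2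
        nlinarith
      have h2 : D * |y| ^ (1 - a) ≤ m :=
        mul_le_mul_of_nonneg_left (Real.rpow_le_rpow (abs_nonneg _) hyl (by linarith)) hD0
      have h3 := mul_nonneg hm0.le (sq_nonneg ‖x - x₀‖)
      have hzero : y = 0 → B * y ^ 2 + D * |y| ^ (1 - a) = 0 := fun h => by
        rw [h, abs_zero, Real.zero_rpow (by linarith)]; ring
      rw [← hB]
      rcases hcase with h | h | h | h
      · rw [h]; nlinarith
      · linarith [hzero h]
      · have hlow := hw.lower x y ((hnorm x hx).trans (by norm_num)) (hyl.trans hl)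
        rw [h, abs_of_pos hl0] at hlow h2
        rw [h] at h1 ⊢
        rw [abs_of_pos hl0]
        linarith
      · linarith [hzero (hw.snd_eq_zero _ h)])
    (by norm_num) ⟨hy₀, hy₀'⟩
  rw [← hB] at key
  nlinarith [mul_nonneg hB0 (sq_nonneg y₀)]

/-- The quantitative lower bound for a difference quotient. -/
lemma lower_bound (ha : -1 < a) (ha' : a < 1) (hw : IsIncrement a (4 * D) ε N w) (hε : 0 < ε)
    (heven : ∀ x y, ‖x‖ ≤ 7 / 8 → |y| ≤ 1 / 8 → w (x, -y) = w (x, y))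
    (hl0 : 0 < l) (hl : l ≤ 1 / 8) (hln : (128 * n + 1) * l ^ 2 ≤ 1 + a)
    (hεD : 4 * ε ≤ D * l ^ (1 - a)) {x₀ : E n} (hx₀ : ‖x₀‖ ≤ 1 / 2) {y₀ : ℝ} (hy₀ : |y₀| ≤ 1 / 8)
    {r : ℝ} (hr0 : 0 ≤ r) (hr : r ≤ 1 / 8)
    (hN : |y₀| ≤ l * r → 0 < r → ∀ x y, ‖x - x₀‖ ≤ r → |y| ≤ l * r → (x, y) ∉ N) :
    D * (l * r) ^ (1 - a) / 2 ≤ w (x₀, y₀) := by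
  have h1a : 0 < 1 + a := by linarith
  have hεD' : ε ≤ D * l ^ (1 - a) := by linarith
  have hD0 : 0 ≤ D := nonneg_of_mul_nonneg_left (hε.le.trans hεD') (Real.rpow_pos_of_pos hl0 _)
  have hlr : l * r ≤ l := by nlinarith
  have hlr0 : 0 ≤ l * r := by positivity
  have habs : ∀ x : E n, ‖x‖ ≤ 5 / 8 → ∀ y, |y| ≤ l → D * |y| ^ (1 - a) ≤ w (x, y) := by
    intro x hx y hy
    rcases le_total 0 y with h | h
    · exact hw.rpow_le ha ha' hε hl0 hl hln hεD' hx h (by rwa [abs_of_nonneg h] at hy)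
    · have := hw.rpow_le ha ha' hε hl0 hl hln hεD' hx (y₀ := -y) (by linarith)
        (by rwa [abs_of_nonpos h] at hy)
      rwa [abs_neg, heven x y (by linarith) (hy.trans hl)] at this
  -- Half of the value guaranteed at |y| = lr. The barrier δ + By² - 2δ|x - x₀|²/r², with By² ≤ δ,
  -- is then at most 2δ at |y| = lr and at most 0 at |x - x₀| = r.
  set δ := D * (l * r) ^ (1 - a) / 2 with hδ
  have hδ0 : 0 ≤ δ := by positivity
  rcases lt_or_ge (l * r) |y₀| with hy | hy
  · have h1 : D * (l * r) ^ (1 - a) ≤ D * |y₀| ^ (1 - a) :=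
      mul_le_mul_of_nonneg_left (Real.rpow_le_rpow hlr0 hy.le (by linarith)) hD0
    rcases le_total |y₀| l with hyl | hyl
    · have := habs x₀ (by linarith) y₀ hyl
      linarith
    · have h2 : D * l ^ (1 - a) ≤ D * |y₀| ^ (1 - a) :=
        mul_le_mul_of_nonneg_left (Real.rpow_le_rpow hl0.le hyl (by linarith)) hD0
      have := hw.lower x₀ y₀ (by linarith) hy₀
      linarith
  rcases hr0.eq_or_lt with h0 | hr0
  · rw [← h0, mul_zero, Real.zero_rpow (by linarith), mul_zero, zero_div] at hδ
    rw [hδ]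
    exact hw.nonneg ha ha' hε hl0 hl hln hεD' (by linarith) (hy.trans hlr)
  · have hN' := hN hy hr0
    -- The right-hand side stays subordinate at every scale r because r² ≤ r^{1-a}.
    have hεr : ε * r ^ 2 ≤ δ := by
      have h1 : r ^ 2 ≤ r ^ (1 - a) := by
        rw [← Real.rpow_natCast r 2]
        exact Real.rpow_le_rpow_of_exponent_ge hr0 (by linarith) (by push_cast; linarith)
      have h2 : 0 < r ^ (1 - a) := Real.rpow_pos_of_pos hr0 _
      rw [hδ, Real.mul_rpow hl0.le hr0.le]
      nlinarith
    set B := (n * (2 * δ / r ^ 2) + ε) / (1 + a) with hB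
    have hB0 : 0 ≤ B := by positivity
    have hBl : B * (l * r) ^ 2 ≤ δ := by
      rw [hB, div_mul_eq_mul_div, div_le_iff₀ h1a]
      have : (n * (2 * δ / r ^ 2) + ε) * (l * r) ^ 2 = (2 * n * δ + ε * r ^ 2) * l ^ 2 := by
        field_simp
      rw [this]
      have h2 : (2 * n * δ + ε * r ^ 2) * l ^ 2 ≤ (128 * n * δ + δ) * l ^ 2 := by
        refine mul_le_mul_of_nonneg_right ?_ (sq_nonneg l)
        have : (0 : ℝ) ≤ n * δ := by positivity
        linarith
      nlinarith
    have hnorm : ∀ x : E n, ‖x - x₀‖ ≤ r → ‖x‖ ≤ 5 / 8 := fun x hx => by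
      have := norm_le_norm_add_norm_sub' x x₀
      linarith
    have key := barrier_le ha ha' hw.continuous hw.isClosed hε (x₀ := x₀) (r := r)
      (y₁ := -(l * r)) (y₂ := l * r) (C := δ) (A := 2 * δ / r ^ 2) (D := 0) (Or.inl rfl)
      (hw.super_cylinder (by linarith) (by linarith) (by linarith)) (by
        intro x y hx hy hcase
        have hyl : |y| ≤ l * r := abs_le.2 hy
        have h0 := hw.nonneg ha ha' hε hl0 hl hln hεD' ((hnorm x hx).trans (by norm_num))
          (hyl.trans hlr)
        have h1 : B * y ^ 2 ≤ δ := by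
          have : y ^ 2 ≤ (l * r) ^ 2 := sq_le_sq' hy.1 hy.2
          nlinarith
        have h3 : 0 ≤ 2 * δ / r ^ 2 * ‖x - x₀‖ ^ 2 := by positivity
        have hend : |y| = l * r → 2 * δ ≤ w (x, y) := fun h => by
          have := habs x (hnorm x hx) y (hyl.trans hlr)
          rw [h] at this
          rw [hδ]; linarith
        rw [← hB]
        rcases hcase with h | h | h | h
        · rw [h, div_mul_cancel₀ _ (by positivity)]; linarith
        · have := hend (by rw [h, abs_neg, abs_of_nonneg hlr0])
          linarith
        · have := hend (by rw [h, abs_of_nonneg hlr0])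
          linarith
        · exact absurd h (hN' x y hx hyl))
      hr0.le (abs_le.1 hy)
    rw [← hB] at key
    nlinarith [mul_nonneg hB0 (sq_nonneg y₀)]

end IsIncrement

end

/-! ### Difference quotients of a solution -/

lemma form_congr {w v : E n × ℝ → ℝ} {η : E n → ℝ} {χ : ℝ → ℝ}
    (h : ∀ x ∈ tsupport η, ∀ y ∈ tsupport χ, w (x, y) = v (x, y)) :
    form a w η χ = form a v η χ := by
  unfold form
  refine integral_congr_ae (.of_forall fun y => ?_)
  simp only
  by_cases hy : y ∈ tsupport χ
  · have hi : ∀ ψ : E n → ℝ, tsupport ψ ⊆ tsupport η →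
        ∫ x, w (x, y) * ψ x = ∫ x, v (x, y) * ψ x := by
      intro ψ hψ
      refine integral_congr_ae (.of_forall fun x => ?_)
      simp only
      by_cases hx : x ∈ tsupport ψ
      · rw [h x (hψ hx) y hy]
      · rw [image_eq_zero_of_notMem_tsupport hx, mul_zero, mul_zero]
    rw [hi _ (tsupport_lap_subset η), hi η subset_rfl]
  · rw [image_eq_zero_of_notMem_tsupport hy,
      image_eq_zero_of_notMem_tsupport fun h => hy (tsupport_wd_subset a χ h)]
    simp

lemma norm_pt_le_of_le {x : E n} {y : ℝ} (hx : ‖x‖ ≤ 29 / 32) (hy : |y| ≤ 1 / 8) :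
    ‖pt x y‖ ≤ 15 / 16 := by
  refine le_of_sq_le_sq ?_ (by norm_num)
  rw [norm_pt_sq, ← sq_abs y]
  nlinarith [norm_nonneg x, abs_nonneg y]

lemma pt_mem_ball {x : E n} {y : ℝ} (hx : ‖x‖ ≤ 29 / 32) (hy : |y| ≤ 1 / 8) :
    pt x y ∈ ball (0 : E (n + 1)) 1 := by
  rw [mem_ball_zero_iff]
  linarith [norm_pt_le_of_le hx hy]

/-- The comparison machinery takes globally continuous functions, so u is extended by Tietze from a
closed ball. The radius 29/32 = 7/8 + 1/32 leaves room for translations of length at most 1/32. -/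
lemma exists_continuous_extension {u : E (n + 1) → ℝ} (hu : ContinuousOn u (ball 0 1)) :
    ∃ U : E n × ℝ → ℝ, Continuous U ∧
      ∀ x y, ‖x‖ ≤ 29 / 32 → |y| ≤ 1 / 8 → U (x, y) = u (pt x y) := by
  have hc : ContinuousOn u (closedBall 0 (15 / 16)) :=
    hu.mono (closedBall_subset_ball (by norm_num))
  obtain ⟨v, hv⟩ := ContinuousMap.exists_restrict_eq
    (isClosed_closedBall (x := (0 : E (n + 1))) (ε := 15 / 16)) ⟨_, hc.domRestrict⟩
  refine ⟨fun p => v (pt p.1 p.2), v.continuous.comp continuous_pt, fun x y hx hy => ?_⟩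
  have := congrArg (fun f => f ⟨pt x y, by
    rw [mem_closedBall_zero_iff]; exact norm_pt_le_of_le hx hy⟩) hv
  simpa using this

lemma hasDerivAt_tangential {u : E (n + 1) → ℝ} {x τ : E n} {y t : ℝ}
    (h : DifferentiableXAt u (pt (x + t • τ) y)) :
    HasDerivAt (fun t : ℝ => u (pt (x + t • τ) y))
      (inner ℝ (gradX u (pt (x + t • τ) y)) τ) t := by
  rw [DifferentiableXAt, xPart_pt, yPart_pt] at h
  rw [gradX, xPart_pt, yPart_pt, inner_gradient_left]
  have h1 : HasDerivAt (fun t : ℝ => x + t • τ) τ t := by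
    simpa using ((hasDerivAt_id t).smul_const τ).const_add x
  exact h.hasFDerivAt.comp_hasDerivAt t h1

lemma lineDeriv_eq_inner_gradX {u : E (n + 1) → ℝ} {x τ : E n} {y : ℝ}
    (h : DifferentiableXAt u (pt x y)) :
    lineDeriv ℝ u (pt x y) (pt τ 0) = inner ℝ (gradX u (pt x y)) τ := by
  have h1 := hasDerivAt_tangential (u := u) (x := x) (τ := τ) (y := y) (t := 0) (by simpa using h)
  rw [zero_smul, add_zero] at h1
  rw [lineDeriv]
  simp only [smul_pt, pt_add, mul_zero, add_zero]
  exact h1.deriv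

/-- Translating the test moves the increment onto g, where the Lipschitz bound applies. The globally
Lipschitz extension supplies the continuity needed for integrability. -/
lemma integral_mul_translate_sub_le {g : E n → ℝ} {ε : ℝ} (hε : 0 ≤ ε)
    (hg : ∀ x ∈ ball (0 : E n) 1, ∀ x' ∈ ball (0 : E n) 1, |g x - g x'| ≤ ε * ‖x - x'‖)
    {η : E n → ℝ} (hη : Smc η) (hη0 : ∀ x, 0 ≤ η x) {v : E n}
    (h1 : ∀ x ∈ tsupport η, x ∈ ball (0 : E n) 1)
    (h2 : ∀ x ∈ tsupport η, x + v ∈ ball (0 : E n) 1) :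
    (∫ x, g x * η (x - v)) - ∫ x, g x * η x ≤ ε * ‖v‖ * ∫ x, η x := by
  obtain ⟨G, hG, hGe⟩ := LipschitzOnWith.extend_real (f := g) (s := ball (0 : E n) 1)
    (K := ε.toNNReal) (LipschitzOnWith.of_dist_le_mul fun x hx x' hx' => by
      rw [Real.dist_eq, dist_eq_norm, Real.coe_toNNReal _ hε]
      exact hg x hx x' hx')
  have e1 : ∫ x, g x * η (x - v) = ∫ x, G (x + v) * η x := by
    rw [← integral_add_right_eq_self _ v]
    refine integral_congr_ae (.of_forall fun x => ?_)
    simp only [add_sub_cancel_right]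
    by_cases hx : x ∈ tsupport η
    · rw [hGe (h2 x hx)]
    · rw [image_eq_zero_of_notMem_tsupport hx, mul_zero, mul_zero]
  have e2 : ∫ x, g x * η x = ∫ x, G x * η x := by
    refine integral_congr_ae (.of_forall fun x => ?_)
    simp only
    by_cases hx : x ∈ tsupport η
    · rw [hGe (h1 x hx)]
    · rw [image_eq_zero_of_notMem_tsupport hx, mul_zero, mul_zero]
  have hGc := hG.continuous
  have hηc := hη.smooth.continuous
  have i1 : Integrable fun x => G (x + v) * η x :=
    (by fun_prop : Continuous fun x => G (x + v) * η x).integrable_of_hasCompactSupport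
      hη.cs.mul_left
  have i2 : Integrable fun x => G x * η x :=
    (by fun_prop : Continuous fun x => G x * η x).integrable_of_hasCompactSupport hη.cs.mul_left
  rw [e1, e2, ← integral_sub i1 i2, ← integral_const_mul]
  refine integral_mono (i1.sub i2) ((hηc.integrable_of_hasCompactSupport hη.cs).const_mul _)
    fun x => ?_
  have h3 := hG.dist_le_mul (x + v) x
  rw [Real.dist_eq, dist_eq_norm, add_sub_cancel_left, Real.coe_toNNReal _ hε] at h3
  simp only
  rw [← sub_mul]
  exact mul_le_mul_of_nonneg_right ((le_abs_self _).trans h3) (hη0 x)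

/-- Difference quotients of a solution satisfy the hypotheses of the barrier argument. -/
lemma exists_isIncrement (ha : -1 < a) {g : E n → ℝ} {u : E (n + 1) → ℝ} {ε c₀ : ℝ}
    (hε : 0 < ε) (hu : IsSolution a (ball 0 1) g u)
    (hg : ∀ x ∈ ball (0 : E n) 1, ∀ x' ∈ ball (0 : E n) 1, |g x - g x'| ≤ ε * ‖x - x'‖)
    (hdiff : ∀ X ∈ ball (0 : E (n + 1)) 1, DifferentiableXAt u X) {τ : E n} (hτ : ‖τ‖ = 1)
    (hlow : ∀ x y, pt x y ∈ ball (0 : E (n + 1)) 1 →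
      c₀ * |y| ^ (1 - a) - ε ≤ inner ℝ (gradX u (pt x y)) τ)
    {h : ℝ} (hh0 : 0 < h) (hh : h ≤ 1 / 32) :
    ∃ (N : Set (E n × ℝ)) (w : E n × ℝ → ℝ), IsIncrement a c₀ ε N w ∧
      (∀ x y, ‖x‖ ≤ 7 / 8 → |y| ≤ 1 / 8 → w (x, -y) = w (x, y)) ∧
      (∀ x y, ‖x‖ ≤ 7 / 8 → |y| ≤ 1 / 8 → (x, y) ∈ N → pt x y ∈ contactSet (ball 0 1) u) ∧
      ∀ x y, ‖x‖ ≤ 7 / 8 → |y| ≤ 1 / 8 →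
        w (x, y) = h⁻¹ * (u (pt (x + h • τ) y) - u (pt x y)) := by
  obtain ⟨U, hUc, hU⟩ := exists_continuous_extension hu.continuousOn
  have hhτ : ‖h • τ‖ = h := by rw [norm_smul, hτ, mul_one, Real.norm_of_nonneg hh0.le]
  have hshift : ∀ x : E n, ‖x‖ ≤ 7 / 8 → ∀ t ∈ Icc 0 h, ‖x + t • τ‖ ≤ 29 / 32 := by
    intro x hx t ht
    have h1 := norm_add_le x (t • τ)
    rw [norm_smul, hτ, mul_one, Real.norm_of_nonneg ht.1] at h1
    linarith [ht.2]
  have hshift1 : ∀ x : E n, ‖x‖ ≤ 7 / 8 → ‖x + h • τ‖ ≤ 29 / 32 := fun x hx =>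
    hshift x hx h (right_mem_Icc.2 hh0.le)
  have hUh : Continuous fun p : E n × ℝ => U (p.1 + h • τ, p.2) := by fun_prop
  set N : Set (E n × ℝ) := {p | p.2 = 0 ∧ U p = 0} with hN
  set w : E n × ℝ → ℝ := fun p => h⁻¹ * (U (p.1 + h • τ, p.2) - U p) with hw
  have hweq : ∀ x y, ‖x‖ ≤ 7 / 8 → |y| ≤ 1 / 8 →
      w (x, y) = h⁻¹ * (u (pt (x + h • τ) y) - u (pt x y)) := fun x y hx hy => by
    simp only [hw]
    rw [hU _ _ (hshift1 x hx) hy, hU _ _ (by linarith) hy]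
  have hmem : ∀ x y, ‖x‖ ≤ 7 / 8 → |y| ≤ 1 / 8 →
      ((x, y) ∈ N ↔ pt x y ∈ contactSet (ball 0 1) u) := fun x y hx hy => by
    have hx' : ‖x‖ ≤ 29 / 32 := by linarith
    simp only [hN, contactSet, mem_ofPred_eq, yPart_pt, hU x y hx' hy, pt_mem_ball hx' hy, true_and]
  refine ⟨N, w, ⟨by fun_prop, ?_, fun p hp => hp.1, ?_, ?_, ?_⟩, ?_, ?_, hweq⟩
  · exact (isClosed_eq continuous_snd continuous_const).inter (isClosed_eq hUc continuous_const)
  · intro η χ hη hχ hη0 hχ0 hsupp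
    have hin : ∀ x ∈ tsupport η, ∀ y ∈ tsupport χ,
        ‖x‖ ≤ 7 / 8 ∧ |y| ≤ 1 / 8 ∧ (x, y) ∉ N := by
      intro x hx y hy
      obtain ⟨⟨h1, h2⟩, h3⟩ := hsupp (mk_mem_prod hx hy)
      rw [mem_ball_zero_iff] at h1
      exact ⟨h1.le, abs_le.2 ⟨h2.1.le, h2.2.le⟩, h3⟩
    have hI : 0 ≤ ∫ y, |y| ^ a * χ y :=
      integral_nonneg fun y => mul_nonneg (Real.rpow_nonneg (abs_nonneg _) _) (hχ0 y)
    by_cases hne : (tsupport χ).Nonempty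
    swap
    · have hχ0 : χ = 0 := by
        rwa [not_nonempty_iff_eq_empty, tsupport_eq_empty_iff] at hne
      have : form a w η χ = form a (fun _ => 0) η χ := form_congr fun x _ y hy =>
        absurd ⟨y, hy⟩ hne
      rw [this, hχ0]
      simp [form]
    obtain ⟨y₀, hy₀⟩ := hne
    have hη1 : ∀ x ∈ tsupport η, ‖x‖ ≤ 7 / 8 := fun x hx => (hin x hx y₀ hy₀).1
    have hball : ∀ x : E n, ‖x‖ ≤ 29 / 32 → x ∈ ball (0 : E n) 1 := fun x hx => by
      rw [mem_ball_zero_iff]; linarith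
    have htr : ∀ x ∈ tsupport (fun x => η (x - h • τ)), x - h • τ ∈ tsupport η := fun x hx =>
      tsupport_comp_sub_right η _ hx
    have htr' : ∀ x ∈ tsupport (fun x => η (x - h • τ)), ‖x‖ ≤ 29 / 32 := fun x hx => by
      have := hshift1 _ (hη1 _ (htr x hx))
      rwa [sub_add_cancel] at this
    have hy1 : ∀ x ∈ tsupport (fun x => η (x - h • τ)), ∀ y ∈ tsupport χ, |y| ≤ 1 / 8 :=
      fun x hx y hy => (hin _ (htr x hx) y hy).2.1
    -- The translate may meet its own contact set, so only the supersolution inequality is available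
    -- for it. For u, which enters with a minus sign, the equality off N is needed.
    have f1 : form a U (fun x => η (x - h • τ)) χ ≤
        (∫ y, |y| ^ a * χ y) * ∫ x, g x * η (x - h • τ) := by
      rw [form_congr (v := fun p => u (pt p.1 p.2)) fun x hx y hy =>
        hU x y (htr' x hx) (hy1 x hx y hy)]
      exact hu.form_le ha isOpen_ball (hη.comp_sub_right _) hχ (fun x => hη0 _) hχ0
        fun x hx y hy => pt_mem_ball (htr' x hx) (hy1 x hx y hy)
    have f2 : form a U η χ = (∫ y, |y| ^ a * χ y) * ∫ x, g x * η x := by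
      rw [form_congr (v := fun p => u (pt p.1 p.2)) fun x hx y hy =>
        hU x y ((hη1 x hx).trans (by norm_num)) (hin x hx y hy).2.1]
      refine hu.form_eq ha isOpen_ball hη hχ fun x hx y hy => ?_
      obtain ⟨k1, k2, k3⟩ := hin x hx y hy
      exact ⟨pt_mem_ball (k1.trans (by norm_num)) k2, fun k => k3 ((hmem x y k1 k2).2 k)⟩
    have f3 := integral_mul_translate_sub_le hε.le hg hη hη0 (v := h • τ)
      (fun x hx => hball x ((hη1 x hx).trans (by norm_num)))
      (fun x hx => hball _ (hshift1 x (hη1 x hx)))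
    rw [hhτ] at f3
    rw [hw, form_const_mul, form_sub ha hUh hUc hη hχ, form_translate, f2,
      inv_mul_le_iff₀ hh0]
    calc _ ≤ (∫ y, |y| ^ a * χ y) * ((∫ x, g x * η (x - h • τ)) - ∫ x, g x * η x) := by
          rw [mul_sub]; linarith
      _ ≤ (∫ y, |y| ^ a * χ y) * (ε * h * ∫ x, η x) := mul_le_mul_of_nonneg_left f3 hI
      _ = _ := by ring
  · intro x y hx hy
    have hd : ∀ t ∈ Icc 0 h, HasDerivAt (fun t : ℝ => u (pt (x + t • τ) y))
        (inner ℝ (gradX u (pt (x + t • τ) y)) τ) t := fun t ht =>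
      hasDerivAt_tangential (hdiff _ (pt_mem_ball (hshift x hx t ht) hy))
    have hmvt := (convex_Icc 0 h).mul_sub_le_image_sub_of_le_deriv
      (fun t ht => (hd t ht).continuousAt.continuousWithinAt)
      (fun t ht => (hd t (interior_subset ht)).differentiableAt.differentiableWithinAt)
      (C := c₀ * |y| ^ (1 - a) - ε)
      (fun t ht => by
        rw [(hd t (interior_subset ht)).deriv]
        exact hlow _ _ (pt_mem_ball (hshift x hx t (interior_subset ht)) hy))
      0 (left_mem_Icc.2 hh0.le) h (right_mem_Icc.2 hh0.le) hh0.le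
    rw [zero_smul, add_zero, sub_zero] at hmvt
    rw [hweq x y hx hy, inv_mul_eq_div, le_div_iff₀ hh0]
    exact hmvt
  · rintro ⟨x, y⟩ ⟨hy, hU0⟩ hx
    simp only at hy hx
    subst hy
    have h0 : |(0 : ℝ)| ≤ 1 / 8 := by norm_num
    rw [hweq x 0 hx h0, ← hU x 0 (by linarith) h0, hU0, sub_zero]
    exact mul_nonneg (inv_nonneg.2 hh0.le) (hu.nonneg _ (pt_mem_ball (hshift1 x hx) h0))
  · intro x y hx hy
    rw [hweq x y hx hy, hweq x (-y) hx (by rwa [abs_neg]),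
      hu.even _ y (pt_mem_ball (hshift1 x hx) hy), hu.even x y (pt_mem_ball (by linarith) hy)]
  · exact fun x y hx hy => (hmem x y hx hy).1

/-- The lower bound for the tangential derivative near points at which a cylinder free of contact
points is centred. -/
lemma gradX_lower_bound (ha : -1 < a) (ha' : a < 1) {g : E n → ℝ} {u : E (n + 1) → ℝ} {ε D l : ℝ}
    (hε : 0 < ε) (hu : IsSolution a (ball 0 1) g u)
    (hg : ∀ x ∈ ball (0 : E n) 1, ∀ x' ∈ ball (0 : E n) 1, |g x - g x'| ≤ ε * ‖x - x'‖)
    (hdiff : ∀ X ∈ ball (0 : E (n + 1)) 1, DifferentiableXAt u X) {τ : E n} (hτ : ‖τ‖ = 1)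
    (hlow : ∀ x y, pt x y ∈ ball (0 : E (n + 1)) 1 →
      4 * D * |y| ^ (1 - a) - ε ≤ inner ℝ (gradX u (pt x y)) τ)
    (hl0 : 0 < l) (hl : l ≤ 1 / 8) (hln : (128 * n + 1) * l ^ 2 ≤ 1 + a)
    (hεD : 4 * ε ≤ D * l ^ (1 - a)) {x₀ : E n} (hx₀ : ‖x₀‖ ≤ 1 / 2) {y₀ : ℝ} (hy₀ : |y₀| ≤ 1 / 8)
    {r : ℝ} (hr0 : 0 ≤ r) (hr : r ≤ 1 / 8)
    (hN : |y₀| ≤ l * r → 0 < r → ∀ x y, ‖x - x₀‖ ≤ r → |y| ≤ l * r →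
      pt x y ∉ contactSet (ball 0 1) u) :
    D * (l * r) ^ (1 - a) / 2 ≤ inner ℝ (gradX u (pt x₀ y₀)) τ := by
  have hd := hasDerivAt_tangential (u := u) (x := x₀) (τ := τ) (y := y₀) (t := 0)
    (hdiff _ (pt_mem_ball (by rw [zero_smul, add_zero]; linarith) hy₀))
  rw [zero_smul, add_zero] at hd
  refine ge_of_tendsto hd.tendsto_slope_zero_right ?_
  filter_upwards [Ioo_mem_nhdsGT (show (0 : ℝ) < 1 / 32 by norm_num)] with h hh
  obtain ⟨N, w, hw, heven, hNc, hweq⟩ := exists_isIncrement ha hε hu hg hdiff hτ hlow hh.1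
    hh.2.le
  have key := hw.lower_bound ha ha' hε heven hl0 hl hln hεD hx₀ hy₀ hr0 hr
    (fun h1 h2 x y hx hy hxy => hN h1 h2 x y hx hy (hNc x y (by
      have := norm_le_norm_add_norm_sub' x x₀
      linarith) (by nlinarith) hxy))
  rw [hweq x₀ y₀ (by linarith) hy₀] at key
  simpa using key

end ThinObstacle

end

/-! ### Choice of constants and conclusion -/

theorem mainTheorem10 (n : ℕ) (a : ℝ) (ha : -1 < a) (ha' : a < 1) :
    ∃ ε₀ : ℝ, 0 < ε₀ ∧ ∃ c : ℝ, 0 < c ∧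
      ∀ (g : ThinObstacle.E n → ℝ) (u u₀ : ThinObstacle.E (n + 1) → ℝ) (e : ThinObstacle.E n),
        -- `u` solves the problem in `B_1`, with `|g|` and `|∇g|` at most `ε₀`
        ThinObstacle.IsSolution a (Metric.ball 0 1) g u →
        (∀ x ∈ Metric.ball (0 : ThinObstacle.E n) 1, |g x| ≤ ε₀) →
        (∀ x ∈ Metric.ball (0 : ThinObstacle.E n) 1, ∀ x' ∈ Metric.ball (0 : ThinObstacle.E n) 1,
          |g x - g x'| ≤ ε₀ * ‖x - x'‖) →
        -- `e` is the normal to the free boundary of `u₀` that points out of its contact set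
        ThinObstacle.IsGlobalProfile a u₀ →
        ‖e‖ = 1 →
        ThinObstacle.contactSet Set.univ u₀ =
          {X | ThinObstacle.yPart X = 0 ∧ inner ℝ (ThinObstacle.xPart X) e ≤ 0} →
        (∀ X ∈ Metric.ball (0 : ThinObstacle.E (n + 1)) 1, ThinObstacle.DifferentiableXAt u X ∧
          ‖ThinObstacle.gradX u X - ThinObstacle.gradX u₀ X‖ ≤ ε₀) →
        (ThinObstacle.contactSet (Metric.ball 0 1) u).Nonempty ∧
        ∀ τ : ThinObstacle.E n, ‖τ‖ = 1 → ‖τ - e‖ < 1 / 2 →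
          ∀ X ∈ Metric.ball (0 : ThinObstacle.E (n + 1)) (1 / 8),
            c * Metric.infDist X (ThinObstacle.contactSet (Metric.ball 0 1) u)
                ^ (2 * ThinObstacle.sExp a)
              ≤ lineDeriv ℝ u X (ThinObstacle.pt τ 0) := by
  open ThinObstacle in
  obtain ⟨c₀, hc₀, hgrad⟩ := exists_profile_gradient_bound n ha ha'
  have hp : 2 * sExp a = 1 - a := by rw [sExp]; ring
  rw [hp] at hgrad ⊢
  have h1a : 0 < 1 + a := by linarith
  set K : ℝ := (128 * n + 1) / (1 + a) with hK
  have hK0 : 0 < K := by positivity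
  -- Thin enough that l ≤ 1/8 and Kl² ≤ 1, the aspect-ratio condition shared by the three barriers.
  set l : ℝ := 1 / (8 * (1 + K)) with hldef
  have hl0 : 0 < l := by positivity
  have hl : l ≤ 1 / 8 := by
    rw [hldef]; exact one_div_le_one_div_of_le (by norm_num) (by linarith)
  have hln : (128 * n + 1) * l ^ 2 ≤ 1 + a := by
    have h1 : K * (1 + a) = 128 * n + 1 := by rw [hK]; field_simp
    have h2 : l * (1 + K) = 1 / 8 := by rw [hldef]; field_simp
    have h3 : K * l ≤ 1 := by nlinarith
    have h4 : K * l ^ 2 ≤ 1 := by nlinarith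
    rw [← h1]
    nlinarith
  set D : ℝ := c₀ / 4 with hD
  have hD0 : 0 < D := by positivity
  -- With r = 1/8 the lower bound for the derivative is 2ε, which contradicts |u_e| ≤ ε at -e/2 if Λ
  -- is empty.
  set ε : ℝ := D * (l * (1 / 8)) ^ (1 - a) / 4 with hεdef
  have hε : 0 < ε := by positivity
  have hεD : 4 * ε ≤ D * l ^ (1 - a) := by
    have : (l * (1 / 8)) ^ (1 - a) ≤ l ^ (1 - a) :=
      Real.rpow_le_rpow (by positivity) (by linarith) (by linarith)
    rw [hεdef]
    nlinarith
  refine ⟨ε, hε, D * (l / 16) ^ (1 - a) / 2, by positivity, ?_⟩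
  intro g u u₀ e hu _ hg hu₀ he hΛ hnear
  have hlow : ∀ τ : E n, ‖τ‖ = 1 → ‖τ - e‖ < 1 / 2 → ∀ x y,
      pt x y ∈ Metric.ball (0 : E (n + 1)) 1 →
        4 * D * |y| ^ (1 - a) - ε ≤ inner ℝ (gradX u (pt x y)) τ := by
    intro τ hτ hτe x y hxy
    have h1 := hgrad u₀ e hu₀ he hΛ τ hτ hτe x y hxy
    have h2 := abs_real_inner_le_norm (gradX u (pt x y) - gradX u₀ (pt x y)) τ
    rw [hτ, mul_one, inner_sub_left] at h2
    have h3 := (abs_le.1 (h2.trans (hnear _ hxy).2)).1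
    have h4 : 4 * D = c₀ := by rw [hD]; ring
    rw [h4]
    linarith
  have key := fun (τ : E n) (hτ : ‖τ‖ = 1) (hτe : ‖τ - e‖ < 1 / 2) (x₀ : E n)
    (hx₀ : ‖x₀‖ ≤ 1 / 2) (y₀ : ℝ) (hy₀ : |y₀| ≤ 1 / 8) (r : ℝ) (hr0 : 0 ≤ r) (hr : r ≤ 1 / 8) =>
    gradX_lower_bound ha ha' hε hu hg (fun X hX => (hnear X hX).1) hτ (hlow τ hτ hτe) hl0 hl hln
      hεD hx₀ hy₀ hr0 hr
  have hne : (contactSet (Metric.ball 0 1) u).Nonempty := by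
    by_contra hemp
    have hx₀ : ‖(-(1 / 2 : ℝ)) • e‖ = 1 / 2 := by rw [norm_smul, he]; norm_num
    have h0 : |(0 : ℝ)| ≤ 1 / 8 := by norm_num
    have h1 := key e he (by simp) ((-(1 / 2 : ℝ)) • e) hx₀.le 0 h0 (1 / 8) (by norm_num) le_rfl
      fun _ _ x y _ _ h => hemp ⟨_, h⟩
    have h2 := (hnear (pt ((-(1 / 2 : ℝ)) • e) 0)
      (pt_mem_ball (by rw [hx₀]; norm_num) h0)).2
    rw [gradX_eq_zero_of_inner_neg hΛ (by
      rw [real_inner_smul_left, real_inner_self_eq_norm_sq, he]; norm_num), sub_zero] at h2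
    have h3 := (le_abs_self _).trans
      (abs_real_inner_le_norm (gradX u (pt ((-(1 / 2 : ℝ)) • e) 0)) e)
    rw [he, mul_one] at h3
    linarith
  refine ⟨hne, fun τ hτ hτe X hX => ?_⟩
  obtain ⟨x, y, rfl⟩ : ∃ x y, X = pt x y := ⟨_, _, (pt_xPart_yPart _).symm⟩
  rw [mem_ball_zero_iff] at hX
  have hsq := norm_pt_sq x y
  have hx : ‖x‖ ≤ 1 / 8 := by
    have : ‖x‖ ≤ ‖pt x y‖ := le_of_sq_le_sq (by rw [hsq]; nlinarith) (norm_nonneg _)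
    linarith
  have hy : |y| ≤ 1 / 8 := by
    have : |y| ≤ ‖pt x y‖ := le_of_sq_le_sq (by rw [hsq, sq_abs]; nlinarith [sq_nonneg ‖x‖])
      (norm_nonneg _)
    linarith
  rw [lineDeriv_eq_inner_gradX (hnear _ (by rw [mem_ball_zero_iff]; linarith)).1]
  set d := Metric.infDist (pt x y) (contactSet (Metric.ball 0 1) u) with hd
  have hd0 : 0 ≤ d := Metric.infDist_nonneg
  have hd2 : d ≤ 2 := by
    obtain ⟨Y, hY⟩ := hne
    have h1 := Metric.infDist_le_dist_of_mem (x := pt x y) hY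
    have h2 := hY.1
    rw [mem_ball_zero_iff] at h2
    rw [dist_eq_norm] at h1
    have := norm_sub_le (pt x y) Y
    linarith
  -- d ≤ 2 gives r = d/16 ≤ 1/8. When |y| ≤ lr, every point of the cylinder is within r + 2lr ≤ 5r/4
  -- < d of X, so the cylinder contains no contact point.
  have hfin := key τ hτ hτe x (by linarith) y hy (d / 16) (by positivity) (by linarith) (by
    intro hyr hr x' y' hx' hy' hmem
    have h1 := Metric.infDist_le_dist_of_mem (x := pt x y) hmem
    have h2 : pt x y - pt x' y' = pt (x - x') (y - y') := by
      rw [sub_eq_iff_eq_add, pt_add, sub_add_cancel, sub_add_cancel]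
    rw [dist_eq_norm, h2, ← hd] at h1
    have h3 := norm_pt_le (x - x') (y - y')
    rw [norm_sub_rev] at h3
    have h4 := abs_sub y y'
    nlinarith)
  refine le_trans (le_of_eq ?_) hfin
  rw [show l * (d / 16) = l / 16 * d by ring, Real.mul_rpow (by positivity) hd0]
  ring
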